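/- Let $K$ be an infinite field, $\Gamma$ a finite quiver, $I$ an admissible ideal of the path algebra $K\Gamma$ (i.e. $R^N\subseteq I\subseteq R^2$ for some $N$, where $R$ is the ideal generated by the arrows), $\Lambda=K\Gamma/I$, and $J$ the Jacobson radical of $\Lambda$. The product $qp$ of paths means "$q$ after $p$"; $u$ is a right subpath of $p$ if $p=u'u$ for some path $u'$; vertices are identified with the corresponding idempotents. A uniserial module is a nonzero finitely generated left $\Lambda$-module $U$ whose submodules form a chain. A path $p$ of length $l$ is a mast of $U$ if $U$ has composition length $l+1$ and $pU\neq 0$; a path is a mast if it is a mast of some uniserial module. A top element of $U$ is an $x\in U\setminus JU$ with $ex=x$ for some vertex $e$. $\Lambda$ has finite uniserial type if there are only finitely many isomorphism types of uniserial modules. A detour on a path $p$ is a pair $(\alpha,u)$, where $u$ is a right subpath of $p$ (possibly of length $0$) and $\alpha$ is an arrow such that $\alpha u$ is a path which is not a right subpath of $p$, but such that the family $(v_i(\alpha,u))_{i\in I(\alpha,u)}$ of all right subpaths of $p$ which are longer than $u$ and end in the same vertex as $\alpha$ is nonempty. Introduce a variable $X_i(\alpha,u)$ for each detour $(\alpha,u)$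 on $p$ and $i\in I(\alpha,u)$. Reduce each path $q$ that starts where $p$ starts to a combination of right subpaths of $p$ with coefficients in $K[X_i(\alpha,u)]$ as follows: working from the right, whenever $u$ is a right subpath of $p$ and $\alpha$ an arrow starting where $u$ ends, keep $\alpha u$ if it is a right subpath of $p$, replace it by $\sum_i X_i(\alpha,u)v_i(\alpha,u)$ if $(\alpha,u)$ is a detour on $p$, and replace it by $0$ otherwise. Extended $K$-linearly (paths not starting where $p$ starts being sent to $0$), this assigns to each $z\in I$ a combination of right subpaths of $p$; the variety $V_p$ is the set of common zeros, in the affine space over $K$ with coordinates $X_i(\alpha,u)$, of all coefficients so obtained from all $z\in I$. The (layered and labeled) graph of a uniserial module $U$ relative to a top element $x$ has a vertex labeled $e$ in layer $i$ whenever $e(J^iU)\not\subseteq J^{i+1}U$, and an edge labeled $\alpha$ from layer $i$ to layer $j$ whenever $\alpha$ is an arrow and there is a path $u$ of length $i$, ending where $\alpha$ starts, with $\Lambda ux=J^iU\neq0$ and $\Lambda\alpha ux=J^jU\ne 0$. The graphs of $U$ are its graphs relative to all its top elements. A graph is an edge path if, for some path $p=\alpha_l\cdots\alpha_1$, where $\alpha_i:e_{i-1}\to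 e_i$ (for $l=0$, $p=e_0$ is a vertex), it consists precisely of one vertex $e_i$ in layer $i$ for $0\le i\le l$ and one edge $\alpha_{i}$ from layer $i-1$ to layer $i$ for $1\le i\le l$. A halyard on a mast $p$ is a detour $(\alpha,u)$ on $p$ such that $\alpha ux\neq0$ for some uniserial module $U$ with mast $p$ and some top element $x$ of $U$. It is circular if there are an oriented cycle $c$ of positive length such that $\alpha cu$ is a right subpath of $p$, a uniserial module $U$ with mast $p$, and a top element $x$ of $U$, with $\Lambda\alpha ux=\Lambda\alpha cux$. **Theorem 4.1.** The following conditions are equivalent: (1) For each path $p$ in $K\Gamma$, the variety $V_p$ is finite. (1') For each path $p$ in $K\Gamma$, the variety $V_p$ is either empty or a singleton. (2) Whenever $\alpha:e\to e'$ is an arrow of $\Gamma$ and $p:e\to e'$ is a mast of positive length, $p=c'\alpha$ for an oriented cycle $c'$ at $e'$ (possibly of length $0$). (3) $\Lambda$ has finite uniserial type, and there are no circular halyards on the mast of any uniserial left $\Lambda$-module. (4) There is a one-to-one correspondence between the isomorphism types and the graphs of the uniserial left $\Lambda$-modules: there is a bijection from the set of isomorphism types of uniserial modules onto the set of all graphs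 of uniserial modules which sends the isomorphism type of $U$ to the graph of $U$ relative to $x$, for every uniserial $U$ and every top element $x$ of $U$. (5) The only graphs of uniserial left $\Lambda$-modules are edge paths. -/

import Mathlib

open Quiver

universe uK uV uE

section PathAlgebraDef

/-- The path algebra `KΓ` of a quiver `Γ` with finite vertex set `V`.
The block `f a b` of an element `f` is a formal `K`-linear combination of paths from `a` to `b`,
that is, the component `e_b f e_a`. -/
def PathAlgebra (K : Type uK) (V : Type uV) [Field K] [Quiver.{uE} V] :
    Type (max uK uV uE) :=
  ∀ a b : V, Path a b →₀ K

variable {K : Type uK} {V : Type uV} [Field K] [Quiver.{uE} V]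

noncomputable instance : AddCommGroup (PathAlgebra K V) :=
  inferInstanceAs (AddCommGroup (∀ a b : V, Path a b →₀ K))

noncomputable instance : Module K (PathAlgebra K V) :=
  inferInstanceAs (Module K (∀ a b : V, Path a b →₀ K))

/-- Bilinear extension of the composition of paths: first a combination of paths from `a` to `b`,
then a combination of paths from `b` to `c`. -/
noncomputable def pathComp (a b c : V) :
    (Path a b →₀ K) →ₗ[K] (Path b c →₀ K) →ₗ[K] (Path a c →₀ K) :=
  Finsupp.lsum K fun p : Path a b =>
    LinearMap.toSpanSingleton K _
      (Finsupp.lsum K fun q : Path b c => Finsupp.lsingle (p.comp q))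

theorem pathComp_single {a b c : V} (p : Path a b) (q : Path b c) (r s : K) :
    pathComp a b c (Finsupp.single p r) (Finsupp.single q s)
      = Finsupp.single (p.comp q) (r * s) := by
  simp [pathComp]

theorem pathComp_assoc {a b c d : V} (f : Path a b →₀ K) (g : Path b c →₀ K)
    (h : Path c d →₀ K) :
    pathComp a c d (pathComp a b c f g) h = pathComp a b d f (pathComp b c d g h) := by
  induction f using Finsupp.induction_linear with
  | zero => simp
  | add f₁ f₂ h₁ h₂ => simp [h₁, h₂]
  | single p r =>
    induction g using Finsupp.induction_linear with
    | zero => simp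
    | add f₁ f₂ h₁ h₂ => simp [h₁, h₂]
    | single q s =>
      induction h using Finsupp.induction_linear with
      | zero => simp
      | add f₁ f₂ h₁ h₂ => simp [h₁, h₂]
      | single w t => rw [pathComp_single, pathComp_single, pathComp_single, pathComp_single,
          mul_assoc, Path.comp_assoc]

theorem nil_pathComp {a b : V} (f : Path a b →₀ K) :
    pathComp a a b (Finsupp.single Path.nil 1) f = f := by
  induction f using Finsupp.induction_linear with
  | zero => simp
  | add f₁ f₂ h₁ h₂ => simp [h₁, h₂]
  | single p r => simp [pathComp_single]

theorem pathComp_nil {a b : V} (f : Path a b →₀ K) :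
    pathComp a b b f (Finsupp.single Path.nil 1) = f := by
  induction f using Finsupp.induction_linear with
  | zero => simp
  | add f₁ f₂ h₁ h₂ => simp [h₁, h₂]
  | single p r => simp [pathComp_single]

open Classical in
/-- A path, as an element of the path algebra; a path of length zero is a vertex, regarded as
an idempotent. -/
noncomputable def ofPath (K : Type uK) {V : Type uV} [Field K] [Quiver.{uE} V] {a b : V}
    (p : Path a b) : PathAlgebra K V :=
  (Pi.single a (Pi.single b (Finsupp.single p 1)) : ∀ a b : V, Path a b →₀ K)

/-- Multiplication: the product of `q` and `p` is "`q` after `p`". -/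
noncomputable instance [Fintype V] : Mul (PathAlgebra K V) :=
  ⟨fun f g a c => ∑ b, pathComp a b c (g a b) (f b c)⟩

open Classical in
noncomputable instance : One (PathAlgebra K V) :=
  ⟨fun a => Pi.single a (Finsupp.single Path.nil 1)⟩

theorem PathAlgebra.mul_apply [Fintype V] (f g : PathAlgebra K V) (a c : V) :
    (f * g) a c = ∑ b, pathComp a b c (g a b) (f b c) := rfl

theorem PathAlgebra.one_apply_self (a : V) :
    (1 : PathAlgebra K V) a a = Finsupp.single Path.nil 1 := by
  classical exact Pi.single_eq_same (M := fun b => Path a b →₀ K) a _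

theorem PathAlgebra.one_apply_ne {a b : V} (h : b ≠ a) : (1 : PathAlgebra K V) a b = 0 := by
  classical exact Pi.single_eq_of_ne (M := fun b => Path a b →₀ K) h _

theorem PathAlgebra.add_apply (f g : PathAlgebra K V) (a c : V) :
    (f + g) a c = f a c + g a c := rfl

theorem PathAlgebra.zero_apply (a c : V) : (0 : PathAlgebra K V) a c = 0 := rfl

theorem PathAlgebra.smul_apply (r : K) (f : PathAlgebra K V) (a c : V) :
    (r • f) a c = r • f a c := rfl

noncomputable instance [Fintype V] : Ring (PathAlgebra K V) :=
  { (inferInstance : AddCommGroup (PathAlgebra K V)),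
    (inferInstance : Mul (PathAlgebra K V)),
    (inferInstance : One (PathAlgebra K V)) with
    left_distrib := fun f g h => by
      funext a c
      simp [PathAlgebra.mul_apply, PathAlgebra.add_apply, Finset.sum_add_distrib]
    right_distrib := fun f g h => by
      funext a c
      simp [PathAlgebra.mul_apply, PathAlgebra.add_apply, Finset.sum_add_distrib]
    zero_mul := fun f => by
      funext a c
      simp [PathAlgebra.mul_apply, PathAlgebra.zero_apply]
    mul_zero := fun f => by
      funext a c
      simp [PathAlgebra.mul_apply, PathAlgebra.zero_apply]
    mul_assoc := fun f g h => by
      funext a d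
      simp only [PathAlgebra.mul_apply, map_sum, LinearMap.sum_apply, pathComp_assoc]
      exact Finset.sum_comm
    one_mul := fun f => by
      funext a c
      rw [PathAlgebra.mul_apply, Finset.sum_eq_single c]
      · rw [PathAlgebra.one_apply_self, pathComp_nil]
      · intro b _ hb
        rw [PathAlgebra.one_apply_ne hb.symm, map_zero]
      · simp
    mul_one := fun f => by
      funext a c
      rw [PathAlgebra.mul_apply, Finset.sum_eq_single a]
      · rw [PathAlgebra.one_apply_self, nil_pathComp]
      · intro b _ hb
        rw [PathAlgebra.one_apply_ne hb, map_zero, LinearMap.zero_apply]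
      · simp }

noncomputable instance [Fintype V] : Algebra K (PathAlgebra K V) :=
  Algebra.ofModule
    (fun r f g => by
      funext a c
      simp [PathAlgebra.mul_apply, PathAlgebra.smul_apply, Finset.smul_sum])
    (fun r f g => by
      funext a c
      simp [PathAlgebra.mul_apply, PathAlgebra.smul_apply, Finset.smul_sum])

/-- An ideal `I` of `KΓ` is admissible if `R ^ N ⊆ I ⊆ R ^ 2` for some `N`, where `R` is the ideal
generated by the arrows; `R ^ n` is spanned by the paths of length at least `n`. -/
def IsAdmissible [Fintype V] (I : Ideal (PathAlgebra K V)) : Prop :=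
  (∀ z ∈ I, ∀ (a b : V) (q : Path a b), z a b q ≠ 0 → 2 ≤ q.length) ∧
    ∃ N : ℕ, ∀ (a b : V) (q : Path a b), N ≤ q.length → ofPath K q ∈ I

end PathAlgebraDef

section Combinatorics

variable {V : Type uV} [Quiver.{uE} V]

/-- `u` is a right subpath of `p`: `p = u' u`, i.e. `p` is "`u'` after `u`" for some path `u'`. -/
def IsRightSubpath {a b c : V} (u : Path a c) (p : Path a b) : Prop :=
  ∃ u' : Path c b, p = u.comp u'

/-- The pair `(α, u)` is a detour on `p`. -/
def IsDetour {a b c d : V} (p : Path a b) (u : Path a c) (α : c ⟶ d) : Prop :=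
  IsRightSubpath u p ∧ ¬ IsRightSubpath (u.cons α) p ∧
    ∃ v : Path a d, IsRightSubpath v p ∧ u.length < v.length

/-- The right subpaths of `p` which end in the vertex `d`. -/
def RightSubpathTo {a b : V} (p : Path a b) (d : V) : Type (max uV uE) :=
  {v : Path a d // IsRightSubpath v p}

/-- The index set of the variables `X_i(α, u)` of the variety `V_p`: a detour `(α, u)` on `p`
together with a right subpath `v = v_i(α, u)` of `p` which is longer than `u` and ends in the same
vertex as `α`. -/
structure DetourVar {a b : V} (p : Path a b) : Type (max uV uE) where
  (c d : V)
  u : Path a c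
  α : c ⟶ d
  isDetour : IsDetour p u α
  v : RightSubpathTo p d
  lt : u.length < v.1.length

theorem finite_rightSubpaths {a b : V} (p : Path a b) :
    {v : Σ d : V, Path a d | IsRightSubpath v.2 p}.Finite := by
  induction p with
  | nil =>
    refine (Set.finite_singleton (⟨a, Path.nil⟩ : Σ d : V, Path a d)).subset ?_
    rintro ⟨d, v⟩ ⟨u', h⟩
    dsimp only at u' h
    cases u' with
    | nil => exact Set.mem_singleton_iff.2 (congrArg (Sigma.mk a) h.symm)
    | cons w β => simp [Path.comp_cons] at h
  | @cons b₁ b₂ p β ih =>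
    refine (ih.insert (⟨b₂, p.cons β⟩ : Σ d : V, Path a d)).subset ?_
    rintro ⟨d, v⟩ ⟨u', h⟩
    dsimp only at u' h
    cases u' with
    | nil => exact Or.inl (congrArg (Sigma.mk b₂) h.symm)
    | cons w γ =>
      right
      rw [Path.comp_cons] at h
      obtain rfl := Path.obj_eq_of_cons_eq_cons h
      exact ⟨w, eq_of_heq (Path.heq_of_cons_eq_cons h)⟩

instance {a b : V} (p : Path a b) (d : V) : Finite (RightSubpathTo p d) := by
  have := (finite_rightSubpaths p).to_subtype
  refine Finite.of_injective (fun v : RightSubpathTo p d =>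
    (⟨⟨d, v.1⟩, v.2⟩ : {v : Σ d : V, Path a d | IsRightSubpath v.2 p})) ?_
  intro v w h
  have h₁ := congrArg Subtype.val h
  exact Subtype.ext (eq_of_heq (Sigma.mk.inj h₁).2)

end Combinatorics

section Variety

variable {V : Type uV} [Quiver.{uE} V]

/-- One step of the substitution process for `p`. For a right subpath `u` of `p` and an arrow `α`
starting where `u` ends, the path `α u` is kept if it is a right subpath of `p`; it is replaced by
`∑ᵢ X_i(α, u) v_i(α, u)` if `(α, u)` is a detour on `p`; otherwise it is replaced by `0`. -/
noncomputable def substStep (K : Type uK) [Field K] {a b c d : V} (p : Path a b) (α : c ⟶ d)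
    (u : RightSubpathTo p c) : RightSubpathTo p d →₀ MvPolynomial (DetourVar p) K := by
  classical
  exact
    if h : IsRightSubpath (u.1.cons α) p then Finsupp.single ⟨u.1.cons α, h⟩ 1
    else if hd : IsDetour p u.1 α then
      ∑ᶠ v : {v : RightSubpathTo p d // u.1.length < v.1.length},
        Finsupp.single v.1 (MvPolynomial.X ⟨c, d, u.1, α, hd, v.1, v.2⟩)
    else 0

/-- The reduction of a path `q`, starting where `p` starts, to a combination of right subpaths
of `p` with polynomial coefficients, by iterated substitution from the right. -/
noncomputable def substPath (K : Type uK) [Field K] {a b : V} (p : Path a b) :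
    ∀ {d : V}, Path a d → (RightSubpathTo p d →₀ MvPolynomial (DetourVar p) K)
  | _, Path.nil => Finsupp.single ⟨Path.nil, p, (Path.nil_comp p).symm⟩ 1
  | _, Path.cons q α => (substPath K p q).sum fun u f => f • substStep K p α u

/-- The polynomial which occurs as the coefficient of the right subpath `v` of `p` when the
element `z` of the path algebra is reduced by means of the substitution equations for `p`. -/
noncomputable def substPoly {K : Type uK} [Field K] {a b : V} (p : Path a b)
    (z : PathAlgebra K V) {d : V} (v : RightSubpathTo p d) : MvPolynomial (DetourVar p) K :=
  (z a d).sum fun q r => MvPolynomial.C r * substPath K p q v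

/-- The affine variety `V_p`: the vanishing locus, in the affine space over `K` whose coordinates
are the variables `X_i(α, u)`, of all the polynomials obtained from the relations in `I` by
reduction. -/
def uniserialVariety {K : Type uK} [Field K] [Fintype V] (I : Ideal (PathAlgebra K V))
    {a b : V} (p : Path a b) : Set (DetourVar p → K) :=
  {k | ∀ z ∈ I, ∀ (d : V) (v : RightSubpathTo p d), MvPolynomial.eval k (substPoly p z v) = 0}

end Variety

section Graphs

/-- A layered and labeled graph: `(i, e) ∈ vertices` means that there is a vertex labeled `e` in
layer `i`, and `(i, α, j) ∈ edges` means that there is an edge labeled by the arrow `α` from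
layer `i` to layer `j`. -/
@[ext] structure LayeredGraph (V : Type uV) [Quiver.{uE} V] : Type (max uV uE) where
  vertices : Set (ℕ × V)
  edges : Set (ℕ × (Σ c d : V, c ⟶ d) × ℕ)

/-- The graph which is just the edge path along `p`: layer `i` consists of the vertex which `p`
reaches after `i` steps, and the only edge starting in layer `i` is the next arrow of `p`, which
leads to layer `i + 1`. -/
def edgePath {V : Type uV} [Quiver.{uE} V] {a : V} : ∀ {b : V}, Path a b → LayeredGraph V
  | _, Path.nil => ⟨{(0, a)}, ∅⟩
  | b, Path.cons (b := c) p α =>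
    ⟨insert (p.length + 1, b) (edgePath p).vertices,
      insert (p.length, ⟨c, b, α⟩, p.length + 1) (edgePath p).edges⟩

/-- A layered and labeled graph is an edge path. -/
def LayeredGraph.IsEdgePath {V : Type uV} [Quiver.{uE} V] (G : LayeredGraph V) : Prop :=
  ∃ (a b : V) (p : Path a b), G = edgePath p

end Graphs

section Modules

/-- A uniserial object of `Λ-mod`: a nonzero finitely generated module whose submodules form a
chain. -/
def IsUniserial (Λ : Type*) [Ring Λ] (U : Type*) [AddCommGroup U] [Module Λ U] : Prop :=
  Nontrivial U ∧ Module.Finite Λ U ∧ ∀ N N' : Submodule Λ U, N ≤ N' ∨ N' ≤ N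

/-- The submodule `J ^ i U`, where `J` is the Jacobson radical of `Λ`. -/
def radPow (Λ : Type*) [Ring Λ] (U : Type*) [AddCommGroup U] [Module Λ U] :
    ℕ → Submodule Λ U
  | 0 => ⊤
  | i + 1 => Submodule.span Λ {y | ∃ r ∈ Ring.jacobson Λ, ∃ x ∈ radPow Λ U i, y = r • x}

variable {K : Type uK} {V : Type uV} [Field K] [Quiver.{uE} V] [Fintype V]

/-- The residue class in `Λ = KΓ/I` of a path. -/
noncomputable abbrev pathIn (I : Ideal (PathAlgebra K V)) [I.IsTwoSided] {a b : V}
    (p : Path a b) : PathAlgebra K V ⧸ I :=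
  Ideal.Quotient.mk I (ofPath K p)

/-- The uniserial left modules over `Λ = KΓ/I`. Being cyclic, each of them has an isomorphic copy
in the universe used here. -/
structure UniserialModule (I : Ideal (PathAlgebra K V)) [I.IsTwoSided] where
  carrier : Type (max uK uV uE)
  [addCommGroup : AddCommGroup carrier]
  [module : Module (PathAlgebra K V ⧸ I) carrier]
  isUniserial : IsUniserial (PathAlgebra K V ⧸ I) carrier

attribute [instance] UniserialModule.addCommGroup UniserialModule.module

variable (I : Ideal (PathAlgebra K V)) [I.IsTwoSided]

/-- Isomorphism of uniserial left `Λ`-modules. -/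
instance uniserialSetoid : Setoid (UniserialModule I) where
  r U U' := Nonempty (U.carrier ≃ₗ[PathAlgebra K V ⧸ I] U'.carrier)
  iseqv :=
    { refl := fun _ => ⟨LinearEquiv.refl _ _⟩
      symm := fun ⟨φ⟩ => ⟨φ.symm⟩
      trans := fun ⟨φ⟩ ⟨ψ⟩ => ⟨φ.trans ψ⟩ }

/-- The isomorphism types of uniserial left `Λ`-modules. -/
def UniserialType : Type (max uK uV uE + 1) := Quotient (uniserialSetoid I)

/-- `Λ` has finite uniserial type. -/
def FiniteUniserialType : Prop := Finite (UniserialType I)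

variable {I}

/-- `p` is a mast of `U`: the composition length of `U` is one more than the length of `p`, and
`p U ≠ 0`. -/
def UniserialModule.HasMast (U : UniserialModule I) {a b : V} (p : Path a b) : Prop :=
  Module.length (PathAlgebra K V ⧸ I) U.carrier = p.length + 1 ∧
    ∃ x : U.carrier, pathIn I p • x ≠ 0

/-- `x` is a top element of `U`: `x ∉ JU`, and `e x = x` for some vertex `e`. -/
def UniserialModule.IsTop (U : UniserialModule I) (x : U.carrier) : Prop :=
  x ∉ radPow (PathAlgebra K V ⧸ I) U.carrier 1 ∧
    ∃ e : V, pathIn I (Path.nil : Path e e) • x = x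

/-- The layered and labeled graph of `U` relative to the top element `x`. There is a vertex `e` in
layer `i` if `e` occurs in `J ^ i U / J ^ (i + 1) U`. There is an edge `α` from layer `i` to
layer `j` if `Λ u x = J ^ i U ≠ 0` and `Λ α u x = J ^ j U ≠ 0` for a path `u` of length `i`. -/
def UniserialModule.graph (U : UniserialModule I) (x : U.carrier) : LayeredGraph V where
  vertices := {m | ∃ y ∈ radPow (PathAlgebra K V ⧸ I) U.carrier m.1,
    pathIn I (Path.nil : Path m.2 m.2) • y ∉
      radPow (PathAlgebra K V ⧸ I) U.carrier (m.1 + 1)}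
  edges := {m | ∃ (a : V) (u : Path a m.2.1.1), u.length = m.1 ∧
    pathIn I u • x ≠ 0 ∧
    Submodule.span (PathAlgebra K V ⧸ I) {pathIn I u • x} =
      radPow (PathAlgebra K V ⧸ I) U.carrier m.1 ∧
    pathIn I (u.cons m.2.1.2.2) • x ≠ 0 ∧
    Submodule.span (PathAlgebra K V ⧸ I) {pathIn I (u.cons m.2.1.2.2) • x} =
      radPow (PathAlgebra K V ⧸ I) U.carrier m.2.2}

variable (I)

/-- The graphs of uniserial left `Λ`-modules, relative to arbitrary top elements. -/
def uniserialGraphs : Set (LayeredGraph V) :=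
  {G | ∃ (U : UniserialModule I) (x : U.carrier), U.IsTop x ∧ U.graph x = G}

/-- `p` is a mast of some uniserial left `Λ`-module. -/
def IsMast {a b : V} (p : Path a b) : Prop :=
  ∃ U : UniserialModule I, U.HasMast p

/-- The pair `(α, u)` is a halyard on the mast `p`: a detour on `p` such that `α u x ≠ 0` for some
uniserial module with mast `p` and top element `x`. -/
def IsHalyard {a b c d : V} (p : Path a b) (u : Path a c) (α : c ⟶ d) : Prop :=
  IsDetour p u α ∧ ∃ (U : UniserialModule I) (x : U.carrier),
    U.HasMast p ∧ U.IsTop x ∧ pathIn I (u.cons α) • x ≠ 0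

/-- The halyard `(α, u)` on the mast `p` is circular: for some oriented cycle `w` of positive
length, `α w u` is a right subpath of `p`, and in the graph of some uniserial module with mast `p`
and top element `x` the edge `α` leaving `u` ends in the same layer as `α w u`. -/
def IsCircularHalyard {a b c d : V} (p : Path a b) (u : Path a c) (α : c ⟶ d) : Prop :=
  IsHalyard I p u α ∧ ∃ w : Path c c, 0 < w.length ∧
    IsRightSubpath ((u.comp w).cons α) p ∧
    ∃ (U : UniserialModule I) (x : U.carrier), U.HasMast p ∧ U.IsTop x ∧
      Submodule.span (PathAlgebra K V ⧸ I) {pathIn I (u.cons α) • x} =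
        Submodule.span (PathAlgebra K V ⧸ I) {pathIn I ((u.comp w).cons α) • x}

end Modules

-- Every condition is compared with the one on masts and parallel arrows, called
-- `MastsStartWithArrows`. If U is uniserial with mast p and top element x, the elements vx, with v
-- a right subpath of p, form a K-basis of U adapted to the radical layers. Hence every nonzero
-- element fixed by a vertex has a leading term c·vx (`IsMastTop.exists_leading`).
--
-- Suppose the mast condition holds. Let α leave p after u, with αux ≠ 0 and leading term a multiple
-- of vx. Then v = wu, and the segment w of a mast is again a mast (`IsMastTop.subquotient`),
-- parallel to α. So w starts with α, and αu was a right subpath of p after all. Thus all detours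
-- act as zero (`MastsStartWithArrows.detoursVanish`): V_p contains at most the origin, graphs are
-- edge paths, there are no halyards, and U is determined by p. Masts have bounded length, so there
-- are finitely many.
--
-- Suppose it fails for a mast p : a → b and an arrow α : a → b. The element px lies in the socle.
-- With a functional λ vanishing on JU, the action of α can be changed by y ↦ tλ(y)px for any t in K
-- (`IsMastTop.exists_deformation`). This moves one coordinate of a point of V_p freely, so V_p is
-- infinite; it also yields a module with αx ≠ 0, whose graph has two different arrows leaving the
-- top layer.
--
-- For finite type and for graphs as invariants, p is taken of minimal length. Then αx is a multiple
-- of px, and a deformation makes it equal to px. If αwx ≠ 0 for a cyclic right subpath w of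
-- positive length, then p = αw: this is a circular halyard, and α kills the top element x - wx, so
-- the graph depends on the top element. Otherwise α kills JU, and the scalar s in αx = s·px is an
-- isomorphism invariant. Deforming gives a module for each s in the infinite field K, all with the
-- same graph when s ≠ 0.

universe w

/-! ### Coefficients of paths and the length filtration of the path algebra. -/

namespace PathAlgebra

variable {K : Type uK} {V : Type uV} [Field K] [Quiver.{uE} V]

/-- The block `e_b f e_a` of `f`, as a linear function of `f`. -/
noncomputable def block (K : Type uK) {V : Type uV} [Field K] [Quiver.{uE} V] (a b : V) :
    PathAlgebra K V →ₗ[K] (Path a b →₀ K) where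
  toFun f := f a b
  map_add' _ _ := rfl
  map_smul' _ _ := rfl

theorem block_apply (a b : V) (f : PathAlgebra K V) : block K a b f = f a b := rfl

theorem ofPath_self {a b : V} (q : Path a b) : ofPath K q a b = Finsupp.single q 1 := by
  simp [ofPath]

theorem ofPath_ne_left {a b a' : V} (b' : V) (q : Path a b) (h : a' ≠ a) :
    ofPath K q a' b' = 0 := by
  classical
  rw [ofPath, Pi.single_eq_of_ne h]
  rfl

theorem ofPath_ne_right {a b b' : V} (a' : V) (q : Path a b) (h : b' ≠ b) :
    ofPath K q a' b' = 0 := by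
  rcases eq_or_ne a' a with rfl | h'
  · classical
    rw [ofPath, Pi.single_eq_same, Pi.single_eq_of_ne h]
  · exact ofPath_ne_left b' q h'

theorem ext_blocks {f g : PathAlgebra K V} (h : ∀ a b, f a b = g a b) : f = g := by
  funext a b
  exact h a b

variable [Fintype V]

theorem expansion (f : PathAlgebra K V) :
    f = ∑ a, ∑ b, (f a b).sum fun q c => c • ofPath K q := by
  apply ext_blocks
  intro a b
  rw [← block_apply a b (∑ _, _), map_sum, Finset.sum_eq_single a]
  · rw [map_sum, Finset.sum_eq_single b]
    · rw [Finsupp.sum, map_sum]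
      simp only [map_smul, block_apply, ofPath_self, Finsupp.smul_single, smul_eq_mul, mul_one]
      exact (Finsupp.sum_single (f a b)).symm
    · intro b' _ hb
      rw [Finsupp.sum, map_sum]
      simp [block_apply, ofPath_ne_right _ _ hb.symm]
    · simp
  · intro a' _ ha
    rw [map_sum]
    refine Finset.sum_eq_zero fun b' _ => ?_
    rw [Finsupp.sum, map_sum]
    simp [block_apply, ofPath_ne_left _ _ ha.symm]
  · simp

/-- An additive property of elements of the path algebra may be checked on the paths which
actually occur. -/
theorem induction_support {P : PathAlgebra K V → Prop} (f : PathAlgebra K V) (zero : P 0)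
    (add : ∀ g h, P g → P h → P (g + h))
    (path : ∀ (a b : V) (q : Path a b) (c : K), f a b q ≠ 0 → P (c • ofPath K q)) : P f := by
  rw [expansion f]
  refine Finset.sum_induction _ P add zero fun a _ =>
    Finset.sum_induction _ P add zero fun b _ =>
    Finset.sum_induction _ P add zero fun q hq => path a b q _ (Finsupp.mem_support_iff.1 hq)

theorem ofPath_mul_ofPath {a b c : V} (p : Path a b) (q : Path b c) :
    ofPath K q * ofPath K p = ofPath K (p.comp q) := by
  apply ext_blocks
  intro a' c'
  rw [mul_apply]
  rcases eq_or_ne a' a with rfl | ha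
  · rw [Finset.sum_eq_single b]
    · rcases eq_or_ne c' c with rfl | hc
      · rw [ofPath_self, ofPath_self, ofPath_self, pathComp_single, mul_one]
      · rw [ofPath_ne_right _ _ hc, ofPath_ne_right _ _ hc, map_zero]
    · intro b' _ hb
      rw [ofPath_ne_left _ _ hb, map_zero]
    · simp
  · rw [ofPath_ne_left _ _ ha]
    refine Finset.sum_eq_zero fun b' _ => ?_
    rw [ofPath_ne_left _ _ ha, map_zero, LinearMap.zero_apply]

theorem ofPath_mul_ofPath_of_ne {a b b' c : V} (p : Path a b) (q : Path b' c) (h : b ≠ b') :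
    ofPath K q * ofPath K p = 0 := by
  apply ext_blocks
  intro a' c'
  rw [mul_apply, zero_apply]
  refine Finset.sum_eq_zero fun d _ => ?_
  rcases eq_or_ne d b with rfl | hd
  · rw [ofPath_ne_left _ _ h, map_zero]
  · rw [ofPath_ne_right _ _ hd, map_zero, LinearMap.zero_apply]

theorem one_eq_sum : (1 : PathAlgebra K V) = ∑ a : V, ofPath K (Path.nil : Path a a) := by
  apply ext_blocks
  intro a b
  rw [← block_apply a b (∑ _, _), map_sum, Finset.sum_eq_single a]
  · rcases eq_or_ne b a with rfl | h
    · rw [one_apply_self, block_apply, ofPath_self]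
    · rw [one_apply_ne h, block_apply, ofPath_ne_right _ _ h]
  · intro a' _ ha
    rw [block_apply, ofPath_ne_left _ _ ha.symm]
  · simp

/-- To prove a bilinear identity in the path algebra it suffices to check it on paths. -/
theorem bilin_ext {M : Type*} [AddCommGroup M] [Module K M]
    {F G : PathAlgebra K V →ₗ[K] PathAlgebra K V →ₗ[K] M}
    (h : ∀ (a b c d : V) (p : Path a b) (q : Path c d),
      F (ofPath K q) (ofPath K p) = G (ofPath K q) (ofPath K p)) : F = G := by
  ext f g
  induction f using induction_support with
  | zero => simp
  | add g h hg hh => simp [hg, hh]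
  | path c d q r hq =>
    induction g using induction_support with
    | zero => simp
    | add g h hg hh => rw [map_add, map_add, hg, hh]
    | path a b p s hp => simp [h]

/-- The coefficient of a path, as a linear function. -/
noncomputable def coeff (K : Type uK) {V : Type uV} [Field K] [Quiver.{uE} V] {a b : V}
    (q : Path a b) : PathAlgebra K V →ₗ[K] K :=
  Finsupp.lapply q ∘ₗ block K a b

omit [Fintype V] in
theorem coeff_apply {a b : V} (q : Path a b) (f : PathAlgebra K V) : coeff K q f = f a b q := rfl

omit [Fintype V] in
theorem coeff_ofPath_self {a b : V} (q : Path a b) : coeff K q (ofPath K q) = 1 := by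
  rw [coeff_apply, ofPath_self, Finsupp.single_eq_same]

omit [Fintype V] in
theorem coeff_ofPath_of_ne {a b a' b' : V} (q : Path a b) (q' : Path a' b')
    (h : (⟨a, b, q⟩ : Σ a b : V, Path a b) ≠ ⟨a', b', q'⟩) : coeff K q (ofPath K q') = 0 := by
  rw [coeff_apply]
  rcases eq_or_ne a a' with rfl | ha
  · rcases eq_or_ne b b' with rfl | hb
    · rw [ofPath_self, Finsupp.single_eq_of_ne]
      rintro rfl
      exact h rfl
    · rw [ofPath_ne_right _ _ hb]; rfl
  · rw [ofPath_ne_left _ _ ha]; rfl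

omit [Fintype V] in
theorem coeff_ofPath_of_length_ne {a b a' b' : V} (q : Path a b) (q' : Path a' b')
    (h : q.length ≠ q'.length) : coeff K q (ofPath K q') = 0 := by
  apply coeff_ofPath_of_ne
  intro h'
  cases h'
  exact h rfl

omit [Fintype V] in
theorem coeff_nil_ofPath_cons {a b c d : V} (p : Path b c) (α : c ⟶ d) :
    coeff K (Path.nil : Path a a) (ofPath K (p.cons α)) = 0 :=
  coeff_ofPath_of_length_ne _ _ (by simp)

/-- A product of two paths is trivial only if both factors are. These multiplicative functionals
become the characters of the simple modules. -/
theorem coeff_nil_mul (a : V) (f g : PathAlgebra K V) :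
    coeff K (Path.nil : Path a a) (f * g) =
      coeff K (Path.nil : Path a a) f * coeff K (Path.nil : Path a a) g := by
  let φ := coeff K (Path.nil : Path a a)
  have : (LinearMap.mul K (PathAlgebra K V)).compr₂ φ =
      (LinearMap.mul K K).compl₁₂ φ φ := by
    apply bilin_ext
    intro c b b' d p q
    simp only [LinearMap.compr₂_apply, LinearMap.mul_apply', LinearMap.compl₁₂_apply]
    rcases eq_or_ne b b' with rfl | hb
    · rw [ofPath_mul_ofPath]
      cases q with
      | nil =>
        cases p with
        | nil =>
          rw [Path.comp_nil]
          rcases eq_or_ne c a with rfl | hc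
          · simp [φ, coeff_ofPath_self]
          · have : φ (ofPath K (Path.nil : Path c c)) = 0 := by
              apply coeff_ofPath_of_ne
              intro h
              cases h
              exact hc rfl
            simp [this]
        | cons p α => simp [φ, coeff_nil_ofPath_cons,]
      | cons q α => simp [φ, coeff_nil_ofPath_cons,]
    · rw [ofPath_mul_ofPath_of_ne _ _ hb, map_zero]
      cases q with
      | nil =>
        cases p with
        | nil =>
          rcases eq_or_ne b' a with rfl | hc
          · have : φ (ofPath K (Path.nil : Path c c)) = 0 := by
              apply coeff_ofPath_of_ne
              intro h
              cases h
              exact hb rfl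
            simp [this]
          · have : φ (ofPath K (Path.nil : Path b' b')) = 0 := by
              apply coeff_ofPath_of_ne
              intro h
              cases h
              exact hc rfl
            simp [this]
        | cons p α => simp [φ, coeff_nil_ofPath_cons,]
      | cons q α => simp [φ, coeff_nil_ofPath_cons,]
  exact LinearMap.congr_fun₂ this f g

omit [Fintype V] in
theorem coeff_nil_ofPath_nil_of_ne {a b : V} (h : a ≠ b) :
    coeff K (Path.nil : Path a a) (ofPath K (Path.nil : Path b b)) = 0 := by
  apply coeff_ofPath_of_ne
  intro h'
  cases h'
  exact h rfl

/-- An arrow factors only as (vertex)(arrow) or (arrow)(vertex). So its coefficient is a derivation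
over two vertex characters, which is what makes the later deformation of a module multiplicative. -/
theorem coeff_arrow_mul {a b : V} (α : a ⟶ b) (f g : PathAlgebra K V) :
    coeff K α.toPath (f * g) =
      coeff K (Path.nil : Path b b) f * coeff K α.toPath g +
        coeff K α.toPath f * coeff K (Path.nil : Path a a) g := by
  let φ := coeff K α.toPath
  have : (LinearMap.mul K (PathAlgebra K V)).compr₂ φ =
      (LinearMap.mul K K).compl₁₂ (coeff K (Path.nil : Path b b)) φ +
      (LinearMap.mul K K).compl₁₂ φ (coeff K (Path.nil : Path a a)) := by
    apply bilin_ext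
    intro c d d' e p q
    simp only [LinearMap.compr₂_apply, LinearMap.mul_apply', LinearMap.compl₁₂_apply,
      LinearMap.add_apply]
    have h2 : ∀ {x y : V} (w : Path x y), w.length ≠ 1 → φ (ofPath K w) = 0 := fun w hw =>
      coeff_ofPath_of_length_ne _ _ (by simpa using hw.symm)
    have h0 : ∀ {z x y : V} (w : Path x y), w.length ≠ 0 →
        coeff K (Path.nil : Path z z) (ofPath K w) = 0 := fun w hw =>
      coeff_ofPath_of_length_ne _ _ (by simpa using hw.symm)
    have hL : ∀ {x y z : V} (w : Path x y), z ≠ x → φ (ofPath K w) *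
        coeff K (Path.nil : Path a a) (ofPath K (Path.nil : Path z z)) = 0 := by
      intro x y z w hz
      rcases eq_or_ne a z with rfl | h
      · rw [show φ (ofPath K w) = 0 from by
          show ofPath K w a b _ = 0
          rw [ofPath_ne_left _ _ hz]; rfl, zero_mul]
      · rw [coeff_nil_ofPath_nil_of_ne h, mul_zero]
    have hR : ∀ {x y z : V} (w : Path x y), z ≠ y →
        coeff K (Path.nil : Path b b) (ofPath K (Path.nil : Path z z)) * φ (ofPath K w) = 0 := by
      intro x y z w hz
      rcases eq_or_ne b z with rfl | h
      · rw [show φ (ofPath K w) = 0 from by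
          show ofPath K w a b _ = 0
          rw [ofPath_ne_right _ _ hz]; rfl, mul_zero]
      · rw [coeff_nil_ofPath_nil_of_ne h, zero_mul]
    have hL' : ∀ {y z : V} (w : Path z y), φ (ofPath K w) *
        coeff K (Path.nil : Path a a) (ofPath K (Path.nil : Path z z)) = φ (ofPath K w) := by
      intro y z w
      rcases eq_or_ne a z with rfl | h
      · rw [coeff_ofPath_self, mul_one]
      · rw [show φ (ofPath K w) = 0 from by
          show ofPath K w a b _ = 0
          rw [ofPath_ne_left _ _ h]; rfl, zero_mul]
    have hR' : ∀ {x z : V} (w : Path x z),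
        coeff K (Path.nil : Path b b) (ofPath K (Path.nil : Path z z)) * φ (ofPath K w) =
          φ (ofPath K w) := by
      intro x z w
      rcases eq_or_ne b z with rfl | h
      · rw [coeff_ofPath_self, one_mul]
      · rw [show φ (ofPath K w) = 0 from by
          show ofPath K w a b _ = 0
          rw [ofPath_ne_right _ _ h]; rfl, mul_zero]
    rcases eq_or_ne d d' with rfl | hd
    · rw [ofPath_mul_ofPath]
      cases q with
      | nil =>
        rw [Path.comp_nil, hR', h2 (Path.nil) (by simp), zero_mul, add_zero]
      | cons q β =>
        rw [h0 (q.cons β) (by simp), zero_mul, zero_add]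
        cases p with
        | nil => rw [Path.nil_comp, hL']
        | cons p γ =>
          rw [h0 (p.cons γ) (by simp), mul_zero, h2]
          simp
    · rw [ofPath_mul_ofPath_of_ne _ _ hd, map_zero]
      cases q with
      | nil => rw [hR p hd.symm, h2 (Path.nil) (by simp), zero_mul, add_zero]
      | cons q β =>
        rw [h0 (q.cons β) (by simp), zero_mul, zero_add]
        cases p with
        | nil => rw [hL _ hd]
        | cons p γ => rw [h0 (p.cons γ) (by simp), mul_zero]
  exact LinearMap.congr_fun₂ this f g

omit [Fintype V] in
theorem coeff_one_nil (a : V) : coeff K (Path.nil : Path a a) 1 = 1 := by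
  rw [coeff_apply, one_apply_self, Finsupp.single_eq_same]

theorem coeff_one_arrow {a b : V} (α : a ⟶ b) : coeff K α.toPath 1 = 0 := by
  rw [one_eq_sum, map_sum]
  exact Finset.sum_eq_zero fun c _ =>
    coeff_ofPath_of_length_ne _ (Path.nil : Path c c) (by simp)

/-- All paths occurring in `f` have length at least `n`. -/
def LengthGE (n : ℕ) (f : PathAlgebra K V) : Prop :=
  ∀ (a b : V) (q : Path a b), f a b q ≠ 0 → n ≤ q.length

omit [Fintype V] in
theorem lengthGE_ofPath {n : ℕ} {a b : V} (q : Path a b) (h : n ≤ q.length) :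
    LengthGE n (ofPath K q) := by
  intro a' b' q' hq
  by_contra hlt
  exact hq (coeff_ofPath_of_length_ne (K := K) q' q (by omega))

theorem LengthGE.add {n : ℕ} {f g : PathAlgebra K V} (hf : LengthGE n f) (hg : LengthGE n g) :
    LengthGE n (f + g) := by
  intro a b q hq
  by_cases h : f a b q = 0
  · refine hg a b q fun h' => hq ?_
    rw [add_apply, Finsupp.add_apply, h, h', add_zero]
  · exact hf a b q h

theorem LengthGE.smul {n : ℕ} {f : PathAlgebra K V} (hf : LengthGE n f) (c : K) :
    LengthGE n (c • f) := by
  intro a b q hq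
  refine hf a b q fun h => hq ?_
  rw [smul_apply, Finsupp.smul_apply, h, smul_zero]

theorem lengthGE_zero (n : ℕ) : LengthGE n (0 : PathAlgebra K V) :=
  fun a b q h => absurd (show (0 : PathAlgebra K V) a b q = 0 from rfl) h

theorem LengthGE.mul {m n : ℕ} {f g : PathAlgebra K V} (hf : LengthGE m f) (hg : LengthGE n g) :
    LengthGE (m + n) (f * g) := by
  refine induction_support (P := fun f' => LengthGE (m + n) (f' * g)) f ?_ ?_ ?_
  · rw [zero_mul]
    exact lengthGE_zero _
  · intro f₁ f₂ h₁ h₂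
    rw [add_mul]
    exact h₁.add h₂
  · intro c d q r hq
    refine induction_support (P := fun g' => LengthGE (m + n) (r • ofPath K q * g')) g ?_ ?_ ?_
    · rw [mul_zero]
      exact lengthGE_zero _
    · intro f₁ f₂ h₁ h₂
      rw [mul_add]
      exact h₁.add h₂
    · intro a b p s hp
      rw [smul_mul_smul_comm]
      apply LengthGE.smul
      rcases eq_or_ne b c with rfl | hb
      · rw [ofPath_mul_ofPath]
        apply lengthGE_ofPath
        have := hf _ _ _ hq
        have := hg _ _ _ hp
        rw [Path.length_comp]
        omega
      · rw [ofPath_mul_ofPath_of_ne _ _ hb]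
        exact lengthGE_zero _

theorem LengthGE.pow {f : PathAlgebra K V} (hf : LengthGE 1 f) (n : ℕ) : LengthGE n (f ^ n) := by
  induction n with
  | zero => exact fun _ _ _ _ => Nat.zero_le _
  | succ n ih => rw [pow_succ]; exact ih.mul hf

omit [Fintype V] in
theorem lengthGE_one_iff {f : PathAlgebra K V} :
    LengthGE 1 f ↔ ∀ a : V, coeff K (Path.nil : Path a a) f = 0 := by
  constructor
  · intro h a
    by_contra hne
    simpa using h a a Path.nil hne
  · intro h a b q hq
    cases q with
    | nil => exact absurd (h a) hq
    | cons q α => simp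

theorem LengthGE.mem {N : ℕ} {I : Ideal (PathAlgebra K V)}
    (hN : ∀ (a b : V) (q : Path a b), N ≤ q.length → ofPath K q ∈ I)
    {f : PathAlgebra K V} (hf : LengthGE N f) : f ∈ I := by
  refine induction_support (P := fun f' => f' ∈ I) f I.zero_mem (fun _ _ => I.add_mem) ?_
  intro a b q c hq
  rw [← one_mul (ofPath K q), ← smul_mul_assoc]
  exact I.mul_mem_left _ (hN a b q (hf a b q hq))

end PathAlgebra

/-! ### Characters of Λ, its Jacobson radical, and paths acting on modules. -/

namespace PathAlgebra

variable {K : Type uK} {V : Type uV} [Field K] [Quiver.{uE} V] [Fintype V]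
variable {I : Ideal (PathAlgebra K V)} [I.IsTwoSided]

omit [I.IsTwoSided] in
theorem coeff_eq_zero_of_mem (hI : IsAdmissible I) {z : PathAlgebra K V} (hz : z ∈ I)
    {a b : V} (q : Path a b) (hq : q.length < 2) : coeff K q z = 0 := by
  by_contra h
  exact absurd (hI.1 z hz a b q h) (by omega)

/-- The character of `KΓ / I` belonging to the vertex `a`. -/
noncomputable def vertexChar (hI : IsAdmissible I) (a : V) : (PathAlgebra K V ⧸ I) →ₐ[K] K :=
  Ideal.Quotient.liftₐ I
    (AlgHom.ofLinearMap (coeff K (Path.nil : Path a a)) (coeff_one_nil a) (coeff_nil_mul a))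
    fun _ hz => coeff_eq_zero_of_mem hI hz _ (by simp)

theorem vertexChar_mk (hI : IsAdmissible I) (a : V) (f : PathAlgebra K V) :
    vertexChar hI a (Ideal.Quotient.mk I f) = coeff K (Path.nil : Path a a) f := rfl

/-- The coefficient of the arrow `α` in an element of `KΓ / I`. -/
noncomputable def arrowCoeff {a b : V} (α : a ⟶ b) (r : PathAlgebra K V ⧸ I) : K :=
  -- A chosen representative; for admissible I the choice is immaterial, since elements of I involve
  -- no path of length less than two.
  coeff K α.toPath (Function.surjInv Ideal.Quotient.mk_surjective r)

theorem arrowCoeff_mk (hI : IsAdmissible I) {a b : V} (α : a ⟶ b) (f : PathAlgebra K V) :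
    arrowCoeff α (Ideal.Quotient.mk I f) = coeff K α.toPath f := by
  rw [arrowCoeff, ← sub_eq_zero, ← map_sub]
  refine coeff_eq_zero_of_mem hI ?_ _ (by simp)
  exact Ideal.Quotient.eq.1 (Function.surjInv_eq Ideal.Quotient.mk_surjective _)

theorem arrowCoeff_add (hI : IsAdmissible I) {a b : V} (α : a ⟶ b) (r s : PathAlgebra K V ⧸ I) :
    arrowCoeff α (r + s) = arrowCoeff α r + arrowCoeff α s := by
  obtain ⟨f, rfl⟩ := Ideal.Quotient.mk_surjective r
  obtain ⟨g, rfl⟩ := Ideal.Quotient.mk_surjective s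
  rw [← map_add, arrowCoeff_mk hI, arrowCoeff_mk hI, arrowCoeff_mk hI, map_add]

theorem arrowCoeff_smul (hI : IsAdmissible I) {a b : V} (α : a ⟶ b) (c : K)
    (r : PathAlgebra K V ⧸ I) : arrowCoeff α (c • r) = c * arrowCoeff α r := by
  obtain ⟨f, rfl⟩ := Ideal.Quotient.mk_surjective r
  rw [show c • Ideal.Quotient.mk I f = Ideal.Quotient.mk I (c • f) from rfl, arrowCoeff_mk hI,
    arrowCoeff_mk hI, map_smul, smul_eq_mul]

theorem arrowCoeff_one (hI : IsAdmissible I) {a b : V} (α : a ⟶ b) :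
    arrowCoeff α (1 : PathAlgebra K V ⧸ I) = 0 := by
  rw [← map_one (Ideal.Quotient.mk I), arrowCoeff_mk hI, coeff_one_arrow]

theorem arrowCoeff_mul (hI : IsAdmissible I) {a b : V} (α : a ⟶ b)
    (r s : PathAlgebra K V ⧸ I) :
    arrowCoeff α (r * s) =
      vertexChar hI b r * arrowCoeff α s + arrowCoeff α r * vertexChar hI a s := by
  obtain ⟨f, rfl⟩ := Ideal.Quotient.mk_surjective r
  obtain ⟨g, rfl⟩ := Ideal.Quotient.mk_surjective s
  rw [← map_mul, arrowCoeff_mk hI, arrowCoeff_mk hI, arrowCoeff_mk hI, vertexChar_mk,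
    vertexChar_mk, coeff_arrow_mul]

theorem pathIn_mul_pathIn {a b c : V} (p : Path a b) (q : Path b c) :
    pathIn I q * pathIn I p = pathIn I (p.comp q) := by
  rw [← map_mul, ofPath_mul_ofPath]

theorem pathIn_mul_pathIn_of_ne {a b b' c : V} (p : Path a b) (q : Path b' c) (h : b ≠ b') :
    pathIn I q * pathIn I p = 0 := by
  rw [← map_mul, ofPath_mul_ofPath_of_ne _ _ h, map_zero]

theorem pathIn_cons {a b c : V} (p : Path a b) (α : b ⟶ c) :
    pathIn I (p.cons α) = pathIn I α.toPath * pathIn I p := by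
  rw [pathIn_mul_pathIn]; rfl

theorem sum_pathIn_nil : ∑ a : V, pathIn I (Path.nil : Path a a) = 1 := by
  rw [← map_sum, ← one_eq_sum, map_one]

theorem vertexChar_nil_of_ne (hI : IsAdmissible I) {a b : V} (h : a ≠ b) :
    vertexChar hI a (pathIn I (Path.nil : Path b b)) = 0 := by
  rw [vertexChar_mk, coeff_nil_ofPath_nil_of_ne h]

theorem vertexChar_pathIn_of_pos (hI : IsAdmissible I) (a : V) {b c : V} (q : Path b c)
    (hq : 0 < q.length) : vertexChar hI a (pathIn I q) = 0 := by
  rw [vertexChar_mk]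
  exact coeff_ofPath_of_length_ne _ _ (by simpa using hq.ne)

theorem exists_lengthGE_one (hI : IsAdmissible I) {r : PathAlgebra K V ⧸ I}
    (hr : ∀ a, vertexChar hI a r = 0) : ∃ f, LengthGE 1 f ∧ Ideal.Quotient.mk I f = r := by
  obtain ⟨f, rfl⟩ := Ideal.Quotient.mk_surjective r
  exact ⟨f, lengthGE_one_iff.2 hr, rfl⟩

/-- J is the image of the arrow ideal: an element killed by all characters has a representative
without trivial paths, and I contains all long paths, so its left multiples are nilpotent. -/
theorem mem_jacobson_iff (hI : IsAdmissible I) {r : PathAlgebra K V ⧸ I} :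
    r ∈ Ring.jacobson (PathAlgebra K V ⧸ I) ↔ ∀ a, vertexChar hI a r = 0 := by
  constructor
  · intro hr a
    rw [← Ideal.jacobson_bot, Ideal.mem_jacobson_iff] at hr
    by_contra h
    -- With this multiplier the first two terms of z·y·r + z - 1 cancel under the character, leaving
    -- -1 = 0.
    obtain ⟨z, hz⟩ := hr (algebraMap K _ (-(vertexChar hI a r)⁻¹))
    have := congrArg (vertexChar hI a) ((Submodule.mem_bot _).1 hz)
    simp only [map_sub, map_add, map_mul, map_one, map_zero, AlgHom.commutes,
      Algebra.algebraMap_self, RingHom.id_apply] at this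
    rw [mul_assoc, neg_mul, inv_mul_cancel₀ h] at this
    simp at this
  · intro hr
    obtain ⟨N, hN⟩ := hI.2
    rw [← Ideal.jacobson_bot, Ideal.mem_jacobson_iff]
    intro y
    have hnil : IsNilpotent (y * r) := by
      obtain ⟨f, hf, hfr⟩ := exists_lengthGE_one hI (r := y * r) fun a => by
        rw [map_mul, hr a, mul_zero]
      refine ⟨N, ?_⟩
      rw [← hfr, ← map_pow]
      exact Ideal.Quotient.eq_zero_iff_mem.2 ((hf.pow N).mem hN)
    obtain ⟨u, hu⟩ := hnil.isUnit_one_add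
    refine ⟨(u⁻¹ : _ˣ), ?_⟩
    rw [Submodule.mem_bot, mul_assoc, sub_eq_zero]
    calc (↑u⁻¹ : PathAlgebra K V ⧸ I) * (y * r) + ↑u⁻¹ = ↑u⁻¹ * (1 + y * r) := by
          rw [mul_add, mul_one, add_comm]
      _ = 1 := by rw [← hu, Units.inv_mul]

section Modules

variable {U : Type*} [AddCommGroup U] [Module (PathAlgebra K V ⧸ I) U]

theorem sum_nil_smul (y : U) : ∑ a : V, pathIn I (Path.nil : Path a a) • y = y := by
  rw [← Finset.sum_smul, sum_pathIn_nil, one_smul]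

theorem nil_smul_pathIn_smul {a b : V} (q : Path a b) (y : U) :
    pathIn I (Path.nil : Path b b) • pathIn I q • y = pathIn I q • y := by
  rw [smul_smul, pathIn_mul_pathIn, Path.comp_nil]

theorem pathIn_smul_nil_smul {a b : V} (q : Path a b) (y : U) :
    pathIn I q • pathIn I (Path.nil : Path a a) • y = pathIn I q • y := by
  rw [smul_smul, pathIn_mul_pathIn, Path.nil_comp]

theorem pathIn_smul_of_ne {a b c : V} (q : Path b c) (h : a ≠ b) {y : U}
    (hy : pathIn I (Path.nil : Path a a) • y = y) : pathIn I q • y = 0 := by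
  rw [← hy, smul_smul, pathIn_mul_pathIn_of_ne _ _ h, zero_smul]

theorem pathIn_comp_smul {a b c : V} (p : Path a b) (q : Path b c) (y : U) :
    pathIn I (p.comp q) • y = pathIn I q • pathIn I p • y := by
  rw [smul_smul, pathIn_mul_pathIn]

theorem pathIn_cons_smul {a b c : V} (p : Path a b) (α : b ⟶ c) (y : U) :
    pathIn I (p.cons α) • y = pathIn I α.toPath • pathIn I p • y := by
  rw [pathIn_cons, mul_smul]

/-- A submodule which contains `α y` for all arrows `α` contains `J y`. -/
theorem jacobson_smul_mem_of_arrows (hI : IsAdmissible I) {N : Submodule (PathAlgebra K V ⧸ I) U}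
    {y : U} (h : ∀ (a b : V) (α : a ⟶ b), pathIn I α.toPath • y ∈ N)
    {r : PathAlgebra K V ⧸ I} (hr : r ∈ Ring.jacobson (PathAlgebra K V ⧸ I)) : r • y ∈ N := by
  obtain ⟨f, hf, rfl⟩ := exists_lengthGE_one hI ((mem_jacobson_iff hI).1 hr)
  refine induction_support (P := fun f' => Ideal.Quotient.mk I f' • y ∈ N) f ?_ ?_ ?_
  · rw [map_zero, zero_smul]
    exact N.zero_mem
  · intro g g' hg hg'
    rw [map_add, add_smul]
    exact N.add_mem hg hg'
  · intro a b q c hq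
    have hq' : 1 ≤ q.length := hf a b q hq
    rw [← one_mul (ofPath K q), ← smul_mul_assoc, map_mul, mul_smul]
    refine N.smul_mem _ ?_
    obtain ⟨d, α, q', -, rfl⟩ := Path.eq_toPath_comp_of_length_eq_succ q
      (n := q.length - 1) (by omega)
    show pathIn I _ • y ∈ N
    rw [pathIn_comp_smul]
    exact N.smul_mem _ (h _ _ α)

/-- Reflects Λe = Ke + Je for a vertex e: on an element fixed by a vertex, the algebra acts by
scalars modulo the radical. This is what allows one to speak of leading coefficients. -/
theorem smul_eq_vertexChar_smul_add [Module K U] [IsScalarTower K (PathAlgebra K V ⧸ I) U]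
    (hI : IsAdmissible I) {d : V} {y : U} (hy : pathIn I (Path.nil : Path d d) • y = y)
    (r : PathAlgebra K V ⧸ I) : ∃ j ∈ Ring.jacobson (PathAlgebra K V ⧸ I),
      r • y = vertexChar hI d r • y + j • y := by
  refine ⟨(r - algebraMap K _ (vertexChar hI d r)) * pathIn I (Path.nil : Path d d), ?_, ?_⟩
  · rw [mem_jacobson_iff hI]
    intro a
    rw [map_mul, map_sub, AlgHom.commutes]
    rcases eq_or_ne a d with rfl | h
    · simp
    · rw [vertexChar_nil_of_ne hI h, mul_zero]
  · rw [mul_smul, hy, sub_smul, algebraMap_smul]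
    abel

theorem nil_mul_mul_nil_mem_jacobson (hI : IsAdmissible I) {d e : V} (h : d ≠ e)
    (r : PathAlgebra K V ⧸ I) :
    pathIn I (Path.nil : Path d d) * r * pathIn I (Path.nil : Path e e) ∈
      Ring.jacobson (PathAlgebra K V ⧸ I) := by
  rw [mem_jacobson_iff hI]
  intro a
  rw [map_mul, map_mul]
  rcases eq_or_ne a d with rfl | h'
  · rw [vertexChar_nil_of_ne hI h, mul_zero]
  · rw [vertexChar_nil_of_ne hI h', zero_mul, zero_mul]

theorem pathIn_mem_jacobson (hI : IsAdmissible I) {a b : V} (q : Path a b) (hq : 0 < q.length) :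
    pathIn I q ∈ Ring.jacobson (PathAlgebra K V ⧸ I) :=
  (mem_jacobson_iff hI).2 fun _ => vertexChar_pathIn_of_pos hI _ q hq

end Modules

end PathAlgebra

/-! ### Radical layers, chains of submodules, and composition length. -/

namespace PathAlgebra

variable {K : Type uK} {V : Type uV} [Field K] [Quiver.{uE} V] [Fintype V]
variable {I : Ideal (PathAlgebra K V)} [I.IsTwoSided]

section radPow

variable {Λ : Type*} [Ring Λ] {U U' : Type*} [AddCommGroup U] [Module Λ U]
  [AddCommGroup U'] [Module Λ U']

theorem smul_mem_radPow_succ {r : Λ} (hr : r ∈ Ring.jacobson Λ) {i : ℕ} {y : U}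
    (hy : y ∈ radPow Λ U i) : r • y ∈ radPow Λ U (i + 1) :=
  Submodule.subset_span ⟨r, hr, y, hy, rfl⟩

theorem radPow_succ_le_iff {i : ℕ} {N : Submodule Λ U} :
    radPow Λ U (i + 1) ≤ N ↔ ∀ r ∈ Ring.jacobson Λ, ∀ y ∈ radPow Λ U i, r • y ∈ N := by
  refine ⟨fun h r hr y hy => h (smul_mem_radPow_succ hr hy), fun h => Submodule.span_le.2 ?_⟩
  rintro _ ⟨r, hr, y, hy, rfl⟩
  exact h r hr y hy

theorem radPow_antitone : Antitone (radPow Λ U) :=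
  antitone_nat_of_succ_le fun _ => radPow_succ_le_iff.2 fun r _ _ hy => Submodule.smul_mem _ r hy

/-- The shift by k serves to compare the radical layers of the submodule J^k U with those of U. -/
theorem radPow_map_le_add (f : U →ₗ[Λ] U') (k : ℕ) (hf : ∀ y, f y ∈ radPow Λ U' k) (i : ℕ) :
    (radPow Λ U i).map f ≤ radPow Λ U' (k + i) := by
  rw [Submodule.map_le_iff_le_comap]
  induction i with
  | zero => exact fun y _ => hf y
  | succ i ih =>
    refine radPow_succ_le_iff.2 fun r hr y hy => ?_
    rw [Submodule.mem_comap, map_smul]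
    exact smul_mem_radPow_succ hr (ih hy)

theorem radPow_le_map_of_surjective (f : U →ₗ[Λ] U') (hf : Function.Surjective f) (i : ℕ) :
    radPow Λ U' i ≤ (radPow Λ U i).map f := by
  induction i with
  | zero =>
    intro y _
    obtain ⟨z, rfl⟩ := hf y
    exact Submodule.mem_map_of_mem trivial
  | succ i ih =>
    refine radPow_succ_le_iff.2 fun r hr y hy => ?_
    obtain ⟨z, hz, rfl⟩ := ih hy
    exact ⟨r • z, smul_mem_radPow_succ hr hz, map_smul f r z⟩

theorem radPow_eq_of_succ_eq {i : ℕ} (h : radPow Λ U (i + 1) = radPow Λ U i) (k : ℕ) :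
    radPow Λ U (i + k) = radPow Λ U i := by
  induction k with
  | zero => rfl
  | succ k ih =>
    refine le_antisymm (radPow_antitone (by omega)) ?_
    rw [← h]
    refine radPow_succ_le_iff.2 fun r hr y hy => ?_
    rw [← ih] at hy
    exact smul_mem_radPow_succ hr hy

end radPow

variable {U : Type*} [AddCommGroup U] [Module (PathAlgebra K V ⧸ I) U]

theorem pathIn_smul_mem_radPow (hI : IsAdmissible I) {a b : V} (q : Path a b) {i : ℕ} {y : U}
    (hy : y ∈ radPow (PathAlgebra K V ⧸ I) U i) :
    pathIn I q • y ∈ radPow (PathAlgebra K V ⧸ I) U (i + q.length) := by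
  induction q with
  | nil => exact Submodule.smul_mem _ _ hy
  | cons q α ih =>
    rw [pathIn_cons_smul, Path.length_cons, ← add_assoc]
    exact smul_mem_radPow_succ (pathIn_mem_jacobson hI _ (by simp)) ih

theorem radPow_le_span_lengthGE (hI : IsAdmissible I) (i : ℕ) :
    radPow (PathAlgebra K V ⧸ I) U i ≤ Submodule.span (PathAlgebra K V ⧸ I)
      {y | ∃ f, LengthGE i f ∧ ∃ z : U, y = Ideal.Quotient.mk I f • z} := by
  induction i with
  | zero =>
    intro y _
    exact Submodule.subset_span ⟨1, fun _ _ _ _ => Nat.zero_le _, y, by rw [map_one, one_smul]⟩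
  | succ i ih =>
    refine radPow_succ_le_iff.2 fun r hr y hy => ?_
    obtain ⟨g, hg, rfl⟩ := exists_lengthGE_one hI ((mem_jacobson_iff hI).1 hr)
    replace hy := ih hy
    clear hr
    induction hy using Submodule.span_induction generalizing g with
    | mem y h =>
      obtain ⟨f, hf, z, rfl⟩ := h
      refine Submodule.subset_span ⟨g * f, ?_, z, ?_⟩
      · rw [add_comm i 1]; exact hg.mul hf
      · rw [map_mul, mul_smul]
    | zero => rw [smul_zero]; exact Submodule.zero_mem _
    | add y y' _ _ h h' => rw [smul_add]; exact Submodule.add_mem _ (h g hg) (h' g hg)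
    | smul s y _ h =>
      obtain ⟨f, rfl⟩ := Ideal.Quotient.mk_surjective s
      rw [smul_smul, ← map_mul]
      exact h (g * f) (LengthGE.mul (n := 0) hg fun _ _ _ _ => Nat.zero_le _)

theorem exists_radPow_eq_bot (hI : IsAdmissible I) : ∃ N, ∀ (U : Type*) [AddCommGroup U]
    [Module (PathAlgebra K V ⧸ I) U], radPow (PathAlgebra K V ⧸ I) U N = ⊥ := by
  obtain ⟨N, hN⟩ := hI.2
  refine ⟨N, fun U _ _ => ?_⟩
  rw [eq_bot_iff]
  refine (radPow_le_span_lengthGE hI N).trans (Submodule.span_le.2 ?_)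
  rintro _ ⟨f, hf, z, rfl⟩
  rw [Ideal.Quotient.eq_zero_iff_mem.2 (hf.mem hN), zero_smul]
  exact Submodule.zero_mem _

/-- Nakayama's argument: a repeated layer would repeat forever, but J is nilpotent. -/
theorem radPow_succ_ne (hI : IsAdmissible I) {i : ℕ}
    (h : radPow (PathAlgebra K V ⧸ I) U i ≠ ⊥) :
    radPow (PathAlgebra K V ⧸ I) U (i + 1) ≠ radPow (PathAlgebra K V ⧸ I) U i := by
  intro h'
  obtain ⟨N, hN⟩ := exists_radPow_eq_bot hI
  apply h
  rw [← radPow_eq_of_succ_eq h' N, eq_bot_iff, ← hN U]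
  exact radPow_antitone (Nat.le_add_left N i)

/-- If `y` is not zero then there is a last radical layer which contains `y`. -/
theorem exists_mem_radPow_notMem_succ (hI : IsAdmissible I) {i : ℕ} {y : U} (hy : y ≠ 0)
    (hi : y ∈ radPow (PathAlgebra K V ⧸ I) U i) :
    ∃ j, i ≤ j ∧ y ∈ radPow (PathAlgebra K V ⧸ I) U j ∧
      y ∉ radPow (PathAlgebra K V ⧸ I) U (j + 1) := by
  by_contra! h
  obtain ⟨N, hN⟩ := exists_radPow_eq_bot hI
  have : ∀ k, y ∈ radPow (PathAlgebra K V ⧸ I) U (i + k) := fun k => by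
    induction k with
    | zero => exact hi
    | succ k ih => exact h _ (Nat.le_add_right i k) ih
  apply hy
  rw [← Submodule.mem_bot (PathAlgebra K V ⧸ I), ← hN U]
  exact radPow_antitone (Nat.le_add_left N i) (this N)

theorem exists_nil_smul_notMem {N : Submodule (PathAlgebra K V ⧸ I) U} {y : U} (hy : y ∉ N) :
    ∃ a : V, pathIn I (Path.nil : Path a a) • y ∉ N := by
  by_contra! h
  apply hy
  rw [← sum_nil_smul (I := I) y]
  exact Submodule.sum_mem _ fun a _ => h a

/-- If some z' = e_b z in J^i U were outside Λy, the chain condition would give y = rz'. Modulo J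
the element r acts on z' as a scalar when b = d, and e_d r e_b lies in J when b ≠ d. So either z' is
recovered from y modulo J^(i+1) U, which Λy contains, or y itself lies in J^(i+1) U. -/
theorem span_singleton_eq_radPow (hI : IsAdmissible I)
    (total : ∀ N N' : Submodule (PathAlgebra K V ⧸ I) U, N ≤ N' ∨ N' ≤ N)
    {d : V} {y : U} (hy : pathIn I (Path.nil : Path d d) • y = y) {i : ℕ}
    (hi : y ∈ radPow (PathAlgebra K V ⧸ I) U i)
    (hi' : y ∉ radPow (PathAlgebra K V ⧸ I) U (i + 1)) :
    Submodule.span (PathAlgebra K V ⧸ I) {y} = radPow (PathAlgebra K V ⧸ I) U i := by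
  have hle : radPow (PathAlgebra K V ⧸ I) U (i + 1) ≤ Submodule.span (PathAlgebra K V ⧸ I) {y} :=
    (total _ _).resolve_right fun h => hi' (h (Submodule.mem_span_singleton_self y))
  refine le_antisymm ((Submodule.span_singleton_le_iff_mem _ _).2 hi) fun z hz => ?_
  by_contra hzy
  obtain ⟨b, hb⟩ := exists_nil_smul_notMem hzy
  set z' := pathIn I (Path.nil : Path b b) • z with hz'
  have hz'i : z' ∈ radPow (PathAlgebra K V ⧸ I) U i := Submodule.smul_mem _ _ hz
  have hbz : pathIn I (Path.nil : Path b b) • z' = z' := nil_smul_pathIn_smul _ _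
  have hyz : y ∈ Submodule.span (PathAlgebra K V ⧸ I) {z'} := by
    rcases total (Submodule.span _ {y}) (Submodule.span _ {z'}) with h | h
    · exact h (Submodule.mem_span_singleton_self y)
    · exact absurd (h (Submodule.mem_span_singleton_self z')) hb
  obtain ⟨r, hr⟩ := Submodule.mem_span_singleton.1 hyz
  rcases eq_or_ne d b with rfl | hdb
  · let _ : Module K U := Module.compHom U (algebraMap K (PathAlgebra K V ⧸ I))
    have _ : IsScalarTower K (PathAlgebra K V ⧸ I) U := IsScalarTower.of_algebraMap_smul fun _ _ => rfl
    obtain ⟨j, hj, hjr⟩ := smul_eq_vertexChar_smul_add hI hbz r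
    rw [hr] at hjr
    have hjz : j • z' ∈ radPow (PathAlgebra K V ⧸ I) U (i + 1) := smul_mem_radPow_succ hj hz'i
    rcases eq_or_ne (vertexChar hI d r) 0 with h0 | h0
    · rw [h0, zero_smul, zero_add] at hjr
      exact hi' (hjr ▸ hjz)
    · apply hb
      have : z' = (vertexChar hI d r)⁻¹ • (y - j • z') := by
        rw [hjr, add_sub_cancel_right, inv_smul_smul₀ h0]
      rw [this, ← algebraMap_smul (PathAlgebra K V ⧸ I)]
      exact Submodule.smul_mem _ _
        (Submodule.sub_mem _ (Submodule.mem_span_singleton_self y) (hle hjz))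
  · apply hi'
    rw [← hy, ← hr, ← hbz, smul_smul, smul_smul]
    exact smul_mem_radPow_succ (nil_mul_mul_nil_mem_jacobson hI hdb r) hz'i

theorem span_singleton_eq_radPow_iff (hI : IsAdmissible I)
    (total : ∀ N N' : Submodule (PathAlgebra K V ⧸ I) U, N ≤ N' ∨ N' ≤ N)
    {d : V} {y : U} (hy : pathIn I (Path.nil : Path d d) • y = y) (hy0 : y ≠ 0) {i : ℕ} :
    Submodule.span (PathAlgebra K V ⧸ I) {y} = radPow (PathAlgebra K V ⧸ I) U i ↔
      y ∈ radPow (PathAlgebra K V ⧸ I) U i ∧ y ∉ radPow (PathAlgebra K V ⧸ I) U (i + 1) := by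
  refine ⟨fun h => ?_, fun h => span_singleton_eq_radPow hI total hy h.1 h.2⟩
  have hi : y ∈ radPow (PathAlgebra K V ⧸ I) U i := h ▸ Submodule.mem_span_singleton_self y
  refine ⟨hi, fun hi' => radPow_succ_ne (U := U) hI (i := i) ?_ ?_⟩
  · intro h0
    rw [h0] at hi
    exact hy0 hi
  · refine le_antisymm (radPow_antitone (by omega)) ?_
    rw [← h]
    exact (Submodule.span_singleton_le_iff_mem _ _).2 hi'

/-- The submodules form a chain as soon as each radical layer is generated by one element which
is fixed by a vertex. -/
theorem exists_eq_radPow (hI : IsAdmissible I)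
    (gen : ∀ i, radPow (PathAlgebra K V ⧸ I) U i ≠ ⊥ → ∃ (d : V) (y : U), pathIn I (Path.nil : Path d d) • y = y ∧
      radPow (PathAlgebra K V ⧸ I) U i = Submodule.span (PathAlgebra K V ⧸ I) {y})
    (N : Submodule (PathAlgebra K V ⧸ I) U) : ∃ i, N = radPow (PathAlgebra K V ⧸ I) U i := by
  obtain ⟨M, hM⟩ := exists_radPow_eq_bot hI
  rcases eq_or_ne N ⊥ with rfl | hN
  · exact ⟨M, (hM U).symm⟩
  classical
  -- The first layer not containing N has index i + 1; then N is the preceding layer J^i U, since an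
  -- element of N outside J^(i+1) U already generates it.
  have hex : ∃ i, ¬ N ≤ radPow (PathAlgebra K V ⧸ I) U i :=
    ⟨M, fun h => hN (eq_bot_iff.2 (hM U ▸ h))⟩
  obtain ⟨i, hi⟩ : ∃ i, Nat.find hex = i + 1 := by
    refine Nat.exists_eq_succ_of_ne_zero fun h0 => ?_
    have := Nat.find_spec hex
    rw [h0] at this
    exact this le_top
  have h1 : N ≤ radPow (PathAlgebra K V ⧸ I) U i := by
    by_contra h
    have := Nat.find_min' hex h
    omega
  have h2 : ¬ N ≤ radPow (PathAlgebra K V ⧸ I) U (i + 1) := hi ▸ Nat.find_spec hex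
  refine ⟨i, le_antisymm h1 ?_⟩
  obtain ⟨n, hn, hn'⟩ := SetLike.not_le_iff_exists.1 h2
  obtain ⟨d, y, hy, hgen⟩ := gen i fun h => hN (eq_bot_iff.2 (h ▸ h1))
  have hni := h1 hn
  rw [hgen] at hni ⊢
  obtain ⟨r, rfl⟩ := Submodule.mem_span_singleton.1 hni
  have hyi : y ∈ radPow (PathAlgebra K V ⧸ I) U i :=
    hgen ▸ Submodule.mem_span_singleton_self y
  let _ : Module K U := Module.compHom U (algebraMap K (PathAlgebra K V ⧸ I))
  have _ : IsScalarTower K (PathAlgebra K V ⧸ I) U := IsScalarTower.of_algebraMap_smul fun _ _ => rfl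
  obtain ⟨j, hj, hjr⟩ := smul_eq_vertexChar_smul_add hI hy r
  rcases eq_or_ne (vertexChar hI d r) 0 with h0 | h0
  · rw [h0, zero_smul, zero_add] at hjr
    exact absurd (hjr ▸ smul_mem_radPow_succ hj hyi) hn'
  set c := vertexChar hI d r
  have hcj := hj
  rw [← Ideal.jacobson_bot, Ideal.mem_jacobson_iff] at hcj
  -- Here z is a left inverse of 1 + c⁻¹j, so z·c⁻¹ undoes the action of r on y, which is that of c
  -- + j.
  obtain ⟨z, hz⟩ := hcj (algebraMap K _ c⁻¹)
  rw [Submodule.mem_bot, sub_eq_zero] at hz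
  refine (Submodule.span_singleton_le_iff_mem _ _).2 ?_
  have : y = (z * algebraMap K _ c⁻¹) • r • y := by
    rw [hjr, smul_add, ← algebraMap_smul (PathAlgebra K V ⧸ I) c, smul_smul, smul_smul,
      ← add_smul, mul_assoc, ← map_mul, inv_mul_cancel₀ h0, map_one, mul_one, add_comm, hz,
      one_smul]
  rw [this]
  exact N.smul_mem _ hn

theorem total_of_generators (hI : IsAdmissible I)
    (gen : ∀ i, radPow (PathAlgebra K V ⧸ I) U i ≠ ⊥ → ∃ (d : V) (y : U), pathIn I (Path.nil : Path d d) • y = y ∧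
      radPow (PathAlgebra K V ⧸ I) U i = Submodule.span (PathAlgebra K V ⧸ I) {y})
    (N N' : Submodule (PathAlgebra K V ⧸ I) U) : N ≤ N' ∨ N' ≤ N := by
  obtain ⟨i, rfl⟩ := exists_eq_radPow hI gen N
  obtain ⟨j, rfl⟩ := exists_eq_radPow hI gen N'
  exact (le_total j i).imp (fun h => radPow_antitone h) fun h => radPow_antitone h

theorem generators_of_total (hI : IsAdmissible I)
    (total : ∀ N N' : Submodule (PathAlgebra K V ⧸ I) U, N ≤ N' ∨ N' ≤ N) {i : ℕ}
    (h : radPow (PathAlgebra K V ⧸ I) U i ≠ ⊥) :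
    ∃ (d : V) (y : U), pathIn I (Path.nil : Path d d) • y = y ∧
      radPow (PathAlgebra K V ⧸ I) U i = Submodule.span (PathAlgebra K V ⧸ I) {y} := by
  have h2 : ¬ radPow (PathAlgebra K V ⧸ I) U i ≤ radPow (PathAlgebra K V ⧸ I) U (i + 1) :=
    fun h' => radPow_succ_ne hI h (le_antisymm (radPow_antitone (by omega)) h')
  obtain ⟨y, hy, hy'⟩ := SetLike.not_le_iff_exists.1 h2
  obtain ⟨d, hd⟩ := exists_nil_smul_notMem hy'
  exact ⟨d, _, nil_smul_pathIn_smul _ _, (span_singleton_eq_radPow hI total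
    (nil_smul_pathIn_smul _ _) (Submodule.smul_mem _ _ hy) hd).symm⟩

/-- In a uniserial module the only submodules are the J^i U with i ≤ n, so a chain has at most n + 1
members. -/
theorem length_le_of_radPow_eq_bot (hI : IsAdmissible I)
    (total : ∀ N N' : Submodule (PathAlgebra K V ⧸ I) U, N ≤ N' ∨ N' ≤ N) {n : ℕ}
    (hn : radPow (PathAlgebra K V ⧸ I) U n = ⊥) :
    Module.length (PathAlgebra K V ⧸ I) U ≤ n := by
  have hex : ∀ N : Submodule (PathAlgebra K V ⧸ I) U, ∃ i : Fin (n + 1),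
      N = radPow (PathAlgebra K V ⧸ I) U i := by
    intro N
    obtain ⟨i, rfl⟩ := exists_eq_radPow hI (fun i h => generators_of_total hI total h) N
    rcases le_or_gt i n with h | h
    · exact ⟨⟨i, by omega⟩, rfl⟩
    · refine ⟨⟨n, by omega⟩, ?_⟩
      rw [hn, eq_bot_iff, ← hn]
      exact radPow_antitone h.le
  choose f hf using hex
  -- Larger submodules have smaller radical index, so the index is reversed.
  have hmono : StrictMono fun N => Fin.rev (f N) := by
    intro N N' h
    rw [Fin.rev_lt_rev]
    by_contra hle
    refine absurd h (not_lt_of_ge ?_)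
    rw [hf N, hf N']
    exact radPow_antitone (not_lt.1 hle)
  have : (Module.length (PathAlgebra K V ⧸ I) U : WithBot ℕ∞) ≤ n := by
    rw [Module.coe_length]
    refine iSup_le fun p => ?_
    have h := Fintype.card_le_of_injective _ (hmono.comp p.strictMono).injective
    rw [Fintype.card_fin, Fintype.card_fin] at h
    exact_mod_cast Nat.le_of_succ_le_succ h
  exact_mod_cast this

theorem le_length_of_radPow_ne_bot (hI : IsAdmissible I) {n : ℕ}
    (hn : radPow (PathAlgebra K V ⧸ I) U n ≠ ⊥) :
    (n + 1 : ℕ∞) ≤ Module.length (PathAlgebra K V ⧸ I) U := by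
  have hmono : StrictMono fun i : Fin (n + 2) =>
      radPow (PathAlgebra K V ⧸ I) U (Fin.rev i) := by
    intro i j h
    have hlt : (Fin.rev j : ℕ) < Fin.rev i := Fin.rev_lt_rev.2 h
    have hle : (Fin.rev i : ℕ) ≤ n + 1 := by have := (Fin.rev i).isLt; omega
    refine lt_of_le_of_lt (radPow_antitone hlt) ?_
    refine lt_of_le_of_ne (radPow_antitone (Nat.le_succ _)) (radPow_succ_ne hI ?_)
    intro h0
    apply hn
    rw [eq_bot_iff, ← h0]
    exact radPow_antitone (by omega)
  have := Order.LTSeries.length_le_krullDim (LTSeries.mk (n + 1) _ hmono)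
  rw [← Module.coe_length] at this
  exact_mod_cast this

end PathAlgebra

/-! ### The chain of right subpaths of a path. -/

namespace IsRightSubpath

variable {V : Type uV} [Quiver.{uE} V]

theorem refl {a b : V} (p : Path a b) : IsRightSubpath p p := ⟨Path.nil, rfl⟩

theorem nil {a b : V} (p : Path a b) : IsRightSubpath Path.nil p := ⟨p, (Path.nil_comp p).symm⟩

theorem comp_right {a b c : V} (u : Path a c) (w : Path c b) : IsRightSubpath u (u.comp w) :=
  ⟨w, rfl⟩

theorem trans {a b c d : V} {u : Path a c} {v : Path a d} {p : Path a b}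
    (h : IsRightSubpath u v) (h' : IsRightSubpath v p) : IsRightSubpath u p := by
  obtain ⟨w, rfl⟩ := h
  obtain ⟨w', rfl⟩ := h'
  exact ⟨w.comp w', Path.comp_assoc _ _ _⟩

theorem of_cons {a b c d : V} {u : Path a c} {α : c ⟶ d} {p : Path a b}
    (h : IsRightSubpath (u.cons α) p) : IsRightSubpath u p :=
  trans ⟨α.toPath, rfl⟩ h

theorem length_le {a b c : V} {u : Path a c} {p : Path a b} (h : IsRightSubpath u p) :
    u.length ≤ p.length := by
  obtain ⟨w, rfl⟩ := h
  rw [Path.length_comp]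
  omega

theorem cons_cases {a b c d : V} {u : Path a d} {p : Path a b} {β : b ⟶ c}
    (h : IsRightSubpath u (p.cons β)) :
    (⟨d, u⟩ : Σ d, Path a d) = ⟨c, p.cons β⟩ ∨ IsRightSubpath u p := by
  obtain ⟨w, hw⟩ := h
  cases w with
  | nil => exact Or.inl (congrArg (Sigma.mk _) hw.symm)
  | cons w γ =>
    rw [Path.comp_cons] at hw
    obtain rfl := Path.obj_eq_of_cons_eq_cons hw
    exact Or.inr ⟨w, eq_of_heq (Path.heq_of_cons_eq_cons hw)⟩

/-- A right subpath is an initial stretch of p, so its length determines it together with its end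
vertex; hence the equality in a sigma type. -/
theorem eq_of_length_eq {a b c d : V} {u : Path a c} {v : Path a d} {p : Path a b}
    (hu : IsRightSubpath u p) (hv : IsRightSubpath v p) (h : u.length = v.length) :
    (⟨c, u⟩ : Σ d, Path a d) = ⟨d, v⟩ := by
  induction p with
  | nil =>
    have h1 := hu.length_le
    have h2 := hv.length_le
    rw [Path.length_nil] at h1 h2
    cases u with
    | nil =>
      cases v with
      | nil => rfl
      | cons v β => simp at h2
    | cons u β => simp at h1
  | cons p β ih =>
    rcases hu.cons_cases with hu' | hu'
    · rcases hv.cons_cases with hv' | hv'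
      · rw [hu', hv']
      · cases hu'
        have := hv'.length_le
        rw [Path.length_cons] at h
        omega
    · rcases hv.cons_cases with hv' | hv'
      · cases hv'
        have := hu'.length_le
        rw [Path.length_cons] at h
        omega
      · exact ih hu' hv'

theorem exists_length_eq {a b : V} (p : Path a b) {n : ℕ} (hn : n ≤ p.length) :
    ∃ (c : V) (u : Path a c), IsRightSubpath u p ∧ u.length = n := by
  induction p with
  | nil => exact ⟨a, Path.nil, refl _, by rw [Path.length_nil] at hn ⊢; omega⟩
  | cons p β ih =>
    rcases Nat.lt_or_ge p.length n with h | h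
    · exact ⟨_, p.cons β, refl _, by rw [Path.length_cons] at hn ⊢; omega⟩
    · obtain ⟨c, u, hu, rfl⟩ := ih h
      exact ⟨c, u, hu.trans ⟨β.toPath, rfl⟩, rfl⟩

theorem of_length_le {a b c d : V} {u : Path a c} {v : Path a d} {p : Path a b}
    (hu : IsRightSubpath u p) (hv : IsRightSubpath v p) (h : u.length ≤ v.length) :
    IsRightSubpath u v := by
  obtain ⟨c', u', hu', hlen⟩ := exists_length_eq v h
  cases eq_of_length_eq hu (hu'.trans hv) hlen.symm
  exact hu'

theorem eq_self_of_length_eq {a b c : V} {u : Path a c} {p : Path a b} (hu : IsRightSubpath u p)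
    (h : u.length = p.length) : (⟨c, u⟩ : Σ d, Path a d) = ⟨b, p⟩ :=
  eq_of_length_eq hu (refl p) h

/-- A right subpath of `p`, as an element of `RightSubpathTo p d`. -/
def subtypeMk {a b d : V} {p : Path a b} {u : Path a d} (hu : IsRightSubpath u p) :
    RightSubpathTo p d := ⟨u, hu⟩

theorem subtypeMk_val {a b d : V} {p : Path a b} {u : Path a d} (hu : IsRightSubpath u p) :
    hu.subtypeMk.1 = u := rfl

end IsRightSubpath

/-! ### The basis of a uniserial module given by a mast and a top element. -/

namespace PathAlgebra

variable {K : Type uK} {V : Type uV} [Field K] [Quiver.{uE} V] [Fintype V]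
variable {I : Ideal (PathAlgebra K V)} [I.IsTwoSided]

/-- The submodules of `U` form a chain, `p` is a mast of `U`, and `x` is a top element of `U`,
expressed without reference to the composition length. -/
structure IsMastTop (I : Ideal (PathAlgebra K V)) [I.IsTwoSided] {a b : V} (p : Path a b)
    {U : Type*} [AddCommGroup U] [Module (PathAlgebra K V ⧸ I) U] (x : U) : Prop where
  total : ∀ N N' : Submodule (PathAlgebra K V ⧸ I) U, N ≤ N' ∨ N' ≤ N
  idem : pathIn I (Path.nil : Path a a) • x = x
  radPow_eq_bot : radPow (PathAlgebra K V ⧸ I) U (p.length + 1) = ⊥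
  ne_zero : pathIn I p • x ≠ 0

namespace IsMastTop

variable {U : Type*} [AddCommGroup U] [Module (PathAlgebra K V ⧸ I) U]
variable {a b : V} {p : Path a b} {x : U}

theorem radPow_eq_bot_of_lt (h : IsMastTop I p x) {i : ℕ} (hi : p.length < i) :
    radPow (PathAlgebra K V ⧸ I) U i = ⊥ := by
  rw [eq_bot_iff, ← h.radPow_eq_bot]
  exact radPow_antitone hi

theorem smul_mem (hI : IsAdmissible I) {c d : V} (u : Path c d) (x : U) :
    pathIn I u • x ∈ radPow (PathAlgebra K V ⧸ I) U u.length := by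
  simpa using pathIn_smul_mem_radPow (i := 0) hI u (y := x) trivial

/-- If ux dropped one layer too deep, the rest of p would carry it into the layer beyond the length
of p, which is zero, whereas px ≠ 0. -/
theorem smul_notMem (h : IsMastTop I p x) (hI : IsAdmissible I) {c : V} {u : Path a c}
    (hu : IsRightSubpath u p) :
    pathIn I u • x ∉ radPow (PathAlgebra K V ⧸ I) U (u.length + 1) := by
  intro hmem
  obtain ⟨w, rfl⟩ := hu
  apply h.ne_zero
  rw [pathIn_comp_smul, ← Submodule.mem_bot (PathAlgebra K V ⧸ I), ← h.radPow_eq_bot]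
  have := pathIn_smul_mem_radPow hI w hmem
  rwa [Path.length_comp, show u.length + w.length + 1 = u.length + 1 + w.length by omega]

theorem span_eq_radPow (h : IsMastTop I p x) (hI : IsAdmissible I) {c : V} {u : Path a c}
    (hu : IsRightSubpath u p) : Submodule.span (PathAlgebra K V ⧸ I) {pathIn I u • x} =
      radPow (PathAlgebra K V ⧸ I) U u.length :=
  span_singleton_eq_radPow hI h.total (nil_smul_pathIn_smul u x) (smul_mem hI u x)
    (h.smul_notMem hI hu)

theorem notMem_radPow_one (h : IsMastTop I p x) (hI : IsAdmissible I) :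
    x ∉ radPow (PathAlgebra K V ⧸ I) U 1 := by
  have := h.smul_notMem hI (IsRightSubpath.nil p)
  rwa [h.idem] at this

theorem span_eq_top (h : IsMastTop I p x) (hI : IsAdmissible I) :
    Submodule.span (PathAlgebra K V ⧸ I) {x} = ⊤ := by
  have := h.span_eq_radPow hI (IsRightSubpath.nil p)
  rwa [h.idem] at this

/-- Two top elements with the same vertex have the same masts. -/
theorem change_top (h : IsMastTop I p x) (hI : IsAdmissible I) {y : U}
    (hy : pathIn I (Path.nil : Path a a) • y = y)
    (hy' : y ∉ radPow (PathAlgebra K V ⧸ I) U 1) : IsMastTop I p y where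
  total := h.total
  idem := hy
  radPow_eq_bot := h.radPow_eq_bot
  ne_zero := by
    intro h0
    have htop := span_singleton_eq_radPow (i := 0) hI h.total hy trivial hy'
    have hx : x ∈ Submodule.span (PathAlgebra K V ⧸ I) {y} := by rw [htop]; trivial
    obtain ⟨r, rfl⟩ := Submodule.mem_span_singleton.1 hx
    let _ : Module K U := Module.compHom U (algebraMap K (PathAlgebra K V ⧸ I))
    have _ : IsScalarTower K (PathAlgebra K V ⧸ I) U :=
      IsScalarTower.of_algebraMap_smul fun _ _ => rfl
    obtain ⟨j, hj, hjr⟩ := smul_eq_vertexChar_smul_add hI hy r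
    apply h.ne_zero
    -- The old top element is a scalar multiple of y plus an element of JU, which p annihilates; so
    -- py = 0 would force p to kill the old one too.
    rw [hjr, smul_add, ← algebraMap_smul (PathAlgebra K V ⧸ I), smul_smul, ← Algebra.commutes,
      mul_smul, h0, smul_zero, zero_add, ← Submodule.mem_bot (PathAlgebra K V ⧸ I),
      ← h.radPow_eq_bot, add_comm]
    exact pathIn_smul_mem_radPow hI p (smul_mem_radPow_succ (i := 0) hj trivial)

section Expansion

variable [Module K U] [IsScalarTower K (PathAlgebra K V ⧸ I) U]

/-- The combination of right subpaths of `p` ending in `d`, applied to `x`. -/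
noncomputable def comb (I : Ideal (PathAlgebra K V)) [I.IsTwoSided] {U : Type*} [AddCommGroup U]
    [Module (PathAlgebra K V ⧸ I) U] [Module K U] {a b : V} (p : Path a b) (x : U) (d : V) :
    (RightSubpathTo p d →₀ K) →ₗ[K] U :=
  Finsupp.linearCombination K fun v => pathIn I v.1 • x

omit [IsScalarTower K (PathAlgebra K V ⧸ I) U] in
theorem comb_single (d : V) (v : RightSubpathTo p d) (c : K) :
    comb I p x d (Finsupp.single v c) = c • pathIn I v.1 • x :=
  Finsupp.linearCombination_single _ _ _

/-- Descent through the layers: modulo J^(i+1) U an element of J^i U is a scalar multiple of ux, u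
being the right subpath of length i. This term survives e_d only if u ends in d; the remainder lies
one layer deeper. -/
theorem exists_comb (h : IsMastTop I p x) (hI : IsAdmissible I) (i : ℕ) {y : U}
    (hy : y ∈ radPow (PathAlgebra K V ⧸ I) U i) (d : V) :
    ∃ k : RightSubpathTo p d →₀ K, pathIn I (Path.nil : Path d d) • y = comb I p x d k ∧
      ∀ v, k v ≠ 0 → i ≤ v.1.length := by
  classical
  by_cases hi : p.length < i
  · rw [h.radPow_eq_bot_of_lt hi, Submodule.mem_bot] at hy
    exact ⟨0, by rw [hy, smul_zero, map_zero], fun v hv => absurd rfl hv⟩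
  · obtain ⟨c, u, hu, rfl⟩ := IsRightSubpath.exists_length_eq p (not_lt.1 hi)
    rw [← h.span_eq_radPow hI hu] at hy
    obtain ⟨r, rfl⟩ := Submodule.mem_span_singleton.1 hy
    obtain ⟨j, hj, hjr⟩ := smul_eq_vertexChar_smul_add hI (nil_smul_pathIn_smul u x) r
    obtain ⟨k, hk, hk'⟩ := exists_comb h hI (u.length + 1)
      (smul_mem_radPow_succ hj (smul_mem hI u x)) d
    rw [hjr, smul_add, hk]
    rcases eq_or_ne c d with rfl | hcd
    · refine ⟨Finsupp.single hu.subtypeMk (vertexChar hI c r) + k, ?_, fun v hv => ?_⟩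
      · rw [map_add, comb_single, hu.subtypeMk_val, ← algebraMap_smul (PathAlgebra K V ⧸ I) (vertexChar hI c r),
          smul_smul, ← Algebra.commutes, mul_smul, nil_smul_pathIn_smul]
      · by_cases hkv : k v = 0
        · rw [Finsupp.add_apply, hkv, add_zero] at hv
          have := (Finsupp.single_apply_ne_zero.1 hv).1
          rw [this, hu.subtypeMk_val]
        · have := hk' v hkv
          omega
    · refine ⟨k, ?_, fun v hv => by have := hk' v hv; omega⟩
      rw [← algebraMap_smul (PathAlgebra K V ⧸ I) (vertexChar hI c r), smul_smul,
        ← Algebra.commutes, mul_smul,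
        pathIn_smul_of_ne _ hcd (nil_smul_pathIn_smul u x), smul_zero, zero_add]
termination_by p.length + 1 - i

/-- Every combination of right subpaths has a leading term. -/
theorem comb_leading (hI : IsAdmissible I) {d : V} {k : RightSubpathTo p d →₀ K} (hk : k ≠ 0) :
    ∃ v, k v ≠ 0 ∧ (∀ v', k v' ≠ 0 → v.1.length ≤ v'.1.length) ∧
      comb I p x d k - k v • pathIn I v.1 • x ∈
        radPow (PathAlgebra K V ⧸ I) U (v.1.length + 1) := by
  classical
  obtain ⟨v, hv, hmin⟩ := k.support.exists_min_image (fun v => v.1.length)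
    (Finsupp.support_nonempty_iff.2 hk)
  refine ⟨v, Finsupp.mem_support_iff.1 hv,
    fun v' hv' => hmin v' (Finsupp.mem_support_iff.2 hv'), ?_⟩
  rw [comb, Finsupp.linearCombination_apply, Finsupp.sum, ← Finset.add_sum_erase _ _ hv,
    add_sub_cancel_left]
  refine Submodule.sum_mem _ fun w hw => ?_
  obtain ⟨hwv, hw⟩ := Finset.mem_erase.1 hw
  rw [← algebraMap_smul (PathAlgebra K V ⧸ I)]
  refine Submodule.smul_mem _ _ (radPow_antitone (?_ : v.1.length + 1 ≤ w.1.length)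
    (smul_mem hI w.1 x))
  refine lt_of_le_of_ne (hmin w hw) fun he => hwv (Subtype.ext ?_)
  exact (eq_of_heq (Sigma.mk.inj (IsRightSubpath.eq_of_length_eq v.2 w.2 he)).2).symm

/-- The vx with v a right subpath lie in distinct layers, so the shortest term of a nontrivial
combination cannot cancel. -/
theorem comb_injective (h : IsMastTop I p x) (hI : IsAdmissible I) (d : V) :
    Function.Injective (comb I p x d) := by
  rw [injective_iff_map_eq_zero]
  intro k hk
  by_contra hne
  obtain ⟨v, hv, -, hlead⟩ := comb_leading (x := x) hI hne
  rw [hk, zero_sub, Submodule.neg_mem_iff] at hlead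
  apply h.smul_notMem hI v.2
  rw [← inv_smul_smul₀ hv (pathIn I v.1 • x), ← algebraMap_smul (PathAlgebra K V ⧸ I)]
  exact Submodule.smul_mem _ _ hlead

/-- A nonzero element which is fixed by a vertex has a leading term. -/
theorem exists_leading (h : IsMastTop I p x) (hI : IsAdmissible I) {i : ℕ} {d : V} {y : U}
    (hy : y ∈ radPow (PathAlgebra K V ⧸ I) U i) (hy0 : y ≠ 0)
    (hd : pathIn I (Path.nil : Path d d) • y = y) :
    ∃ (v : Path a d) (c : K), IsRightSubpath v p ∧ i ≤ v.length ∧ c ≠ 0 ∧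
      y - c • pathIn I v • x ∈ radPow (PathAlgebra K V ⧸ I) U (v.length + 1) := by
  obtain ⟨k, hk, hki⟩ := h.exists_comb hI i hy d
  rw [hd] at hk
  have hk0 : k ≠ 0 := by
    rintro rfl
    exact hy0 (by rw [hk, map_zero])
  obtain ⟨v, hv, -, hlead⟩ := comb_leading (x := x) hI hk0
  exact ⟨v.1, k v, v.2, hki v hv, hv, by rwa [hk]⟩

end Expansion

/-- The segments of a mast are masts. -/
theorem subquotient (h : IsMastTop I p x) (hI : IsAdmissible I) {c d : V} {u : Path a c}
    {w : Path c d} (hw : IsRightSubpath (u.comp w) p) :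
    ∃ (N : Submodule (PathAlgebra K V ⧸ I) U) (N' : Submodule (PathAlgebra K V ⧸ I) N)
      (y : N ⧸ N'), IsMastTop I w y := by
  have hu : IsRightSubpath u p := (IsRightSubpath.comp_right u w).trans hw
  set Λ := PathAlgebra K V ⧸ I
  -- The segment w is realized on J^|u| U / J^(|wu|+1) U, with the class of ux as top element.
  set N : Submodule Λ U := radPow Λ U u.length
  set N' : Submodule Λ N := (radPow Λ U ((u.comp w).length + 1)).comap N.subtype
  refine ⟨N, N', N'.mkQ ⟨pathIn I u • x, smul_mem hI u x⟩, ?_, ?_, ?_, ?_⟩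
  · intro M M'
    have hinj : Function.Injective fun M : Submodule Λ (N ⧸ N') =>
        (M.comap N'.mkQ).map N.subtype :=
      (Submodule.map_injective_of_injective N.subtype_injective).comp
        (Submodule.comap_injective_of_surjective N'.mkQ_surjective)
    have key : ∀ M M' : Submodule Λ (N ⧸ N'),
        (M.comap N'.mkQ).map N.subtype ≤ (M'.comap N'.mkQ).map N.subtype → M ≤ M' := by
      intro M M' hle
      rwa [Submodule.map_le_map_iff_of_injective N.subtype_injective,
        Submodule.comap_le_comap_iff_of_surjective N'.mkQ_surjective] at hle
    exact (h.total _ _).imp (key M M') (key M' M)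
  · rw [← map_smul]
    congr 1
    exact Subtype.ext (nil_smul_pathIn_smul u x)
  · rw [eq_bot_iff]
    refine (radPow_le_map_of_surjective N'.mkQ N'.mkQ_surjective _).trans ?_
    rw [Submodule.map_le_iff_le_comap]
    intro y hy
    rw [Submodule.mem_comap, Submodule.mem_bot, Submodule.mkQ_apply,
      Submodule.Quotient.mk_eq_zero, Submodule.mem_comap]
    have := radPow_map_le_add N.subtype u.length (fun y => y.2) _ (Submodule.mem_map_of_mem hy)
    rwa [← add_assoc, ← Path.length_comp] at this
  · rw [← map_smul]
    intro h0
    rw [Submodule.mkQ_apply, Submodule.Quotient.mk_eq_zero, Submodule.mem_comap] at h0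
    apply h.smul_notMem hI hw
    rw [pathIn_comp_smul]
    exact h0

end IsMastTop

/-- A criterion for a module to be uniserial with a given mast. -/
theorem isMastTop_of_span (hI : IsAdmissible I) {U : Type*} [AddCommGroup U]
    [Module (PathAlgebra K V ⧸ I) U] {a b : V} {p : Path a b} {x : U}
    (idem : pathIn I (Path.nil : Path a a) • x = x)
    (gen : Submodule.span (PathAlgebra K V ⧸ I) {x} = ⊤) (ne_zero : pathIn I p • x ≠ 0)
    (arrows : ∀ (c d : V) (u : Path a c) (α : c ⟶ d), IsRightSubpath u p →
      pathIn I α.toPath • pathIn I u • x ∈ Submodule.span (PathAlgebra K V ⧸ I)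
        {y | ∃ (e : V) (v : Path a e), IsRightSubpath v p ∧ u.length < v.length ∧
          y = pathIn I v • x}) : IsMastTop I p x := by
  -- Each arrow pushes ux into the span of strictly longer right subpaths. This bounds the layers
  -- from above, and the shortest right subpath available in a layer generates it.
  have hspan : ∀ i, radPow (PathAlgebra K V ⧸ I) U i ≤ Submodule.span (PathAlgebra K V ⧸ I)
      {y | ∃ (e : V) (v : Path a e), IsRightSubpath v p ∧ i ≤ v.length ∧
          y = pathIn I v • x} := by
    intro i
    induction i with
    | zero =>
      change ⊤ ≤ _
      rw [← gen, Submodule.span_singleton_le_iff_mem]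
      exact Submodule.subset_span ⟨a, Path.nil, IsRightSubpath.nil p, Nat.zero_le _, idem.symm⟩
    | succ i ih =>
      refine radPow_succ_le_iff.2 fun r hr y hy => ?_
      replace hy := ih hy
      induction hy using Submodule.span_induction generalizing r with
      | mem y hy =>
        obtain ⟨c, u, hu, hiu, rfl⟩ := hy
        refine jacobson_smul_mem_of_arrows hI (fun d e α => ?_) hr
        rcases eq_or_ne c d with rfl | hcd
        · refine Submodule.span_mono ?_ (arrows c e u α hu)
          rintro _ ⟨e', v, hv, huv, rfl⟩
          exact ⟨e', v, hv, by omega, rfl⟩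
        · rw [pathIn_smul_of_ne _ hcd (nil_smul_pathIn_smul u x)]
          exact Submodule.zero_mem _
      | zero => rw [smul_zero]; exact Submodule.zero_mem _
      | add y y' _ _ h h' => rw [smul_add]; exact Submodule.add_mem _ (h r hr) (h' r hr)
      | smul s y _ h =>
        rw [smul_smul]
        exact h _ ((mem_jacobson_iff hI).2 fun v => by
          rw [map_mul, (mem_jacobson_iff hI).1 hr v, zero_mul])
  have hbot : radPow (PathAlgebra K V ⧸ I) U (p.length + 1) = ⊥ := by
    rw [eq_bot_iff]
    refine (hspan _).trans (Submodule.span_le.2 ?_)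
    rintro _ ⟨e, v, hv, hlt, rfl⟩
    have := hv.length_le
    omega
  refine ⟨total_of_generators hI fun i hi => ?_, idem, hbot, ne_zero⟩
  have hip : i ≤ p.length := by
    by_contra hlt
    apply hi
    rw [eq_bot_iff, ← hbot]
    exact radPow_antitone (by omega)
  obtain ⟨c, u, hu, rfl⟩ := IsRightSubpath.exists_length_eq p hip
  refine ⟨c, _, nil_smul_pathIn_smul u x, le_antisymm ((hspan _).trans (Submodule.span_le.2 ?_))
    ((Submodule.span_singleton_le_iff_mem _ _).2 (IsMastTop.smul_mem hI u x))⟩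
  rintro _ ⟨e, v, hv, huv, rfl⟩
  obtain ⟨w, rfl⟩ := hu.of_length_le hv huv
  rw [pathIn_comp_smul]
  exact Submodule.smul_mem _ _ (Submodule.mem_span_singleton_self _)

end PathAlgebra

/-! ### Passage between `IsMastTop` and the official notions of mast and top element. -/

namespace PathAlgebra

variable {K : Type uK} {V : Type uV} [Field K] [Quiver.{uE} V] [Fintype V]
variable {I : Ideal (PathAlgebra K V)} [I.IsTwoSided]

namespace IsMastTop

section

variable {U : Type*} [AddCommGroup U] [Module (PathAlgebra K V ⧸ I) U]
variable {a b : V} {p : Path a b} {x : U}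

theorem isUniserial (h : IsMastTop I p x) (hI : IsAdmissible I) :
    IsUniserial (PathAlgebra K V ⧸ I) U :=
  ⟨⟨_, 0, h.ne_zero⟩, ⟨⟨{x}, by rw [Finset.coe_singleton]; exact h.span_eq_top hI⟩⟩, h.total⟩

theorem length_eq (h : IsMastTop I p x) (hI : IsAdmissible I) :
    Module.length (PathAlgebra K V ⧸ I) U = p.length + 1 := by
  refine le_antisymm ?_ (le_length_of_radPow_ne_bot hI fun h0 => ?_)
  · exact_mod_cast length_le_of_radPow_eq_bot hI h.total h.radPow_eq_bot
  · have := smul_mem hI p x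
    rw [h0] at this
    exact h.ne_zero this

theorem map_equiv {U' : Type*} [AddCommGroup U'] [Module (PathAlgebra K V ⧸ I) U']
    (h : IsMastTop I p x) (φ : U ≃ₗ[PathAlgebra K V ⧸ I] U') : IsMastTop I p (φ x) where
  total N N' := by
    have := h.total (N.comap φ.toLinearMap) (N'.comap φ.toLinearMap)
    rwa [Submodule.comap_le_comap_iff_of_surjective φ.surjective,
      Submodule.comap_le_comap_iff_of_surjective φ.surjective] at this
  idem := by rw [← map_smul, h.idem]
  radPow_eq_bot := by
    rw [eq_bot_iff]
    refine (radPow_le_map_of_surjective φ.toLinearMap φ.surjective _).trans ?_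
    rw [h.radPow_eq_bot, Submodule.map_bot]
  ne_zero := by
    rw [← map_smul]
    exact fun h0 => h.ne_zero (φ.map_eq_zero_iff.1 h0)

/-- A top element generates a module whose masts start at its vertex. -/
theorem exists_of_top (hI : IsAdmissible I)
    (total : ∀ N N' : Submodule (PathAlgebra K V ⧸ I) U, N ≤ N' ∨ N' ≤ N) {a : V} {x : U}
    (idem : pathIn I (Path.nil : Path a a) • x = x)
    (hx : x ∉ radPow (PathAlgebra K V ⧸ I) U 1) :
    ∃ (b : V) (p : Path a b), IsMastTop I p x := by
  classical
  have key : ∀ i, radPow (PathAlgebra K V ⧸ I) U i ≠ ⊥ → ∃ (c : V) (u : Path a c),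
      u.length = i ∧ pathIn I u • x ∉ radPow (PathAlgebra K V ⧸ I) U (i + 1) := by
    intro i
    induction i with
    | zero => exact fun _ => ⟨a, Path.nil, rfl, by rwa [idem]⟩
    | succ i ih =>
      intro hi
      obtain ⟨c, u, rfl, hu⟩ := ih fun h0 => hi (by
        rw [eq_bot_iff, ← h0]; exact radPow_antitone (Nat.le_succ _))
      -- If every path of the next length sent x one layer deeper than expected, then in particular
      -- all arrows applied to ux would, and two successive nonzero layers would coincide.
      by_contra! hcon
      refine radPow_succ_ne hI hi (le_antisymm (radPow_antitone (Nat.le_succ _)) ?_)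
      refine radPow_succ_le_iff.2 fun r hr y hy => ?_
      rw [← span_singleton_eq_radPow hI total (nil_smul_pathIn_smul u x) (smul_mem hI u x) hu]
        at hy
      obtain ⟨s, rfl⟩ := Submodule.mem_span_singleton.1 hy
      rw [smul_smul]
      refine jacobson_smul_mem_of_arrows hI (fun d e α => ?_) ((mem_jacobson_iff hI).2 fun v => by
          rw [map_mul, (mem_jacobson_iff hI).1 hr v, zero_mul])
      rcases eq_or_ne c d with rfl | hcd
      · rw [← pathIn_cons_smul]
        exact hcon e (u.cons α) rfl
      · rw [pathIn_smul_of_ne _ hcd (nil_smul_pathIn_smul u x)]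
        exact Submodule.zero_mem _
  obtain ⟨N, hN⟩ := exists_radPow_eq_bot hI
  have hex : ∃ i, radPow (PathAlgebra K V ⧸ I) U i = ⊥ := ⟨N, hN U⟩
  obtain ⟨l, hl⟩ : ∃ l, Nat.find hex = l + 1 := by
    refine Nat.exists_eq_succ_of_ne_zero fun h0 => hx ?_
    have := Nat.find_spec hex
    rw [h0] at this
    have hx0 : x ∈ radPow (PathAlgebra K V ⧸ I) U 0 := trivial
    rw [this] at hx0
    rw [(Submodule.mem_bot _).1 hx0]
    exact Submodule.zero_mem _
  have hbot := Nat.find_spec hex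
  rw [hl] at hbot
  obtain ⟨b, p, rfl, hp⟩ := key l (Nat.find_min hex (by omega))
  exact ⟨b, p, total, idem, hbot, fun h0 => hp (h0 ▸ Submodule.zero_mem _)⟩

end

section

variable {U : Type max uK uV uE} [AddCommGroup U] [Module (PathAlgebra K V ⧸ I) U]
variable {a b : V} {p : Path a b} {x : U}

/-- A module with a mast and a top element as a uniserial module. -/
def toUniserialModule (h : IsMastTop I p x) (hI : IsAdmissible I) : UniserialModule I where
  carrier := U
  isUniserial := h.isUniserial hI

theorem isMast (h : IsMastTop I p x) (hI : IsAdmissible I) : IsMast I p :=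
  ⟨h.toUniserialModule hI, h.length_eq hI, x, h.ne_zero⟩

/-- The segments of a mast are masts. -/
theorem isMast_segment (h : IsMastTop I p x) (hI : IsAdmissible I) {c d : V} {u : Path a c}
    {w : Path c d} (hw : IsRightSubpath (u.comp w) p) : IsMast I w := by
  obtain ⟨N, N', y, hy⟩ := h.subquotient hI hw
  exact hy.isMast hI

end

end IsMastTop

/-- The definition of a mast only gives some y with py ≠ 0. But x generates U and p kills JU, so py
is a scalar multiple of px; in particular p starts at the vertex of x. -/
theorem isMastTop_of_hasMast (hI : IsAdmissible I) {U : UniserialModule I} {a b : V}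
    {p : Path a b} (hp : U.HasMast p) {x : U.carrier} (hx : U.IsTop x) : IsMastTop I p x := by
  obtain ⟨hx1, e, he⟩ := hx
  have hbot : radPow (PathAlgebra K V ⧸ I) U.carrier (p.length + 1) = ⊥ := by
    by_contra h
    have := le_length_of_radPow_ne_bot hI h
    rw [hp.1] at this
    norm_cast at this
    omega
  obtain ⟨y, hy⟩ := hp.2
  have htop := span_singleton_eq_radPow (i := 0) hI U.isUniserial.2.2 he trivial hx1
  have hyx : y ∈ Submodule.span (PathAlgebra K V ⧸ I) {x} := by rw [htop]; trivial
  obtain ⟨r, rfl⟩ := Submodule.mem_span_singleton.1 hyx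
  let _ : Module K U.carrier := Module.compHom U.carrier (algebraMap K (PathAlgebra K V ⧸ I))
  have _ : IsScalarTower K (PathAlgebra K V ⧸ I) U.carrier :=
    IsScalarTower.of_algebraMap_smul fun _ _ => rfl
  obtain ⟨j, hj, hjr⟩ := smul_eq_vertexChar_smul_add hI he r
  have hpx : pathIn I p • x ≠ 0 := by
    intro h0
    apply hy
    rw [hjr, smul_add, ← algebraMap_smul (PathAlgebra K V ⧸ I), smul_smul, ← Algebra.commutes,
      mul_smul, h0, smul_zero, zero_add, ← Submodule.mem_bot (PathAlgebra K V ⧸ I), ← hbot,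
      add_comm]
    exact pathIn_smul_mem_radPow hI p (smul_mem_radPow_succ (i := 0) hj trivial)
  rcases eq_or_ne e a with rfl | hea
  · exact ⟨U.isUniserial.2.2, he, hbot, hpx⟩
  · exact absurd (pathIn_smul_of_ne p hea he) hpx

theorem exists_isMastTop_of_isTop (hI : IsAdmissible I) {U : UniserialModule I} {x : U.carrier}
    (hx : U.IsTop x) : ∃ (a b : V) (p : Path a b), IsMastTop I p x := by
  obtain ⟨hx1, a, ha⟩ := hx
  obtain ⟨b, p, hp⟩ := IsMastTop.exists_of_top hI U.isUniserial.2.2 ha hx1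
  exact ⟨a, b, p, hp⟩

theorem exists_isTop (hI : IsAdmissible I) (U : UniserialModule I) :
    ∃ x : U.carrier, U.IsTop x := by
  have := U.isUniserial.1
  have hne : radPow (PathAlgebra K V ⧸ I) U.carrier 0 ≠ ⊥ := top_ne_bot
  have h1 : ¬ radPow (PathAlgebra K V ⧸ I) U.carrier 0 ≤ radPow (PathAlgebra K V ⧸ I) U.carrier 1 :=
    fun h => radPow_succ_ne hI hne (le_antisymm (radPow_antitone (Nat.le_succ _)) h)
  obtain ⟨y, -, hy⟩ := SetLike.not_le_iff_exists.1 h1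
  obtain ⟨e, he⟩ := exists_nil_smul_notMem hy
  exact ⟨_, he, e, nil_smul_pathIn_smul _ _⟩

theorem exists_isMastTop_of_isMast (hI : IsAdmissible I) {a b : V} {p : Path a b}
    (hp : IsMast I p) : ∃ (U : UniserialModule I) (x : U.carrier), IsMastTop I p x := by
  obtain ⟨U, hU⟩ := hp
  obtain ⟨x, hx⟩ := exists_isTop hI U
  exact ⟨U, x, isMastTop_of_hasMast hI hU hx⟩

/-! ### Changing the action of one arrow by a map from the top to the socle. -/

section Deformation

variable {U : Type*} [AddCommGroup U] [Module (PathAlgebra K V ⧸ I) U]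

/-- The additive group `U` with the action of `KΓ / I` given by a ring homomorphism. -/
def TwistedModule (_ρ : (PathAlgebra K V ⧸ I) →+* AddMonoid.End U) : Type _ := U

instance (ρ : (PathAlgebra K V ⧸ I) →+* AddMonoid.End U) : AddCommGroup (TwistedModule ρ) :=
  inferInstanceAs (AddCommGroup U)

noncomputable instance (ρ : (PathAlgebra K V ⧸ I) →+* AddMonoid.End U) :
    Module (PathAlgebra K V ⧸ I) (TwistedModule ρ) :=
  Module.compHom U ρ

/-- The identity map from `U` to the twisted module. -/
def toTwisted (ρ : (PathAlgebra K V ⧸ I) →+* AddMonoid.End U) : U ≃+ TwistedModule ρ :=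
  AddEquiv.refl U

omit [Module (PathAlgebra K V ⧸ I) U] in
theorem smul_toTwisted (ρ : (PathAlgebra K V ⧸ I) →+* AddMonoid.End U) (r : PathAlgebra K V ⧸ I)
    (y : U) : r • toTwisted ρ y = toTwisted ρ (ρ r y) := rfl

variable [Module K U] [IsScalarTower K (PathAlgebra K V ⧸ I) U]

/-- The action of `KΓ / I` in which the arrow `α` has been changed by the operator
`y ↦ t (lam y) s`. -/
noncomputable def deformHom (hI : IsAdmissible I) {a b : V} (α : a ⟶ b) (t : K) (lam : U →ₗ[K] K)
    (s : U) (h₁ : ∀ (r : PathAlgebra K V ⧸ I) y, lam (r • y) = vertexChar hI a r * lam y)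
    (h₂ : ∀ r : PathAlgebra K V ⧸ I, r • s = vertexChar hI b r • s) (h₃ : lam s = 0) :
    (PathAlgebra K V ⧸ I) →+* AddMonoid.End U where
  toFun r :=
    { toFun := fun y => r • y + (t * arrowCoeff α r * lam y) • s
      map_zero' := by simp
      map_add' := fun y z => by
        rw [smul_add, map_add, mul_add, add_smul]
        abel }
  map_one' := by
    ext y
    show (1 : PathAlgebra K V ⧸ I) • y + _ = y
    rw [arrowCoeff_one hI, mul_zero, zero_mul, zero_smul, add_zero, one_smul]
  map_zero' := by
    ext y
    show (0 : PathAlgebra K V ⧸ I) • y + _ = 0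
    rw [← zero_smul K (0 : PathAlgebra K V ⧸ I), arrowCoeff_smul hI]
    simp
  map_add' r r' := by
    ext y
    show (r + r') • y + _ = (r • y + _) + (r' • y + _)
    rw [arrowCoeff_add hI, add_smul, mul_add, add_mul, add_smul]
    abel
  -- The product of the two corrections vanishes because lam kills s; the linear terms match by the
  -- derivation rule `arrowCoeff_mul`.
  map_mul' r r' := by
    ext y
    show (r * r') • y + _ = r • (r' • y + _) + (t * arrowCoeff α r * lam (r' • y + _)) • s
    rw [map_add, map_smul lam (_ : K), h₃, h₁, smul_zero, add_zero, smul_add, arrowCoeff_mul hI,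
      smul_comm r (_ : K), h₂, smul_smul, smul_smul, add_assoc, ← add_smul]
    congr 2
    ring

end Deformation

/-- An additive map which commutes with the scalars and with the right subpaths of a mast, as far
as their action on `x` is concerned, preserves radical layers. -/
theorem IsMastTop.map_mem_span {U U' : Type*} [AddCommGroup U] [Module (PathAlgebra K V ⧸ I) U]
    [AddCommGroup U'] [Module (PathAlgebra K V ⧸ I) U'] {a b : V} {p : Path a b} {x : U}
    (h : IsMastTop I p x) (hI : IsAdmissible I) (f : U →+ U')
    (hK : ∀ (c : K) (y : U), f (algebraMap K (PathAlgebra K V ⧸ I) c • y) =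
      algebraMap K (PathAlgebra K V ⧸ I) c • f y)
    (hf : ∀ (c : V) (v : Path a c), IsRightSubpath v p → f (pathIn I v • x) = pathIn I v • f x)
    {i : ℕ} {y : U} (hy : y ∈ radPow (PathAlgebra K V ⧸ I) U i) :
    f y ∈ Submodule.span (PathAlgebra K V ⧸ I)
      {z | ∃ (e : V) (v : Path a e), IsRightSubpath v p ∧ i ≤ v.length ∧
        z = pathIn I v • f x} := by
  let _ : Module K U := Module.compHom U (algebraMap K (PathAlgebra K V ⧸ I))
  have _ : IsScalarTower K (PathAlgebra K V ⧸ I) U :=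
    IsScalarTower.of_algebraMap_smul fun _ _ => rfl
  rw [← sum_nil_smul (I := I) y, map_sum]
  refine Submodule.sum_mem _ fun d _ => ?_
  obtain ⟨k, hk, hki⟩ := h.exists_comb hI i hy d
  rw [hk, comb, Finsupp.linearCombination_apply, Finsupp.sum, map_sum]
  refine Submodule.sum_mem _ fun v hv => ?_
  rw [← algebraMap_smul (PathAlgebra K V ⧸ I), hK, hf _ _ v.2]
  exact Submodule.smul_mem _ _ (Submodule.subset_span
    ⟨d, v.1, v.2, hki v (Finsupp.mem_support_iff.1 hv), rfl⟩)

theorem IsMastTop.map_mem_radPow {U U' : Type*} [AddCommGroup U]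
    [Module (PathAlgebra K V ⧸ I) U]
    [AddCommGroup U'] [Module (PathAlgebra K V ⧸ I) U'] {a b : V} {p : Path a b} {x : U}
    (h : IsMastTop I p x) (hI : IsAdmissible I) (f : U →+ U')
    (hK : ∀ (c : K) (y : U), f (algebraMap K (PathAlgebra K V ⧸ I) c • y) =
      algebraMap K (PathAlgebra K V ⧸ I) c • f y)
    (hf : ∀ (c : V) (v : Path a c), IsRightSubpath v p → f (pathIn I v • x) = pathIn I v • f x)
    {i : ℕ} {y : U} (hy : y ∈ radPow (PathAlgebra K V ⧸ I) U i) :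
    f y ∈ radPow (PathAlgebra K V ⧸ I) U' i := by
  refine (Submodule.span_le.2 ?_) (h.map_mem_span hI f hK hf hy)
  rintro _ ⟨e, v, -, hiv, rfl⟩
  exact radPow_antitone hiv (smul_mem hI v _)

/-- Let `p` be a mast of positive length which is parallel to an arrow `α` and does not start
with `α`. Then the action of `α` on a top element `x` can be changed by any multiple of `p x`. -/
theorem IsMastTop.exists_deformation {U : Type w} [AddCommGroup U] [Module (PathAlgebra K V ⧸ I) U]
    {a b : V} {p : Path a b} {x : U} (h : IsMastTop I p x) (hI : IsAdmissible I)
    (hpos : 0 < p.length) (α : a ⟶ b) (hα : ¬ IsRightSubpath α.toPath p) (t : K) :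
    ∃ (U' : Type w) (_ : AddCommGroup U') (_ : Module (PathAlgebra K V ⧸ I) U') (f : U ≃+ U'),
      IsMastTop I p (f x) ∧
      (∀ (c : K) (y : U), f (algebraMap K (PathAlgebra K V ⧸ I) c • y) =
        algebraMap K (PathAlgebra K V ⧸ I) c • f y) ∧
      pathIn I α.toPath • f x =
        f (pathIn I α.toPath • x + algebraMap K (PathAlgebra K V ⧸ I) t • pathIn I p • x) ∧
      (∀ (c d : V) (q : Path c d) (y : U),
        (⟨a, b, α.toPath⟩ : Σ a b : V, Path a b) ≠ ⟨c, d, q⟩ →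
        pathIn I q • f y = f (pathIn I q • y)) ∧
      ∀ (i : ℕ) (y : U), f y ∈ radPow (PathAlgebra K V ⧸ I) U' i ↔
        y ∈ radPow (PathAlgebra K V ⧸ I) U i := by
  let _ : Module K U := Module.compHom U (algebraMap K (PathAlgebra K V ⧸ I))
  have _ : IsScalarTower K (PathAlgebra K V ⧸ I) U :=
    IsScalarTower.of_algebraMap_smul fun _ _ => rfl
  -- A functional vanishing on JU, rescaled to take the value 1 at x, transforms under Λ by the
  -- character of the vertex a; and px, lying in the last layer, transforms by that of b.
  obtain ⟨lam₀, hx₀, hJ₀⟩ := Submodule.exists_dual_map_eq_bot_of_notMem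
    (p := (radPow (PathAlgebra K V ⧸ I) U 1).restrictScalars K) (h.notMem_radPow_one hI)
    inferInstance
  set lam : U →ₗ[K] K := (lam₀ x)⁻¹ • lam₀ with hlam
  have hx : lam x = 1 := by simp [hlam, hx₀]
  have hJ : ∀ y ∈ radPow (PathAlgebra K V ⧸ I) U 1, lam y = 0 := by
    intro y hy
    have : lam₀ y ∈ ((radPow (PathAlgebra K V ⧸ I) U 1).restrictScalars K).map lam₀ :=
      Submodule.mem_map_of_mem hy
    rw [hJ₀, Submodule.mem_bot] at this
    simp [hlam, this]
  have hrx : ∀ r : PathAlgebra K V ⧸ I, lam (r • x) = vertexChar hI a r := by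
    intro r
    obtain ⟨j, hj, hjr⟩ := smul_eq_vertexChar_smul_add hI h.idem r
    rw [hjr, map_add, hJ _ (smul_mem_radPow_succ (i := 0) hj trivial), map_smul, hx, add_zero,
      smul_eq_mul, mul_one]
  have h₁ : ∀ (r : PathAlgebra K V ⧸ I) y, lam (r • y) = vertexChar hI a r * lam y := by
    intro r y
    have hy : y ∈ Submodule.span (PathAlgebra K V ⧸ I) {x} := by
      rw [h.span_eq_top hI]; trivial
    obtain ⟨s, rfl⟩ := Submodule.mem_span_singleton.1 hy
    rw [smul_smul, hrx, hrx, map_mul]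
  have h₂ : ∀ r : PathAlgebra K V ⧸ I, r • pathIn I p • x =
      vertexChar hI b r • pathIn I p • x := by
    intro r
    obtain ⟨j, hj, hjr⟩ := smul_eq_vertexChar_smul_add hI (nil_smul_pathIn_smul p x) r
    have := smul_mem_radPow_succ hj (smul_mem hI p x)
    rw [h.radPow_eq_bot, Submodule.mem_bot] at this
    rw [hjr, this, add_zero]
  have hlen : ∀ {c d : V} (u : Path c d), 0 < u.length → lam (pathIn I u • x) = 0 :=
    fun u hu => hJ _ (radPow_antitone hu (smul_mem hI u x))
  have h₃ : lam (pathIn I p • x) = 0 := hlen p hpos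
  set ρ := deformHom hI α t lam _ h₁ h₂ h₃ with hρ
  have hρr : ∀ r y, ρ r y = r • y + (t * arrowCoeff α r * lam y) • pathIn I p • x :=
    fun _ _ => rfl
  set f := toTwisted ρ
  have hα1 : arrowCoeff α (pathIn I α.toPath) = (1 : K) := by
    rw [arrowCoeff_mk hI, coeff_ofPath_self]
  have hK : ∀ (c : K) (y : U), f (algebraMap K (PathAlgebra K V ⧸ I) c • y) =
        algebraMap K (PathAlgebra K V ⧸ I) c • f y := by
    intro c y
    rw [smul_toTwisted, hρr, Algebra.algebraMap_eq_smul_one, arrowCoeff_smul hI,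
      arrowCoeff_one hI, mul_zero, mul_zero, zero_mul, zero_smul, add_zero]
  -- Even longer paths through α keep their action: only the coefficient of α itself enters the
  -- correction.
  have hq : ∀ (c d : V) (q : Path c d) (y : U),
        (⟨a, b, α.toPath⟩ : Σ a b : V, Path a b) ≠ ⟨c, d, q⟩ →
        pathIn I q • f y = f (pathIn I q • y) := by
    intro c d q y hne
    rw [smul_toTwisted, hρr, arrowCoeff_mk hI, coeff_ofPath_of_ne _ _ hne, mul_zero, zero_mul,
      zero_smul, add_zero]
  have hαy : ∀ y, pathIn I α.toPath • f y =
      f (pathIn I α.toPath • y + (t * lam y) • pathIn I p • x) := by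
    intro y
    rw [smul_toTwisted, hρr, hα1, mul_one]
  have hsub : ∀ {c : V} {v : Path a c}, IsRightSubpath v p →
      pathIn I v • f x = f (pathIn I v • x) := by
    intro c v hv
    refine hq _ _ v x fun he => hα ?_
    cases he
    exact hv
  have hf : ∀ (c : V) (v : Path a c), IsRightSubpath v p →
      f.toAddMonoidHom (pathIn I v • x) = pathIn I v • f.toAddMonoidHom x :=
    fun c v hv => (hsub hv).symm
  have hx' : f.symm (f x) = x := f.symm_apply_apply x
  have hM : IsMastTop I p (f x) := by
    refine isMastTop_of_span hI ?_ ?_ ?_ ?_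
    · rw [hsub (IsRightSubpath.nil p), h.idem]
    · rw [eq_top_iff]
      intro y _
      obtain ⟨y, rfl⟩ := f.surjective y
      refine (Submodule.span_le.2 ?_)
        (h.map_mem_span hI f.toAddMonoidHom hK hf (i := 0) (y := y) trivial)
      rintro _ ⟨e, v, -, -, rfl⟩
      exact Submodule.smul_mem _ _ (Submodule.mem_span_singleton_self _)
    · rw [hsub (IsRightSubpath.refl p)]
      exact fun h0 => h.ne_zero (f.map_eq_zero_iff.1 h0)
    · intro c d u β hu
      obtain ⟨y, hy, hyβ⟩ : ∃ y ∈ radPow (PathAlgebra K V ⧸ I) U (u.length + 1),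
          pathIn I β.toPath • pathIn I u • f x = f y := by
        rw [hsub hu]
        have hmem : pathIn I β.toPath • pathIn I u • x ∈
            radPow (PathAlgebra K V ⧸ I) U (u.length + 1) := by
          rw [← pathIn_cons_smul]
          exact smul_mem hI (u.cons β) x
        by_cases he : (⟨a, b, α.toPath⟩ : Σ a b : V, Path a b) = ⟨c, d, β.toPath⟩
        · cases he
          refine ⟨_, Submodule.add_mem _ hmem ?_, hαy _⟩
          -- At the top the correction is a multiple of px, which lies in JU as p has positive
          -- length; below the top lam vanishes.
          rcases Nat.eq_zero_or_pos u.length with h0 | h0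
          · rw [h0, ← algebraMap_smul (PathAlgebra K V ⧸ I)]
            exact Submodule.smul_mem _ _ (radPow_antitone hpos (smul_mem hI p x))
          · rw [hlen u h0, mul_zero, zero_smul]
            exact Submodule.zero_mem _
        · exact ⟨_, hmem, hq _ _ _ _ he⟩
      rw [hyβ]
      exact h.map_mem_span hI f.toAddMonoidHom hK hf hy
  refine ⟨TwistedModule ρ, inferInstance, inferInstance, f, hM, hK, ?_, hq, ?_⟩
  · rw [hαy, hx, mul_one, algebraMap_smul]
  · intro i y
    refine ⟨fun hy => ?_, fun hy => h.map_mem_radPow hI f.toAddMonoidHom hK hf hy⟩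
    -- The situation is symmetric: the inverse of f respects the same scalars and right subpaths.
    have := hM.map_mem_radPow (U' := U) hI f.symm.toAddMonoidHom (fun c y => ?_)
      (fun c v hv => ?_) hy
    · simpa using this
    · obtain ⟨y, rfl⟩ := f.surjective y
      rw [← hK]
      simp
    · rw [hsub hv]
      simp

/-- The deformation of `IsMastTop.exists_deformation` for uniserial modules. -/
theorem exists_uniserial_deformation (hI : IsAdmissible I) {U : UniserialModule I} {a b : V}
    {p : Path a b} {x : U.carrier} (h : IsMastTop I p x) (hpos : 0 < p.length) (α : a ⟶ b)
    (hα : ¬ IsRightSubpath α.toPath p) (t : K) :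
    ∃ (U' : UniserialModule I) (f : U.carrier ≃+ U'.carrier), IsMastTop I p (f x) ∧
      (∀ (c : K) (y : U.carrier), f (algebraMap K (PathAlgebra K V ⧸ I) c • y) =
        algebraMap K (PathAlgebra K V ⧸ I) c • f y) ∧
      pathIn I α.toPath • f x =
        f (pathIn I α.toPath • x + algebraMap K (PathAlgebra K V ⧸ I) t • pathIn I p • x) ∧
      (∀ (c d : V) (q : Path c d) (y : U.carrier),
        (⟨a, b, α.toPath⟩ : Σ a b : V, Path a b) ≠ ⟨c, d, q⟩ →
        pathIn I q • f y = f (pathIn I q • y)) ∧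
      ∀ (i : ℕ) (y : U.carrier), f y ∈ radPow (PathAlgebra K V ⧸ I) U'.carrier i ↔
        y ∈ radPow (PathAlgebra K V ⧸ I) U.carrier i := by
  obtain ⟨U', _, _, f, hM, hf⟩ := h.exists_deformation hI hpos α hα t
  exact ⟨hM.toUniserialModule hI, f, hM, hf⟩

end PathAlgebra

/-! ### Points of V_p and uniserial modules with mast p. -/

namespace PathAlgebra

section Evaluation

variable {K : Type uK} {V : Type uV} [Field K] [Quiver.{uE} V]
variable {a b : V} {p : Path a b}

/-- The substitution step with the variables replaced by the coordinates of the point `k`. -/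
noncomputable def evalStep (k : DetourVar p → K) {c d : V} (α : c ⟶ d) (u : RightSubpathTo p c) :
    RightSubpathTo p d →₀ K :=
  (substStep K p α u).mapRange (MvPolynomial.eval k) (map_zero _)

/-- The reduction of a path with the variables replaced by the coordinates of the point `k`. -/
noncomputable def evalPath (k : DetourVar p → K) {d : V} (q : Path a d) :
    RightSubpathTo p d →₀ K :=
  (substPath K p q).mapRange (MvPolynomial.eval k) (map_zero _)

theorem evalStep_of_right (k : DetourVar p → K) {c d : V} (α : c ⟶ d) (u : RightSubpathTo p c)
    (h : IsRightSubpath (u.1.cons α) p) : evalStep k α u = Finsupp.single h.subtypeMk 1 := by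
  have : substStep K p α u = Finsupp.single h.subtypeMk 1 := dif_pos h
  rw [evalStep, this, Finsupp.mapRange_single, map_one]

theorem evalStep_of_detour (k : DetourVar p → K) {c d : V} (α : c ⟶ d) (u : RightSubpathTo p c)
    (h : IsDetour p u.1 α) (v : RightSubpathTo p d) (hv : u.1.length < v.1.length) :
    evalStep k α u v = k ⟨c, d, u.1, α, h, v, hv⟩ := by
  classical
  have : substStep K p α u = ∑ᶠ v : {v : RightSubpathTo p d // u.1.length < v.1.length},
        Finsupp.single v.1 (MvPolynomial.X ⟨c, d, u.1, α, h, v.1, v.2⟩) :=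
    (dif_neg h.2.1).trans (dif_pos h)
  have := Fintype.ofFinite {v : RightSubpathTo p d // u.1.length < v.1.length}
  rw [evalStep, Finsupp.mapRange_apply, ‹substStep K p α u = _›, finsum_eq_sum_of_fintype,
    Finsupp.finsetSum_apply, Finset.sum_eq_single ⟨v, hv⟩]
  · rw [Finsupp.single_eq_same, MvPolynomial.eval_X]
  · intro w _ hw
    rw [Finsupp.single_eq_of_ne]
    rintro rfl
    exact hw rfl
  · simp

/-- Substitution only lengthens right subpaths. This triangularity is what makes the point modules
uniserial. -/
theorem evalStep_eq_zero (k : DetourVar p → K) {c d : V} (α : c ⟶ d) (u : RightSubpathTo p c)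
    (h : ¬ IsRightSubpath (u.1.cons α) p) (v : RightSubpathTo p d)
    (hv : v.1.length ≤ u.1.length) : evalStep k α u v = 0 := by
  classical
  by_cases hd : IsDetour p u.1 α
  · have : substStep K p α u = ∑ᶠ v : {v : RightSubpathTo p d // u.1.length < v.1.length},
          Finsupp.single v.1 (MvPolynomial.X ⟨c, d, u.1, α, hd, v.1, v.2⟩) :=
      (dif_neg h).trans (dif_pos hd)
    have := Fintype.ofFinite {v : RightSubpathTo p d // u.1.length < v.1.length}
    rw [evalStep, Finsupp.mapRange_apply, ‹substStep K p α u = _›, finsum_eq_sum_of_fintype,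
      Finsupp.finsetSum_apply, Finset.sum_eq_zero, map_zero]
    intro w _
    rw [Finsupp.single_eq_of_ne]
    rintro rfl
    exact absurd w.2 (by omega)
  · have : substStep K p α u = 0 := (dif_neg h).trans (dif_neg hd)
    rw [evalStep, this, Finsupp.mapRange_zero, Finsupp.zero_apply]

theorem evalPath_nil (k : DetourVar p → K) :
    evalPath k (Path.nil : Path a a) = Finsupp.single (IsRightSubpath.nil p).subtypeMk 1 := by
  have : substPath K p (Path.nil : Path a a) =
    Finsupp.single (IsRightSubpath.nil p).subtypeMk 1 := rfl
  rw [evalPath, this, Finsupp.mapRange_single, map_one]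

theorem evalPath_cons (k : DetourVar p → K) {c d : V} (q : Path a c) (α : c ⟶ d) :
    evalPath k (q.cons α) = Finsupp.linearCombination K (evalStep k α) (evalPath k q) := by
  have h : substPath K p (q.cons α) =
    (substPath K p q).sum fun u f => f • substStep K p α u := rfl
  ext v
  rw [Finsupp.linearCombination_apply, evalPath, h, evalPath, Finsupp.sum_mapRange_index
    (h := fun u r => r • evalStep k α u) (fun u => zero_smul K _), Finsupp.mapRange_apply, Finsupp.sum_apply, Finsupp.sum_apply,
    Finsupp.sum, Finsupp.sum, map_sum]
  refine Finset.sum_congr rfl fun u _ => ?_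
  rw [Finsupp.smul_apply, smul_eq_mul, map_mul, Finsupp.smul_apply, smul_eq_mul, evalStep,
    Finsupp.mapRange_apply]

theorem evalPath_of_right (k : DetourVar p → K) {c : V} {u : Path a c}
    (hu : IsRightSubpath u p) : evalPath k u = Finsupp.single hu.subtypeMk 1 := by
  induction u with
  | nil => exact evalPath_nil k
  | cons u α ih =>
    rw [evalPath_cons, ih hu.of_cons, Finsupp.linearCombination_single, one_smul]
    exact evalStep_of_right k α _ hu

variable [Fintype V]

/-- The part ending in `d` of the reduction of an element of the path algebra, at the point
`k`. -/
noncomputable def evalElt (k : DetourVar p → K) (d : V) :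
    PathAlgebra K V →ₗ[K] (RightSubpathTo p d →₀ K) :=
  Finsupp.linearCombination K (evalPath k) ∘ₗ block K a d

theorem evalElt_ofPath_of_ne_left (k : DetourVar p → K) (d : V) {c e : V} (q : Path c e)
    (h : a ≠ c) : evalElt k d (ofPath K q) = 0 := by
  rw [evalElt, LinearMap.comp_apply, block_apply, ofPath_ne_left _ _ h, map_zero]

theorem evalElt_ofPath_of_ne_right (k : DetourVar p → K) (d : V) {c e : V} (q : Path c e)
    (h : d ≠ e) : evalElt k d (ofPath K q) = 0 := by
  rw [evalElt, LinearMap.comp_apply, block_apply, ofPath_ne_right _ _ h, map_zero]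

theorem evalElt_ofPath (k : DetourVar p → K) {d : V} (q : Path a d) :
    evalElt k d (ofPath K q) = evalPath k q := by
  rw [evalElt, LinearMap.comp_apply, block_apply, ofPath_self, Finsupp.linearCombination_single,
    one_smul]

theorem eval_substPoly (k : DetourVar p → K) (z : PathAlgebra K V) {d : V}
    (v : RightSubpathTo p d) : MvPolynomial.eval k (substPoly p z v) = evalElt k d z v := by
  rw [evalElt, LinearMap.comp_apply, block_apply, Finsupp.linearCombination_apply,
    Finsupp.sum_apply, substPoly, Finsupp.sum, Finsupp.sum, map_sum]
  refine Finset.sum_congr rfl fun q _ => ?_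
  rw [map_mul, MvPolynomial.eval_C, Finsupp.smul_apply, smul_eq_mul, evalPath,
    Finsupp.mapRange_apply]

theorem mem_uniserialVariety_iff (I : Ideal (PathAlgebra K V)) (k : DetourVar p → K) :
    k ∈ uniserialVariety I p ↔ ∀ z ∈ I, ∀ d, evalElt k d z = 0 := by
  refine forall₂_congr fun z _ => forall_congr' fun d => ?_
  rw [Finsupp.ext_iff]
  exact forall_congr' fun v => by rw [eval_substPoly, Finsupp.zero_apply]

end Evaluation

variable {K : Type uK} {V : Type uV} [Field K] [Quiver.{uE} V] [Fintype V]
variable {I : Ideal (PathAlgebra K V)} [I.IsTwoSided]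

section Point

variable {U : Type*} [AddCommGroup U] [Module (PathAlgebra K V ⧸ I) U]
  [Module K U] [IsScalarTower K (PathAlgebra K V ⧸ I) U]
variable {a b : V} {p : Path a b} {x : U}

open IsMastTop in
/-- Each uniserial module with mast `p` and top element `x` gives a point of the variety `V_p`. -/
theorem IsMastTop.exists_point (h : IsMastTop I p x) (hI : IsAdmissible I) :
    ∃ k ∈ uniserialVariety I p, (∀ (c d : V) (α : c ⟶ d) (u : RightSubpathTo p c),
      comb I p x d (evalStep k α u) = pathIn I α.toPath • pathIn I u.1 • x) ∧
      ∀ (f : PathAlgebra K V) (d : V), comb I p x d (evalElt k d f) =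
        pathIn I (Path.nil : Path d d) • Ideal.Quotient.mk I f • x := by
  classical
  -- The coordinates of the point are the coefficients of αux in the basis of the vx; for a detour,
  -- no shorter v can occur because αux lies in the layer |u| + 1.
  have hex : ∀ (c d : V) (u : Path a c) (α : c ⟶ d), ∃ k : RightSubpathTo p d →₀ K,
      pathIn I α.toPath • pathIn I u • x = comb I p x d k ∧
        ∀ v, k v ≠ 0 → u.length + 1 ≤ v.1.length := by
    intro c d u α
    obtain ⟨k, hk⟩ := h.exists_comb hI (u.length + 1) (smul_mem hI (u.cons α) x) d
    rw [nil_smul_pathIn_smul, pathIn_cons_smul] at hk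
    exact ⟨k, hk⟩
  choose κ hκ hκ' using hex
  let k : DetourVar p → K := fun δ => κ δ.c δ.d δ.u δ.α δ.v
  have hstep : ∀ (c d : V) (α : c ⟶ d) (u : RightSubpathTo p c),
      comb I p x d (evalStep k α u) = pathIn I α.toPath • pathIn I u.1 • x := by
    intro c d α u
    by_cases hr : IsRightSubpath (u.1.cons α) p
    · rw [evalStep_of_right k α u hr, comb_single, hr.subtypeMk_val, one_smul, pathIn_cons_smul]
    · rw [hκ]
      congr 1
      ext v
      rcases Nat.lt_or_ge u.1.length v.1.length with hv | hv
      · rw [evalStep_of_detour k α u ⟨u.2, hr, v.1, v.2, hv⟩ v hv]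
      · rw [evalStep_eq_zero k α u hr v hv]
        by_contra hne
        have := hκ' c d u.1 α v (Ne.symm hne)
        omega
  have hpath : ∀ (d : V) (q : Path a d), comb I p x d (evalPath k q) = pathIn I q • x := by
    intro d q
    induction q with
    | nil => rw [evalPath_nil, comb_single, IsRightSubpath.subtypeMk_val, one_smul]
    | @cons c d q α ih =>
      rw [pathIn_cons_smul, ← ih, evalPath_cons]
      conv_rhs => rw [comb, Finsupp.linearCombination_apply, Finsupp.sum, Finset.smul_sum]
      rw [Finsupp.linearCombination_apply, Finsupp.sum, map_sum]
      refine Finset.sum_congr rfl fun u _ => ?_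
      rw [map_smul, hstep, ← algebraMap_smul (PathAlgebra K V ⧸ I),
        ← algebraMap_smul (PathAlgebra K V ⧸ I) (evalPath k q u) (pathIn I u.1 • x),
        smul_smul, smul_smul (pathIn I α.toPath), Algebra.commutes]
  have helt : ∀ (f : PathAlgebra K V) (d : V), comb I p x d (evalElt k d f) =
      pathIn I (Path.nil : Path d d) • Ideal.Quotient.mk I f • x := by
    intro f d
    refine induction_support (P := fun f => comb I p x d (evalElt k d f) =
      pathIn I (Path.nil : Path d d) • Ideal.Quotient.mk I f • x) f ?_ ?_ ?_
    · simp
    · intro g g' hg hg'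
      rw [map_add, map_add, hg, hg', map_add, add_smul, smul_add]
    · intro c e q r _
      have hr : Ideal.Quotient.mk I (r • ofPath K q) = algebraMap K _ r * pathIn I q := by
        rw [← Algebra.smul_def]; rfl
      rw [map_smul, map_smul, hr, smul_smul, ← mul_assoc, ← Algebra.commutes, mul_smul, mul_smul,
        algebraMap_smul]
      rcases eq_or_ne a c with rfl | hac
      · rcases eq_or_ne d e with rfl | hde
        · rw [evalElt_ofPath, hpath, nil_smul_pathIn_smul]
        · rw [evalElt_ofPath_of_ne_right _ _ _ hde, map_zero,
            pathIn_smul_of_ne _ hde.symm (nil_smul_pathIn_smul q x)]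
      · rw [evalElt_ofPath_of_ne_left _ _ _ hac, map_zero, pathIn_smul_of_ne _ hac h.idem,
          smul_zero, smul_zero, smul_zero]
  refine ⟨k, (mem_uniserialVariety_iff I k).2 fun z hz d => ?_, hstep, helt⟩
  -- Reduction of z computes zx in a basis, so its coefficients vanish as soon as z acts as zero.
  apply h.comb_injective hI d
  rw [helt, Ideal.Quotient.eq_zero_iff_mem.2 hz, zero_smul, smul_zero, map_zero]

end Point

section PointModule

variable {a b : V} {p : Path a b}

/-- The module over the path algebra given by a point of the affine space with the coordinates
`X_i(α, u)`; it has the right subpaths of `p` as a basis. -/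
def PointModule (_k : DetourVar p → K) : Type _ := ∀ d : V, RightSubpathTo p d →₀ K

variable (k : DetourVar p → K)

noncomputable instance : AddCommGroup (PointModule k) :=
  inferInstanceAs (AddCommGroup (∀ d : V, RightSubpathTo p d →₀ K))

/-- The action of a path on the point module. -/
noncomputable def pathMap : ∀ {c d : V}, Path c d →
    (RightSubpathTo p c →₀ K) →ₗ[K] (RightSubpathTo p d →₀ K)
  | _, _, Path.nil => LinearMap.id
  | _, _, Path.cons q α => Finsupp.linearCombination K (evalStep k α) ∘ₗ pathMap q

omit [Fintype V] in
theorem pathMap_nil (c : V) : pathMap k (Path.nil : Path c c) = LinearMap.id := by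
  rw [pathMap]

omit [Fintype V] in
theorem pathMap_cons {c d e : V} (q : Path c d) (α : d ⟶ e) :
    pathMap k (q.cons α) = Finsupp.linearCombination K (evalStep k α) ∘ₗ pathMap k q := by
  rw [pathMap]

omit [Fintype V] in
theorem pathMap_comp {c d e : V} (q : Path c d) (q' : Path d e) :
    pathMap k (q.comp q') = pathMap k q' ∘ₗ pathMap k q := by
  induction q' with
  | nil => rw [Path.comp_nil, pathMap_nil, LinearMap.id_comp]
  | cons q' α ih => rw [Path.comp_cons, pathMap_cons, ih, pathMap_cons, LinearMap.comp_assoc]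

/-- The action on the point module of a combination of paths from `c` to `d`. -/
noncomputable def blockMap (c d : V) : (Path c d →₀ K) →ₗ[K]
    (RightSubpathTo p c →₀ K) →ₗ[K] (RightSubpathTo p d →₀ K) :=
  Finsupp.linearCombination K (pathMap k)

omit [Fintype V] in
theorem blockMap_single {c d : V} (q : Path c d) (r : K) :
    blockMap k c d (Finsupp.single q r) = r • pathMap k q :=
  Finsupp.linearCombination_single _ _ _

omit [Fintype V] in
theorem blockMap_pathComp {c d e : V} (f : Path c d →₀ K) (g : Path d e →₀ K) :
    blockMap k c e (pathComp c d e f g) = blockMap k d e g ∘ₗ blockMap k c d f := by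
  induction f using Finsupp.induction_linear with
  | zero => simp
  | add f₁ f₂ h₁ h₂ => simp [h₁, h₂, LinearMap.comp_add]
  | single q r =>
    induction g using Finsupp.induction_linear with
    | zero => simp
    | add f₁ f₂ h₁ h₂ => simp [h₁, h₂, LinearMap.add_comp]
    | single q' s =>
      rw [pathComp_single, blockMap_single, blockMap_single, blockMap_single, pathMap_comp,
        LinearMap.comp_smul, LinearMap.smul_comp, smul_smul]

noncomputable instance : Module (PathAlgebra K V) (PointModule k) where
  smul f m := fun d => ∑ c, blockMap k c d (f c d) (m c)
  one_smul m := by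
    funext d
    show ∑ c, blockMap k c d ((1 : PathAlgebra K V) c d) (m c) = m d
    rw [Finset.sum_eq_single d]
    · rw [one_apply_self, blockMap_single, one_smul, pathMap_nil, LinearMap.id_apply]
    · intro c _ hc
      rw [one_apply_ne hc.symm, map_zero, LinearMap.zero_apply]
    · simp
  mul_smul f g m := by
    funext e
    show ∑ c, blockMap k c e ((f * g) c e) (m c) =
      ∑ d, blockMap k d e (f d e) (∑ c, blockMap k c d (g c d) (m c))
    simp only [mul_apply, map_sum, blockMap_pathComp, LinearMap.sum_apply]
    exact Finset.sum_comm
  smul_zero f := by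
    funext d
    show ∑ c, blockMap k c d (f c d) 0 = 0
    simp
  smul_add f m m' := by
    funext d
    show ∑ c, blockMap k c d (f c d) (m c + m' c) =
      ∑ c, blockMap k c d (f c d) (m c) + ∑ c, blockMap k c d (f c d) (m' c)
    simp [Finset.sum_add_distrib]
  add_smul f g m := by
    funext d
    show ∑ c, blockMap k c d (f c d + g c d) (m c) =
      ∑ c, blockMap k c d (f c d) (m c) + ∑ c, blockMap k c d (g c d) (m c)
    simp [Finset.sum_add_distrib]
  zero_smul m := by
    funext d
    show ∑ c, blockMap k c d 0 (m c) = 0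
    simp

theorem pointModule_smul_apply (f : PathAlgebra K V) (m : PointModule k) (d : V) :
    (f • m) d = ∑ c, blockMap k c d (f c d) (m c) := rfl

open Classical in
/-- The element of the point module which is a combination of right subpaths ending in `d`. -/
noncomputable def pointSingle (d : V) : (RightSubpathTo p d →₀ K) →+ PointModule k :=
  AddMonoidHom.single (fun d : V => RightSubpathTo p d →₀ K) d

omit [Fintype V] in
theorem pointSingle_same (d : V) (g : RightSubpathTo p d →₀ K) : pointSingle k d g d = g := by
  classical
  exact Pi.single_eq_same (M := fun d : V => RightSubpathTo p d →₀ K) d g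

omit [Fintype V] in
theorem pointSingle_of_ne {d e : V} (h : e ≠ d) (g : RightSubpathTo p d →₀ K) :
    pointSingle k d g e = 0 := by
  classical
  exact Pi.single_eq_of_ne (M := fun d : V => RightSubpathTo p d →₀ K) h g

theorem pointModule_eq_sum (m : PointModule k) : m = ∑ d, pointSingle k d (m d) := by
  classical
  exact (Finset.univ_sum_single (M := fun d : V => RightSubpathTo p d →₀ K) m).symm

theorem ofPath_smul_pointSingle {c d : V} (q : Path c d) (g : RightSubpathTo p c →₀ K) :
    ofPath K q • pointSingle k c g = pointSingle k d (pathMap k q g) := by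
  funext e
  rw [pointModule_smul_apply, Finset.sum_eq_single c]
  · rw [pointSingle_same]
    rcases eq_or_ne e d with rfl | h
    · rw [pointSingle_same, ofPath_self, blockMap_single, one_smul]
    · rw [pointSingle_of_ne k h, ofPath_ne_right _ _ h, map_zero, LinearMap.zero_apply]
  · intro c' _ hc
    rw [pointSingle_of_ne k hc, map_zero]
  · simp

theorem algebraMap_smul_pointModule (r : K) (m : PointModule k) (d : V) :
    (algebraMap K (PathAlgebra K V) r • m) d = r • m d := by
  rw [Algebra.algebraMap_eq_smul_one, pointModule_smul_apply, Finset.sum_eq_single d]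
  · rw [smul_apply, one_apply_self, Finsupp.smul_single, blockMap_single, smul_eq_mul, mul_one,
      pathMap_nil, LinearMap.smul_apply, LinearMap.id_apply]
  · intro c _ hc
    rw [smul_apply, one_apply_ne hc.symm, smul_zero, map_zero, LinearMap.zero_apply]
  · simp

/-- The canonical top element of the point module. -/
noncomputable def pointTop : PointModule k :=
  pointSingle k a (Finsupp.single (IsRightSubpath.nil p).subtypeMk 1)

theorem ofPath_smul_pointTop {d : V} (q : Path a d) :
    ofPath K q • pointTop k = pointSingle k d (evalPath k q) := by
  rw [pointTop, ofPath_smul_pointSingle]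
  congr 1
  induction q with
  | nil => rw [pathMap_nil, LinearMap.id_apply, evalPath_nil]
  | cons q α ih => rw [evalPath_cons, ← ih, pathMap_cons, LinearMap.comp_apply]

theorem ofPath_smul_pointTop_of_ne {c d : V} (q : Path c d) (h : c ≠ a) :
    ofPath K q • pointTop k = 0 := by
  funext e
  rw [pointModule_smul_apply]
  refine Finset.sum_eq_zero fun c' _ => ?_
  rcases eq_or_ne c' c with rfl | hc
  · rw [pointTop, pointSingle_of_ne k h, map_zero]
  · rw [ofPath_ne_left _ _ hc, map_zero, LinearMap.zero_apply]

theorem smul_pointTop_apply (f : PathAlgebra K V) (d : V) :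
    (f • pointTop k) d = evalElt k d f := by
  refine induction_support (P := fun f => (f • pointTop k) d = evalElt k d f) f ?_ ?_ ?_
  · rw [zero_smul, map_zero]; rfl
  · intro g g' hg hg'
    rw [add_smul, map_add, ← hg, ← hg']; rfl
  · intro c e q r _
    rw [Algebra.smul_def, mul_smul, algebraMap_smul_pointModule, ← Algebra.smul_def, map_smul]
    congr 1
    rcases eq_or_ne c a with rfl | hc
    · rw [ofPath_smul_pointTop]
      rcases eq_or_ne d e with rfl | hd
      · rw [pointSingle_same, evalElt_ofPath]
      · rw [pointSingle_of_ne k hd, evalElt_ofPath_of_ne_right _ _ _ hd]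
    · rw [ofPath_smul_pointTop_of_ne k q hc, evalElt_ofPath_of_ne_left _ _ _ hc.symm]
      rfl

theorem pointSingle_mem {N : Submodule (PathAlgebra K V) (PointModule k)} {d : V}
    {g : RightSubpathTo p d →₀ K} (h : ∀ v, g v ≠ 0 → ofPath K v.1 • pointTop k ∈ N) :
    pointSingle k d g ∈ N := by
  rw [← Finsupp.sum_single g, Finsupp.sum, map_sum]
  refine Submodule.sum_mem _ fun v hv => ?_
  have hsmul : pointSingle k d (Finsupp.single v (g v)) =
      algebraMap K (PathAlgebra K V) (g v) • ofPath K v.1 • pointTop k := by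
    rw [ofPath_smul_pointTop, evalPath_of_right k v.2]
    funext e
    rw [algebraMap_smul_pointModule]
    rcases eq_or_ne e d with rfl | he
    · rw [pointSingle_same, pointSingle_same, Finsupp.smul_single, smul_eq_mul, mul_one]; rfl
    · rw [pointSingle_of_ne k he, pointSingle_of_ne k he, smul_zero]
  rw [hsmul]
  exact N.smul_mem _ (h v (Finsupp.mem_support_iff.1 hv))

theorem span_pointTop : Submodule.span (PathAlgebra K V) {pointTop k} = ⊤ := by
  rw [eq_top_iff]
  intro m _
  rw [pointModule_eq_sum k m]
  exact Submodule.sum_mem _ fun d _ => pointSingle_mem k fun v _ =>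
    Submodule.smul_mem _ _ (Submodule.mem_span_singleton_self _)

/-- The module is generated by its canonical top element, and I is two-sided; so the equations of
V_p, which concern only the top element, suffice. -/
theorem smul_pointModule_eq_zero (hk : k ∈ uniserialVariety I p) {z : PathAlgebra K V}
    (hz : z ∈ I) (m : PointModule k) : z • m = 0 := by
  have hm : m ∈ Submodule.span (PathAlgebra K V) {pointTop k} := by
    rw [span_pointTop]; trivial
  obtain ⟨f, rfl⟩ := Submodule.mem_span_singleton.1 hm
  rw [smul_smul]
  funext d
  rw [smul_pointTop_apply]
  exact (mem_uniserialVariety_iff I k).1 hk _ (I.mul_mem_right f hz) d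

/-- Each point of the variety `V_p` belongs to a uniserial module with mast `p`, on which the
detours act according to the coordinates of the point. -/
theorem exists_isMastTop_of_mem (hI : IsAdmissible I) (hk : k ∈ uniserialVariety I p) :
    ∃ (U : Type max uK uV uE) (_ : AddCommGroup U) (_ : Module (PathAlgebra K V ⧸ I) U) (x : U),
      IsMastTop I p x ∧ ∀ δ : DetourVar p, pathIn I (δ.u.cons δ.α) • x = 0 → k δ = 0 := by
  let ρ : (PathAlgebra K V ⧸ I) →+* AddMonoid.End (PointModule k) :=
    Ideal.Quotient.lift I (Module.toAddMonoidEnd (PathAlgebra K V) (PointModule k))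
      fun z hz => by
        ext m
        exact smul_pointModule_eq_zero k hk hz m
  let _ : Module (PathAlgebra K V ⧸ I) (PointModule k) := Module.compHom _ ρ
  have hpath : ∀ {c d : V} (q : Path c d) (m : PointModule k),
      pathIn I q • m = ofPath K q • m := fun _ _ => rfl
  have hspan : ∀ S : Set (PointModule k), ∀ m ∈ Submodule.span (PathAlgebra K V) S,
      m ∈ Submodule.span (PathAlgebra K V ⧸ I) S := by
    intro S m hm
    induction hm using Submodule.span_induction with
    | mem m h => exact Submodule.subset_span h
    | zero => exact Submodule.zero_mem _
    | add m m' _ _ h h' => exact Submodule.add_mem _ h h'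
    | smul f m _ h => exact Submodule.smul_mem _ (Ideal.Quotient.mk I f) h
  have hdet : ∀ {c d : V} {u : Path a c} (hu : IsRightSubpath u p) (α : c ⟶ d),
      pathIn I α.toPath • pathIn I u • pointTop k =
        pointSingle k d (evalStep k α hu.subtypeMk) := by
    intro c d u hu α
    rw [← pathIn_cons_smul, hpath, ofPath_smul_pointTop, evalPath_cons, evalPath_of_right k hu,
      Finsupp.linearCombination_single, one_smul]
  refine ⟨PointModule k, inferInstance, inferInstance, pointTop k, ?_, ?_⟩
  · refine isMastTop_of_span hI ?_ ?_ ?_ ?_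
    · rw [hpath, ofPath_smul_pointTop, evalPath_nil]
      rfl
    · rw [eq_top_iff]
      intro m _
      exact hspan _ _ (by rw [span_pointTop]; trivial)
    · rw [hpath, ofPath_smul_pointTop, evalPath_of_right k (IsRightSubpath.refl p)]
      intro h0
      have := congrFun h0 b
      rw [pointSingle_same] at this
      exact one_ne_zero (Finsupp.single_eq_zero.1 this)
    · intro c d u α hu
      rw [hdet hu]
      apply hspan
      by_cases hr : IsRightSubpath (u.cons α) p
      · have hcons : pointSingle k d (evalStep k α hu.subtypeMk) =
            ofPath K (u.cons α) • pointTop k := by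
          rw [ofPath_smul_pointTop, evalPath_of_right k hr]
          exact congrArg _ (evalStep_of_right k α hu.subtypeMk hr)
        rw [hcons]
        exact Submodule.subset_span ⟨d, u.cons α, hr, Nat.lt_succ_self _, rfl⟩
      · refine pointSingle_mem k fun v hv => Submodule.subset_span ⟨d, v.1, v.2, ?_, rfl⟩
        by_contra hlt
        exact hv (evalStep_eq_zero k α hu.subtypeMk hr v (not_lt.1 hlt))
  · rintro ⟨c, d, u, α, hd, v, hv⟩ h0
    rw [pathIn_cons_smul, hdet hd.1] at h0
    have := congrFun h0 d
    rw [pointSingle_same] at this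
    refine (evalStep_of_detour k α hd.1.subtypeMk hd v hv).symm.trans ?_
    rw [this]
    rfl

end PointModule

end PathAlgebra

/-! ### Edge paths as graphs. -/

section EdgePath

variable {V : Type uV} [Quiver.{uE} V]

theorem mem_edgePath_vertices {a b : V} (p : Path a b) (m : ℕ × V) :
    m ∈ (edgePath p).vertices ↔ ∃ u : Path a m.2, IsRightSubpath u p ∧ u.length = m.1 := by
  obtain ⟨i, e⟩ := m
  induction p with
  | nil =>
    constructor
    · rintro h
      cases h
      exact ⟨Path.nil, IsRightSubpath.refl _, rfl⟩
    · rintro ⟨u, hu, hl⟩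
      dsimp only at u hu hl
      subst hl
      have h := hu.eq_self_of_length_eq (Nat.le_zero.1 hu.length_le)
      cases h
      exact Set.mem_singleton _
  | @cons c d p α ih =>
    constructor
    · rintro (h | h)
      · cases h
        exact ⟨p.cons α, IsRightSubpath.refl _, rfl⟩
      · obtain ⟨u, hu, hl⟩ := ih.1 h
        exact ⟨u, hu.trans ⟨α.toPath, rfl⟩, hl⟩
    · rintro ⟨u, hu, hl⟩
      dsimp only at u hu hl
      subst hl
      rcases hu.cons_cases with h | h
      · cases h
        exact Or.inl rfl
      · exact Or.inr (ih.2 ⟨u, h, rfl⟩)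

theorem mem_edgePath_edges {a b : V} (p : Path a b) (m : ℕ × (Σ c d : V, c ⟶ d) × ℕ) :
    m ∈ (edgePath p).edges ↔ ∃ u : Path a m.2.1.1,
      IsRightSubpath (u.cons m.2.1.2.2) p ∧ u.length = m.1 ∧ m.2.2 = m.1 + 1 := by
  obtain ⟨i, ⟨c, d, β⟩, j⟩ := m
  induction p with
  | nil =>
    constructor
    · rintro ⟨⟩
    · rintro ⟨u, hu, -⟩
      have := hu.length_le
      simp at this
  | @cons c' d' p α ih =>
    constructor
    · rintro (h | h)
      · cases h
        exact ⟨p, IsRightSubpath.refl _, rfl, rfl⟩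
      · obtain ⟨u, hu, hl⟩ := ih.1 h
        exact ⟨u, hu.trans ⟨α.toPath, rfl⟩, hl⟩
    · rintro ⟨u, hu, hl, hj⟩
      dsimp only at u hu hl hj
      subst hl hj
      rcases hu.cons_cases with h | h
      · cases h
        exact Or.inl rfl
      · exact Or.inr (ih.2 ⟨u, h, rfl, rfl⟩)

/-- The path can be read off its edges one by one: the edge leaving layer |u| is the next arrow, and
right subpaths of equal length agree. -/
theorem isRightSubpath_of_edgePath_eq {a b b' : V} {p : Path a b} {p' : Path a b'}
    (h : edgePath p = edgePath p') {c : V} {u : Path a c} (hu : IsRightSubpath u p) :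
    IsRightSubpath u p' := by
  induction u with
  | nil => exact IsRightSubpath.nil p'
  | @cons c d u α ih =>
    have hmem : (u.length, (⟨c, d, α⟩ : Σ c d : V, c ⟶ d), u.length + 1) ∈ (edgePath p).edges :=
      (mem_edgePath_edges p _).2 ⟨u, hu, rfl, rfl⟩
    rw [h] at hmem
    obtain ⟨u', hu', hl, -⟩ := (mem_edgePath_edges p' _).1 hmem
    dsimp only at u' hu' hl
    cases (ih hu.of_cons).eq_of_length_eq hu'.of_cons hl.symm
    exact hu'

theorem edgePath_injective {a b a' b' : V} {p : Path a b} {p' : Path a' b'}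
    (h : edgePath p = edgePath p') :
    (⟨a, b, p⟩ : Σ a b : V, Path a b) = ⟨a', b', p'⟩ := by
  have hmem : (0, a) ∈ (edgePath p).vertices :=
    (mem_edgePath_vertices p _).2 ⟨Path.nil, IsRightSubpath.nil p, rfl⟩
  rw [h] at hmem
  obtain ⟨u, -, hu⟩ := (mem_edgePath_vertices p' _).1 hmem
  obtain rfl : a' = a := Path.eq_of_length_zero u hu
  have h1 := isRightSubpath_of_edgePath_eq h (IsRightSubpath.refl p)
  have h2 := isRightSubpath_of_edgePath_eq h.symm (IsRightSubpath.refl p')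
  cases h1.eq_self_of_length_eq (le_antisymm h1.length_le h2.length_le)
  rfl

end EdgePath

theorem finite_paths_length_le {V : Type uV} [Quiver.{uE} V] [Finite V]
    [∀ a b : V, Finite (a ⟶ b)] (n : ℕ) :
    {q : Σ a b : V, Path a b | q.2.2.length ≤ n}.Finite := by
  have key : ∀ i, {q : Σ a b : V, Path a b | q.2.2.length = i}.Finite := by
    intro i
    induction i with
    | zero =>
      refine (Set.finite_range fun a : V => (⟨a, a, Path.nil⟩ : Σ a b : V, Path a b)).subset ?_
      rintro ⟨a, b, q⟩ h
      cases q with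
      | nil => exact ⟨a, rfl⟩
      | cons q α => simp at h
    | succ i ih =>
      refine (ih.biUnion fun q _ => Set.finite_range fun β : Σ c : V, q.2.1 ⟶ c =>
        (⟨q.1, β.1, q.2.2.cons β.2⟩ : Σ a b : V, Path a b)).subset ?_
      rintro ⟨a, b, q⟩ h
      cases q with
      | nil => simp at h
      | @cons c _ q α =>
        simp only [Set.mem_iUnion]
        exact ⟨⟨a, c, q⟩, Nat.succ.inj h, ⟨b, α⟩, rfl⟩
  refine ((Set.finite_Iic n).biUnion fun i _ => key i).subset ?_
  intro q hq
  simp only [Set.mem_iUnion]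
  exact ⟨_, hq, rfl⟩

/-! ### Graphs of uniserial modules, and modules on which all detours vanish. -/

namespace PathAlgebra

variable {K : Type uK} {V : Type uV} [Field K] [Quiver.{uE} V] [Fintype V]
variable {I : Ideal (PathAlgebra K V)} [I.IsTwoSided]

theorem pathIn_eq_zero_of_le {N : ℕ}
    (hN : ∀ (a b : V) (q : Path a b), N ≤ q.length → ofPath K q ∈ I) {a b : V} (q : Path a b)
    (hq : N ≤ q.length) : pathIn I q = 0 :=
  Ideal.Quotient.eq_zero_iff_mem.2 (hN a b q hq)

theorem hasMast_of_isMastTop (hI : IsAdmissible I) {U : UniserialModule I} {a b : V}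
    {p : Path a b} {x : U.carrier} (h : IsMastTop I p x) : U.HasMast p :=
  ⟨h.length_eq hI, x, h.ne_zero⟩

theorem isTop_of_isMastTop (hI : IsAdmissible I) {U : UniserialModule I} {a b : V}
    {p : Path a b} {x : U.carrier} (h : IsMastTop I p x) : U.IsTop x :=
  ⟨h.notMem_radPow_one hI, a, h.idem⟩

theorem mem_graph_vertices (hI : IsAdmissible I) {U : UniserialModule I} {a b : V}
    {p : Path a b} {x : U.carrier} (h : IsMastTop I p x) (m : ℕ × V) :
    m ∈ (U.graph x).vertices ↔ ∃ u : Path a m.2, IsRightSubpath u p ∧ u.length = m.1 := by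
  let _ : Module K U.carrier := Module.compHom U.carrier (algebraMap K (PathAlgebra K V ⧸ I))
  have _ : IsScalarTower K (PathAlgebra K V ⧸ I) U.carrier :=
    IsScalarTower.of_algebraMap_smul fun _ _ => rfl
  obtain ⟨i, e⟩ := m
  constructor
  · rintro ⟨y, hy, hy'⟩
    dsimp only at hy hy'
    obtain ⟨v, c, hv, hiv, -, hmem⟩ := h.exists_leading hI (Submodule.smul_mem _ _ hy)
      (fun h0 => hy' (h0 ▸ Submodule.zero_mem _)) (nil_smul_pathIn_smul (Path.nil : Path e e) y)
    refine ⟨v, hv, le_antisymm (not_lt.1 fun hlt => hy' ?_) hiv⟩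
    rw [← sub_add_cancel (pathIn I _ • y) (c • pathIn I v • x),
      ← algebraMap_smul (PathAlgebra K V ⧸ I) c (pathIn I v • x)]
    rw [← algebraMap_smul (PathAlgebra K V ⧸ I) c (pathIn I v • x)] at hmem
    exact Submodule.add_mem _ (radPow_antitone (by omega) hmem)
      (Submodule.smul_mem _ _ (radPow_antitone hlt (IsMastTop.smul_mem hI v x)))
  · rintro ⟨u, hu, hl⟩
    dsimp only at u hu hl
    subst hl
    refine ⟨pathIn I u • x, IsMastTop.smul_mem hI u x, ?_⟩
    rw [nil_smul_pathIn_smul]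
    exact h.smul_notMem hI hu

/-- Generating a radical layer just means lying in it and not in the next. In this form edges can be
compared along merely additive maps preserving layers. -/
theorem mem_graph_edges (hI : IsAdmissible I) {U : UniserialModule I} {a b : V}
    {p : Path a b} {x : U.carrier} (h : IsMastTop I p x) (m : ℕ × (Σ c d : V, c ⟶ d) × ℕ) :
    m ∈ (U.graph x).edges ↔ ∃ u : Path a m.2.1.1, u.length = m.1 ∧
      pathIn I u • x ∉ radPow (PathAlgebra K V ⧸ I) U.carrier (m.1 + 1) ∧
      pathIn I (u.cons m.2.1.2.2) • x ∈ radPow (PathAlgebra K V ⧸ I) U.carrier m.2.2 ∧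
      pathIn I (u.cons m.2.1.2.2) • x ∉ radPow (PathAlgebra K V ⧸ I) U.carrier (m.2.2 + 1) := by
  constructor
  · rintro ⟨a', u, hl, hu0, hu, hα0, hα⟩
    obtain rfl : a = a' := by
      by_contra hne
      exact hu0 (pathIn_smul_of_ne u hne h.idem)
    rw [span_singleton_eq_radPow_iff hI h.total (nil_smul_pathIn_smul _ x) hu0] at hu
    rw [span_singleton_eq_radPow_iff hI h.total (nil_smul_pathIn_smul _ x) hα0] at hα
    exact ⟨u, hl, hu.2, hα⟩
  · rintro ⟨u, hl, hu, hα, hα'⟩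
    refine ⟨a, u, hl, fun h0 => hu (h0 ▸ Submodule.zero_mem _), ?_,
      fun h0 => hα' (h0 ▸ Submodule.zero_mem _), ?_⟩
    · refine span_singleton_eq_radPow hI h.total (nil_smul_pathIn_smul _ x) ?_ hu
      rw [← hl]
      exact IsMastTop.smul_mem hI u x
    · exact span_singleton_eq_radPow hI h.total (nil_smul_pathIn_smul _ x) hα hα'

theorem mem_graph_edges_mk (hI : IsAdmissible I) {U : UniserialModule I} {a b : V}
    {p : Path a b} {x : U.carrier} (h : IsMastTop I p x) (i j : ℕ) {c d : V} (α : c ⟶ d) :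
    (i, (⟨c, d, α⟩ : Σ c d : V, c ⟶ d), j) ∈ (U.graph x).edges ↔ ∃ u : Path a c, u.length = i ∧
      pathIn I u • x ∉ radPow (PathAlgebra K V ⧸ I) U.carrier (i + 1) ∧
      pathIn I (u.cons α) • x ∈ radPow (PathAlgebra K V ⧸ I) U.carrier j ∧
      pathIn I (u.cons α) • x ∉ radPow (PathAlgebra K V ⧸ I) U.carrier (j + 1) :=
  mem_graph_edges hI h _

section NoDetours

variable {U : Type*} [AddCommGroup U] [Module (PathAlgebra K V ⧸ I) U]
variable {a b : V} {p : Path a b} {x : U}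

/-- All detours on the mast `p` act as zero on the top element `x`. -/
def DetoursVanish (I : Ideal (PathAlgebra K V)) [I.IsTwoSided] {U : Type*} [AddCommGroup U]
    [Module (PathAlgebra K V ⧸ I) U] {a b : V} (p : Path a b) (x : U) : Prop :=
  ∀ (c d : V) (u : Path a c) (α : c ⟶ d), IsRightSubpath u p → ¬ IsRightSubpath (u.cons α) p →
    pathIn I (u.cons α) • x = 0

/-- A path which leaves p does so by a first arrow, and that arrow already gives zero. -/
theorem DetoursVanish.isRightSubpath (h : DetoursVanish I p x) {d : V} (q : Path a d)
    (hq : pathIn I q • x ≠ 0) : IsRightSubpath q p := by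
  induction q with
  | nil => exact IsRightSubpath.nil p
  | cons q α ih =>
    have hq' : IsRightSubpath q p := ih fun h0 => hq (by rw [pathIn_cons_smul, h0, smul_zero])
    by_contra hne
    exact hq (h _ _ q α hq' hne)

theorem DetoursVanish.graph_eq (hI : IsAdmissible I) {U : UniserialModule I} {x : U.carrier}
    (h : IsMastTop I p x) (h0 : DetoursVanish I p x) : U.graph x = edgePath p := by
  ext m
  · rw [mem_graph_vertices hI h, mem_edgePath_vertices]
  · rw [mem_graph_edges hI h, mem_edgePath_edges]
    obtain ⟨i, ⟨c, d, α⟩, j⟩ := m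
    constructor
    · rintro ⟨u, hl, -, hj, hj'⟩
      dsimp only at u hl hj hj'
      have hr := h0.isRightSubpath (u.cons α) fun hz => hj' (hz ▸ Submodule.zero_mem _)
      refine ⟨u, hr, hl, le_antisymm ?_ ?_⟩
      · by_contra hlt
        refine h.smul_notMem hI hr (radPow_antitone ?_ hj)
        rw [Path.length_cons]
        dsimp only at hlt
        omega
      · by_contra hlt
        refine hj' (radPow_antitone ?_ (IsMastTop.smul_mem hI (u.cons α) x))
        rw [Path.length_cons]
        dsimp only at hlt
        omega
    · rintro ⟨u, hr, hl, hj⟩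
      dsimp only at u hr hl hj
      have hmem := IsMastTop.smul_mem hI (u.cons α) x
      have hnot := h.smul_notMem hI hr
      have hnot' := h.smul_notMem hI hr.of_cons
      rw [Path.length_cons, hl, ← hj] at hmem hnot
      rw [hl] at hnot'
      exact ⟨u, hl, hnot', hmem, hnot⟩

theorem nonempty_equiv_of_ann {U' : Type*} [AddCommGroup U'] [Module (PathAlgebra K V ⧸ I) U']
    {x' : U'} (hx : Submodule.span (PathAlgebra K V ⧸ I) {x} = ⊤)
    (hx' : Submodule.span (PathAlgebra K V ⧸ I) {x'} = ⊤)
    (h : ∀ r : PathAlgebra K V ⧸ I, r • x = 0 ↔ r • x' = 0) :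
    Nonempty (U ≃ₗ[PathAlgebra K V ⧸ I] U') := by
  have hker : LinearMap.ker (LinearMap.toSpanSingleton (PathAlgebra K V ⧸ I) U x) =
      LinearMap.ker (LinearMap.toSpanSingleton (PathAlgebra K V ⧸ I) U' x') := by
    ext r
    exact h r
  have hs : Function.Surjective (LinearMap.toSpanSingleton (PathAlgebra K V ⧸ I) U x) := by
    rw [← LinearMap.range_eq_top, LinearMap.range_toSpanSingleton, hx]
  have hs' : Function.Surjective (LinearMap.toSpanSingleton (PathAlgebra K V ⧸ I) U' x') := by
    rw [← LinearMap.range_eq_top, LinearMap.range_toSpanSingleton, hx']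
  exact ⟨(LinearMap.quotKerEquivOfSurjective _ hs).symm ≪≫ₗ Submodule.quotEquivOfEq _ _ hker ≪≫ₗ
    LinearMap.quotKerEquivOfSurjective _ hs'⟩

/-- The point of V_p attached to the module is the origin, so the annihilator of x depends only on
p. Hence two such modules with mast p are isomorphic. -/
theorem DetoursVanish.smul_eq_zero_iff (hI : IsAdmissible I) (h : IsMastTop I p x)
    (h0 : DetoursVanish I p x) (f : PathAlgebra K V) :
    Ideal.Quotient.mk I f • x = 0 ↔ ∀ d, evalElt (0 : DetourVar p → K) d f = 0 := by
  let _ : Module K U := Module.compHom U (algebraMap K (PathAlgebra K V ⧸ I))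
  have _ : IsScalarTower K (PathAlgebra K V ⧸ I) U :=
    IsScalarTower.of_algebraMap_smul fun _ _ => rfl
  obtain ⟨k, -, hstep, helt⟩ := h.exists_point hI
  obtain rfl : k = 0 := by
    ext ⟨c, d, u, α, hd, v, hv⟩
    have h1 := hstep c d α hd.1.subtypeMk
    rw [IsRightSubpath.subtypeMk_val, ← pathIn_cons_smul, h0 _ _ u α hd.1 hd.2.1] at h1
    have h2 := h.comb_injective hI d (h1.trans (map_zero _).symm)
    refine (evalStep_of_detour k α hd.1.subtypeMk hd v hv).symm.trans ?_
    rw [h2]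
    rfl
  constructor
  · intro hf d
    apply h.comb_injective hI d
    rw [helt, hf, smul_zero, map_zero]
  · intro hf
    rw [← sum_nil_smul (I := I) (Ideal.Quotient.mk I f • x)]
    refine Finset.sum_eq_zero fun d _ => ?_
    rw [← helt, hf, map_zero]

theorem DetoursVanish.nonempty_equiv (hI : IsAdmissible I) {U' : Type*} [AddCommGroup U']
    [Module (PathAlgebra K V ⧸ I) U'] {x' : U'} (h : IsMastTop I p x) (h0 : DetoursVanish I p x)
    (h' : IsMastTop I p x') (h0' : DetoursVanish I p x') :
    Nonempty (U ≃ₗ[PathAlgebra K V ⧸ I] U') := by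
  refine nonempty_equiv_of_ann (h.span_eq_top hI) (h'.span_eq_top hI) fun r => ?_
  obtain ⟨f, rfl⟩ := Ideal.Quotient.mk_surjective r
  rw [h0.smul_eq_zero_iff hI h, h0'.smul_eq_zero_iff hI h']

end NoDetours

/-! ### Consequences of the condition on masts and parallel arrows. -/

/-- Whenever a mast of positive length is parallel to an arrow, it starts with this arrow. -/
def MastsStartWithArrows (I : Ideal (PathAlgebra K V)) [I.IsTwoSided] : Prop :=
  ∀ (e e' : V) (α : e ⟶ e') (p : Path e e'), IsMast I p → 0 < p.length →
    ∃ c' : Path e' e', p = α.toPath.comp c'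

section

variable {U : Type max uK uV uE} [AddCommGroup U] [Module (PathAlgebra K V ⧸ I) U]
variable {a b : V} {p : Path a b} {x : U}

/-- If αux ≠ 0, its leading right subpath v is longer than u, so v = wu with w parallel to α. As a
segment of a mast, w is a mast, hence starts with α; this puts αu on p. -/
theorem MastsStartWithArrows.detoursVanish (h2 : MastsStartWithArrows I) (hI : IsAdmissible I)
    (h : IsMastTop I p x) : DetoursVanish I p x := by
  intro c d u α hu hα
  by_contra hne
  let _ : Module K U := Module.compHom U (algebraMap K (PathAlgebra K V ⧸ I))
  have _ : IsScalarTower K (PathAlgebra K V ⧸ I) U :=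
    IsScalarTower.of_algebraMap_smul fun _ _ => rfl
  obtain ⟨v, -, hv, hlt, -, -⟩ := h.exists_leading hI (IsMastTop.smul_mem hI (u.cons α) x) hne
    (nil_smul_pathIn_smul _ x)
  rw [Path.length_cons] at hlt
  obtain ⟨w, rfl⟩ := hu.of_length_le hv (by omega)
  obtain ⟨c', rfl⟩ := h2 _ _ α w (h.isMast_segment hI hv) (by
    rw [Path.length_comp] at hlt
    omega)
  exact hα (IsRightSubpath.trans ⟨c', by rw [← Path.comp_assoc]; rfl⟩ hv)

end

namespace MastsStartWithArrows

variable (h2 : MastsStartWithArrows I) (hI : IsAdmissible I)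

include h2 hI

theorem uniserialVariety_subset {a b : V} (p : Path a b) : uniserialVariety I p ⊆ {0} := by
  intro k hk
  obtain ⟨U, _, _, x, hx, hδ⟩ := exists_isMastTop_of_mem k hI hk
  ext δ
  exact hδ δ (h2.detoursVanish hI hx _ _ _ _ δ.isDetour.1 δ.isDetour.2.1)

theorem eq_empty_or_singleton {a b : V} (p : Path a b) :
    uniserialVariety I p = ∅ ∨ ∃ k : DetourVar p → K, uniserialVariety I p = {k} :=
  (Set.subset_singleton_iff_eq.1 (h2.uniserialVariety_subset hI p)).imp_right fun h => ⟨0, h⟩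

theorem exists_mast (U : UniserialModule I) : ∃ (a b : V) (p : Path a b), U.HasMast p ∧
    ∀ x : U.carrier, U.IsTop x → U.graph x = edgePath p := by
  obtain ⟨x, hx⟩ := exists_isTop hI U
  obtain ⟨a, b, p, hp⟩ := exists_isMastTop_of_isTop hI hx
  have hm := hasMast_of_isMastTop hI hp
  refine ⟨a, b, p, hm, fun y hy => ?_⟩
  have hy' := isMastTop_of_hasMast hI hm hy
  exact (h2.detoursVanish hI hy').graph_eq hI hy'

theorem equiv_of_hasMast {U U' : UniserialModule I} {a b : V} {p : Path a b} (hU : U.HasMast p)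
    (hU' : U'.HasMast p) : U ≈ U' := by
  obtain ⟨x, hx⟩ := exists_isTop hI U
  obtain ⟨x', hx'⟩ := exists_isTop hI U'
  have h := isMastTop_of_hasMast hI hU hx
  have h' := isMastTop_of_hasMast hI hU' hx'
  exact (h2.detoursVanish hI h).nonempty_equiv hI h h' (h2.detoursVanish hI h')

/-- The mast is a complete invariant, and paths of length at least N act as zero, so only finitely
many paths can be masts. -/
theorem finiteUniserialType [∀ a b : V, Finite (a ⟶ b)] : FiniteUniserialType I := by
  obtain ⟨N, hN⟩ := hI.2
  choose a b p hp hgraph using h2.exists_mast hI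
  have := (finite_paths_length_le (V := V) N).to_subtype
  let F : UniserialType I → {q : Σ a b : V, Path a b | q.2.2.length ≤ N} := fun T =>
    ⟨⟨a T.out, b T.out, p T.out⟩, by
      obtain ⟨x, hx⟩ := (hp T.out).2
      by_contra hlt
      rw [Set.mem_ofPred_eq, not_le] at hlt
      exact hx (by rw [pathIn_eq_zero_of_le hN _ hlt.le, zero_smul])⟩
  refine Finite.of_injective F fun T T' hT => ?_
  have hT' : (⟨a T.out, b T.out, p T.out⟩ : Σ a b : V, Path a b) =
    ⟨a T'.out, b T'.out, p T'.out⟩ := congrArg Subtype.val hT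
  have hmast : ∀ q q' : Σ a b : V, Path a b, q = q' → T.out.HasMast q.2.2 →
      T'.out.HasMast q'.2.2 → T.out ≈ T'.out := by
    rintro q _ rfl hq hq'
    exact h2.equiv_of_hasMast hI hq hq'
  rw [← Quotient.out_eq T, ← Quotient.out_eq T']
  exact Quotient.sound (hmast _ _ hT' (hp _) (hp _))

theorem not_isHalyard {a b c d : V} (p : Path a b) (u : Path a c) (α : c ⟶ d) :
    ¬ IsHalyard I p u α := by
  rintro ⟨hd, U, x, hU, hx, hne⟩
  exact hne (h2.detoursVanish hI (isMastTop_of_hasMast hI hU hx) _ _ u α hd.1 hd.2.1)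

/-- The graph of any top element is the edge path of the mast: it determines the mast, which in turn
determines the isomorphism type. -/
theorem exists_equiv_graphs : ∃ Φ : UniserialType I ≃ uniserialGraphs I,
    ∀ (U : UniserialModule I) (x : U.carrier), U.IsTop x →
      (Φ (Quotient.mk (uniserialSetoid I) U) : LayeredGraph V) = U.graph x := by
  choose top htop using exists_isTop (I := I) hI
  have hiso : ∀ U U' : UniserialModule I, U ≈ U' → ∀ x x', U.IsTop x → U'.IsTop x' →
      U.graph x = U'.graph x' := by
    rintro U U' ⟨φ⟩ x x' hx hx'
    obtain ⟨a, b, p, hp⟩ := exists_isMastTop_of_isTop hI hx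
    have hm := hasMast_of_isMastTop hI (hp.map_equiv φ)
    have hp' := isMastTop_of_hasMast hI hm hx'
    rw [(h2.detoursVanish hI hp).graph_eq hI hp, (h2.detoursVanish hI hp').graph_eq hI hp']
  let F : UniserialType I → uniserialGraphs I := Quotient.lift
    (fun U => ⟨U.graph (top U), U, top U, htop U, rfl⟩)
    fun U U' h => Subtype.ext (hiso U U' h _ _ (htop U) (htop U'))
  have hF : Function.Bijective F := by
    constructor
    · intro T T'
      induction T using Quotient.inductionOn with | _ U
      induction T' using Quotient.inductionOn with | _ U'
      intro h
      have h' : U.graph (top U) = U'.graph (top U') := congrArg Subtype.val h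
      obtain ⟨a, b, p, hp, hg⟩ := h2.exists_mast hI U
      obtain ⟨a', b', p', hp', hg'⟩ := h2.exists_mast hI U'
      rw [hg _ (htop U), hg' _ (htop U')] at h'
      cases edgePath_injective h'
      exact Quotient.sound (h2.equiv_of_hasMast hI hp hp')
    · rintro ⟨G, U, x, hx, rfl⟩
      exact ⟨Quotient.mk _ U, Subtype.ext (hiso U U (Setoid.refl U) _ _ (htop U) hx)⟩
  exact ⟨Equiv.ofBijective F hF, fun U x hx => hiso U U (Setoid.refl U) _ _ (htop U) hx⟩

theorem isEdgePath {G : LayeredGraph V} (hG : G ∈ uniserialGraphs I) : G.IsEdgePath := by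
  obtain ⟨U, x, hx, rfl⟩ := hG
  obtain ⟨a, b, p, -, hp⟩ := h2.exists_mast hI U
  exact ⟨a, b, p, hp x hx⟩

end MastsStartWithArrows

end PathAlgebra

/-! ### Failure of the condition: infinite varieties and graphs with branching. -/

namespace PathAlgebra

variable {K : Type uK} {V : Type uV} [Field K] [Quiver.{uE} V] [Fintype V]
variable {I : Ideal (PathAlgebra K V)} [I.IsTwoSided]

omit [Fintype V] in
theorem isDetour_nil {a b : V} {p : Path a b} {α : a ⟶ b} (hpos : 0 < p.length)
    (hα : ¬ IsRightSubpath α.toPath p) : IsDetour p Path.nil α :=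
  ⟨IsRightSubpath.nil p, hα, p, IsRightSubpath.refl p, hpos⟩

theorem pathIn_nil_cons {a b : V} (α : a ⟶ b) :
    pathIn I (Path.nil.cons α) = pathIn I α.toPath := rfl

/-- The deformation with parameter t shifts by t the coordinate belonging to the detour of α at the
start of p and to the right subpath p itself. -/
theorem infinite_uniserialVariety [Infinite K] (hI : IsAdmissible I) {a b : V} {p : Path a b}
    (hp : IsMast I p) (hpos : 0 < p.length) {α : a ⟶ b} (hα : ¬ IsRightSubpath α.toPath p) :
    (uniserialVariety I p).Infinite := by
  obtain ⟨U, x, h⟩ := exists_isMastTop_of_isMast hI hp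
  let _ : Module K U.carrier := Module.compHom U.carrier (algebraMap K (PathAlgebra K V ⧸ I))
  have _ : IsScalarTower K (PathAlgebra K V ⧸ I) U.carrier :=
    IsScalarTower.of_algebraMap_smul fun _ _ => rfl
  have hd := isDetour_nil hpos hα
  have hlt : (Path.nil : Path a a).length < p.length := hpos
  let δ : DetourVar p := ⟨a, b, Path.nil, α, hd, (IsRightSubpath.refl p).subtypeMk, hlt⟩
  obtain ⟨κ, hκ, -⟩ := h.exists_comb hI 0 (y := pathIn I α.toPath • x) trivial b
  rw [nil_smul_pathIn_smul] at hκ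
  have key : ∀ t : K, ∃ k ∈ uniserialVariety I p,
      k δ = κ (IsRightSubpath.refl p).subtypeMk + t := by
    intro t
    obtain ⟨U', _, _, f, hM, hK, hα', hq, -⟩ := h.exists_deformation hI hpos α hα t
    let _ : Module K U' := Module.compHom U' (algebraMap K (PathAlgebra K V ⧸ I))
    have _ : IsScalarTower K (PathAlgebra K V ⧸ I) U' :=
      IsScalarTower.of_algebraMap_smul fun _ _ => rfl
    obtain ⟨k, hk, hstep, -⟩ := hM.exists_point hI
    refine ⟨k, hk, ?_⟩
    -- No right subpath of p equals α, so the deformation does not affect the basis elements.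
    have hcomb : ∀ g : RightSubpathTo p b →₀ K, IsMastTop.comb I p (f x) b g =
        f (IsMastTop.comb I p x b g) := by
      intro g
      rw [IsMastTop.comb, IsMastTop.comb, Finsupp.linearCombination_apply,
        Finsupp.linearCombination_apply, Finsupp.sum, Finsupp.sum, map_sum]
      refine Finset.sum_congr rfl fun v _ => ?_
      rw [← algebraMap_smul (PathAlgebra K V ⧸ I),
        ← algebraMap_smul (PathAlgebra K V ⧸ I) (g v) (pathIn I v.1 • x), hK, hq]
      intro he
      apply hα
      cases v with | _ v hv
      cases he
      exact hv
    have h1 := hstep a b α hd.1.subtypeMk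
    have hp1 := IsMastTop.comb_single (I := I) (x := x) b (IsRightSubpath.refl p).subtypeMk t
    rw [IsRightSubpath.subtypeMk_val] at hp1
    rw [IsRightSubpath.subtypeMk_val, hM.idem, hα', hκ, algebraMap_smul, ← hp1, ← map_add,
      ← hcomb] at h1
    have h2 := evalStep_of_detour k α hd.1.subtypeMk hd (IsRightSubpath.refl p).subtypeMk hlt
    have h3 := DFunLike.congr_fun (hM.comb_injective hI b h1) (IsRightSubpath.refl p).subtypeMk
    rw [Finsupp.add_apply, Finsupp.single_eq_same] at h3
    exact h2.symm.trans h3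
  choose k hk hkδ using key
  refine Set.infinite_of_injective_forall_mem (f := k) (fun s t hst => ?_) hk
  have := congrFun hst δ
  rw [hkδ, hkδ] at this
  exact add_left_cancel this

theorem exists_not_isEdgePath (hI : IsAdmissible I) {a b : V} {p : Path a b}
    (hp : IsMast I p) (hpos : 0 < p.length) {α : a ⟶ b} (hα : ¬ IsRightSubpath α.toPath p) :
    ∃ G ∈ uniserialGraphs I, ¬ G.IsEdgePath := by
  obtain ⟨U, x, h⟩ := exists_isMastTop_of_isMast hI hp
  obtain ⟨U', x', h', hne⟩ : ∃ (U : UniserialModule I) (x : U.carrier), IsMastTop I p x ∧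
      pathIn I α.toPath • x ≠ 0 := by
    -- If α kills x, the deformation with parameter 1 replaces αx by px ≠ 0.
    by_cases h0 : pathIn I α.toPath • x = 0
    · obtain ⟨U', f, hM, -, hα', -, -⟩ := exists_uniserial_deformation hI h hpos α hα 1
      refine ⟨U', f x, hM, fun h1 => h.ne_zero ?_⟩
      rw [h0, zero_add, map_one, one_smul] at hα'
      exact f.map_eq_zero_iff.1 (hα'.symm.trans h1)
    · exact ⟨U, x, h, h0⟩
  refine ⟨_, ⟨U', x', isTop_of_isMastTop hI h', rfl⟩, ?_⟩
  rintro ⟨c, d, q, hq⟩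
  have hnil : pathIn I (Path.nil : Path a a) • x' ∉
      radPow (PathAlgebra K V ⧸ I) U'.carrier (0 + 1) := by
    rw [h'.idem, zero_add]
    exact h'.notMem_radPow_one hI
  obtain ⟨j, -, hj, hj'⟩ := exists_mem_radPow_notMem_succ hI (i := 0) hne trivial
  have hαmem : (0, (⟨a, b, α⟩ : Σ c d : V, c ⟶ d), j) ∈ (U'.graph x').edges :=
    (mem_graph_edges_mk hI h' _ _ _).2 ⟨Path.nil, rfl, hnil, by rwa [pathIn_nil_cons],
      by rwa [pathIn_nil_cons]⟩
  obtain ⟨e, u, hu, hlen⟩ := IsRightSubpath.exists_length_eq p (n := 1) hpos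
  obtain ⟨β, rfl⟩ : ∃ β : a ⟶ e, u = β.toPath := by
    cases u with
    | nil => simp at hlen
    | cons u β =>
      cases u with
      | nil => exact ⟨β, rfl⟩
      | cons u γ => simp at hlen
  -- Both α and the first arrow β of p label edges leaving layer 0, while an edge path has only one
  -- such edge.
  have hβ := IsMastTop.smul_mem hI β.toPath x'
  have hβ' := h'.smul_notMem hI hu
  have hβmem : (0, (⟨a, e, β⟩ : Σ c d : V, c ⟶ d), 1) ∈ (U'.graph x').edges :=
    (mem_graph_edges_mk hI h' _ _ _).2 ⟨Path.nil, rfl, hnil, hlen ▸ hβ, hlen ▸ hβ'⟩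
  rw [hq] at hαmem hβmem
  obtain ⟨v, hv, hvl, -⟩ := (mem_edgePath_edges q _).1 hαmem
  obtain ⟨w, hw, hwl, -⟩ := (mem_edgePath_edges q _).1 hβmem
  dsimp only at v hv hvl w hw hwl
  cases hv.eq_of_length_eq hw (by rw [Path.length_cons, Path.length_cons, hvl, hwl])
  exact hα hu

namespace IsMastTop

variable {U : Type*} [AddCommGroup U] [Module (PathAlgebra K V ⧸ I) U]
variable {a b : V} {p : Path a b} {x : U}

theorem smul_radPow_one (h : IsMastTop I p x) (hI : IsAdmissible I) {y : U}
    (hy : y ∈ radPow (PathAlgebra K V ⧸ I) U 1) : pathIn I p • y = 0 := by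
  rw [← Submodule.mem_bot (PathAlgebra K V ⧸ I), ← h.radPow_eq_bot, add_comm]
  exact pathIn_smul_mem_radPow hI p hy

/-- Adding a cyclic right subpath to a top element gives a top element. -/
theorem add_smul (h : IsMastTop I p x) (hI : IsAdmissible I) {w : Path a a}
    (hpos : 0 < w.length) (r : PathAlgebra K V ⧸ I)
    (hr : pathIn I (Path.nil : Path a a) • r • pathIn I w • x = r • pathIn I w • x) :
    IsMastTop I p (x + r • pathIn I w • x) := by
  refine h.change_top hI ?_ fun hmem => h.notMem_radPow_one hI ?_
  · rw [smul_add, h.idem, hr]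
  · have := Submodule.smul_mem _ r (radPow_antitone hpos (IsMastTop.smul_mem hI w x))
    simpa using Submodule.sub_mem _ hmem this

/-- If the cyclic right subpaths followed by `α` act as zero, then `α` annihilates the radical. -/
theorem arrow_smul_radPow_one {α : a ⟶ b} (h : IsMastTop I p x) (hI : IsAdmissible I)
    (hzero : ∀ w : Path a a, IsRightSubpath w p → 0 < w.length → pathIn I (w.cons α) • x = 0)
    {y : U} (hy : y ∈ radPow (PathAlgebra K V ⧸ I) U 1) : pathIn I α.toPath • y = 0 := by
  let _ : Module K U := Module.compHom U (algebraMap K (PathAlgebra K V ⧸ I))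
  have _ : IsScalarTower K (PathAlgebra K V ⧸ I) U :=
    IsScalarTower.of_algebraMap_smul fun _ _ => rfl
  obtain ⟨k, hk, hk1⟩ := h.exists_comb hI 1 hy a
  rw [← pathIn_smul_nil_smul, hk, IsMastTop.comb, Finsupp.linearCombination_apply, Finsupp.sum,
    Finset.smul_sum]
  refine Finset.sum_eq_zero fun v hv => ?_
  rw [← algebraMap_smul (PathAlgebra K V ⧸ I), smul_smul, ← Algebra.commutes, mul_smul,
    ← pathIn_cons_smul, hzero v.1 v.2 (hk1 v (Finsupp.mem_support_iff.1 hv)), smul_zero]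

end IsMastTop

/-! ### Shortest exceptional masts: circular halyards, or one-parameter families. -/

/-- The mast `p` is parallel to the arrow `α` but does not start with it, and all shorter masts of
positive length start with the arrows parallel to them. -/
structure IsMinimalExceptional (I : Ideal (PathAlgebra K V)) [I.IsTwoSided] {a b : V} (α : a ⟶ b)
    (p : Path a b) : Prop where
  isMast : IsMast I p
  pos : 0 < p.length
  not_start : ¬ IsRightSubpath α.toPath p
  shorter : ∀ (c d : V) (β : c ⟶ d) (q : Path c d), IsMast I q → 0 < q.length →
    q.length < p.length → IsRightSubpath β.toPath q

theorem exists_isMinimalExceptional (h : ¬ MastsStartWithArrows I) :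
    ∃ (a b : V) (α : a ⟶ b) (p : Path a b), IsMinimalExceptional I α p := by
  classical
  have hex : ∃ n, ∃ (a b : V) (α : a ⟶ b) (p : Path a b), IsMast I p ∧ 0 < p.length ∧
      ¬ IsRightSubpath α.toPath p ∧ p.length = n := by
    by_contra! hcon
    refine h fun a b α p hp hpos => ?_
    by_contra hα
    exact hcon _ a b α p hp hpos hα rfl
  obtain ⟨a, b, α, p, hp, hpos, hα, hlen⟩ := Nat.find_spec hex
  refine ⟨a, b, α, p, hp, hpos, hα, fun c d β q hq hqpos hlt => ?_⟩
  by_contra hβ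
  exact Nat.find_min hex (hlen ▸ hlt) ⟨c, d, β, q, hq, hqpos, hβ, rfl⟩

namespace IsMinimalExceptional

variable {a b : V} {α : a ⟶ b} {p : Path a b} (hm : IsMinimalExceptional I α p)

include hm

section

variable {U : Type max uK uV uE} [AddCommGroup U] [Module (PathAlgebra K V ⧸ I) U] {x : U}

/-- A leading term of αx shorter than p would be a shorter mast parallel to α. By minimality it
would start with α, and then so would p. So αx lies in the last layer. -/
theorem exists_smul_eq (hI : IsAdmissible I) (h : IsMastTop I p x) : ∃ c : K,
    pathIn I α.toPath • x = algebraMap K (PathAlgebra K V ⧸ I) c • pathIn I p • x := by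
  let _ : Module K U := Module.compHom U (algebraMap K (PathAlgebra K V ⧸ I))
  have _ : IsScalarTower K (PathAlgebra K V ⧸ I) U :=
    IsScalarTower.of_algebraMap_smul fun _ _ => rfl
  by_cases h0 : pathIn I α.toPath • x = 0
  · exact ⟨0, by rw [h0, map_zero, zero_smul]⟩
  obtain ⟨v, c, hv, hlt, -, hmem⟩ := h.exists_leading hI (IsMastTop.smul_mem hI α.toPath x) h0
    (nil_smul_pathIn_smul _ x)
  have hlen : v.length = p.length := by
    refine le_antisymm hv.length_le (not_lt.1 fun hvp => hm.not_start ?_)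
    have hv' : IsRightSubpath ((Path.nil : Path a a).comp v) p := by rwa [Path.nil_comp]
    exact (hm.shorter a b α v (h.isMast_segment hI hv') hlt hvp).trans hv
  obtain rfl : v = p := eq_of_heq (Sigma.mk.inj (hv.eq_self_of_length_eq hlen)).2
  rw [h.radPow_eq_bot, Submodule.mem_bot, sub_eq_zero] at hmem
  exact ⟨c, by rw [hmem, algebraMap_smul]⟩

theorem exists_smul_cycle_eq (hI : IsAdmissible I) (h : IsMastTop I p x) {w : Path a a}
    (hpos : 0 < w.length) : ∃ c : K, pathIn I (w.cons α) • x =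
      algebraMap K (PathAlgebra K V ⧸ I) c • pathIn I p • x := by
  -- The previous lemma applies to both top elements x and x + wx, and p sends them to the same
  -- element; the difference gives αwx.
  have h' := h.add_smul hI hpos 1 (by rw [one_smul, nil_smul_pathIn_smul])
  rw [one_smul] at h'
  obtain ⟨c, hc⟩ := hm.exists_smul_eq hI h
  obtain ⟨c', hc'⟩ := hm.exists_smul_eq hI h'
  rw [smul_add, smul_add, h.smul_radPow_one hI
    (radPow_antitone hpos (IsMastTop.smul_mem hI w x)), add_zero, hc, ← pathIn_cons_smul] at hc'
  exact ⟨c' - c, by rw [map_sub, sub_smul, ← hc', add_sub_cancel_left]⟩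

/-- Write p = w'w. The segment w' is a shorter mast parallel to α, so it starts with α, and αw is a
right subpath of p. As αwx is a multiple of px, nothing of p remains after αw. -/
theorem cons_eq (hI : IsAdmissible I) (h : IsMastTop I p x) {w : Path a a}
    (hw : IsRightSubpath w p) (hpos : 0 < w.length) (hne : pathIn I (w.cons α) • x ≠ 0) :
    w.cons α = p := by
  obtain ⟨c, hc⟩ := hm.exists_smul_cycle_eq hI h hpos
  obtain ⟨w', hp⟩ := hw
  have hlen : p.length = w.length + w'.length := by rw [hp, Path.length_comp]
  have hw'pos : 0 < w'.length := by
    by_contra h0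
    apply hne
    rw [← Submodule.mem_bot (PathAlgebra K V ⧸ I), ← h.radPow_eq_bot, hlen,
      Nat.eq_zero_of_not_pos h0]
    exact IsMastTop.smul_mem hI (w.cons α) x
  have hw' : IsMast I w' := h.isMast_segment hI (u := w) (hp ▸ IsRightSubpath.refl p)
  obtain ⟨c', hc'⟩ := hm.shorter a b α w' hw' hw'pos (by omega)
  have hr : IsRightSubpath (w.cons α) p := ⟨c', by rw [hp, hc', ← Path.comp_assoc]; rfl⟩
  have hge : p.length ≤ (w.cons α).length := by
    by_contra hlt
    refine h.smul_notMem hI hr ?_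
    rw [hc]
    exact Submodule.smul_mem _ _ (radPow_antitone (not_le.1 hlt) (IsMastTop.smul_mem hI p x))
  exact eq_of_heq (Sigma.mk.inj (hr.eq_self_of_length_eq (le_antisymm hr.length_le hge))).2

omit hm in
-- An isomorphism carries x to e·x' plus a radical element. Both α and p kill the radical of U', so
-- both see only the factor e, and the ratio of αx to px is preserved.
theorem eq_of_equiv (h : IsMastTop I p x) (hI : IsAdmissible I) {c : K}
    (hc : pathIn I α.toPath • x = algebraMap K (PathAlgebra K V ⧸ I) c • pathIn I p • x)
    {U' : Type max uK uV uE} [AddCommGroup U'] [Module (PathAlgebra K V ⧸ I) U'] {x' : U'}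
    (h' : IsMastTop I p x') {c' : K}
    (hc' : pathIn I α.toPath • x' = algebraMap K (PathAlgebra K V ⧸ I) c' • pathIn I p • x')
    (hzero : ∀ w : Path a a, IsRightSubpath w p → 0 < w.length → pathIn I (w.cons α) • x' = 0)
    (φ : U ≃ₗ[PathAlgebra K V ⧸ I] U') : c = c' := by
  let _ : Module K U' := Module.compHom U' (algebraMap K (PathAlgebra K V ⧸ I))
  have _ : IsScalarTower K (PathAlgebra K V ⧸ I) U' :=
    IsScalarTower.of_algebraMap_smul fun _ _ => rfl
  have hφ := h.map_equiv φ
  have hc1 : pathIn I α.toPath • φ x =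
      algebraMap K (PathAlgebra K V ⧸ I) c • pathIn I p • φ x := by
    rw [← map_smul, hc, map_smul, map_smul]
  obtain ⟨r, hr⟩ := Submodule.mem_span_singleton.1
    (show φ x ∈ Submodule.span (PathAlgebra K V ⧸ I) {x'} by
      rw [h'.span_eq_top hI]; trivial)
  obtain ⟨j, hj, hjr⟩ := smul_eq_vertexChar_smul_add hI h'.idem r
  rw [hr] at hjr
  have hjx : j • x' ∈ radPow (PathAlgebra K V ⧸ I) U' 1 :=
    smul_mem_radPow_succ (i := 0) hj trivial
  set e := vertexChar hI a r
  have hcomm : ∀ (s : K) (r : PathAlgebra K V ⧸ I) (y : U'), r • s • y = s • r • y := by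
    intro s r y
    rw [← algebraMap_smul (PathAlgebra K V ⧸ I) s, ← algebraMap_smul (PathAlgebra K V ⧸ I) s,
      smul_smul, smul_smul, Algebra.commutes]
  have hpφ : pathIn I p • φ x = e • pathIn I p • x' := by
    rw [hjr, smul_add, h'.smul_radPow_one hI hjx, add_zero, hcomm]
  have he : e ≠ 0 := fun h0 => hφ.ne_zero (by rw [hpφ, h0, zero_smul])
  rw [hpφ, hjr, smul_add, h'.arrow_smul_radPow_one hI hzero hjx, add_zero, hcomm, hc',
    algebraMap_smul, algebraMap_smul, smul_smul, smul_smul, ← sub_eq_zero, ← sub_smul,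
    smul_eq_zero] at hc1
  have := hc1.resolve_right h'.ne_zero
  rw [mul_comm, ← sub_mul] at this
  exact (sub_eq_zero.1 ((mul_eq_zero.1 this).resolve_right he)).symm

end

theorem exists_normalized (hI : IsAdmissible I) : ∃ (U : UniserialModule I) (x : U.carrier),
    IsMastTop I p x ∧ pathIn I α.toPath • x = pathIn I p • x := by
  obtain ⟨U, x, h⟩ := exists_isMastTop_of_isMast hI hm.isMast
  obtain ⟨c, hc⟩ := hm.exists_smul_eq hI h
  obtain ⟨U', f, hM, hK, hα', hq, -⟩ :=
    exists_uniserial_deformation hI h hm.pos α hm.not_start (1 - c)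
  refine ⟨U', f x, hM, ?_⟩
  refine hα'.trans (Eq.trans ?_ (hq a b p x fun he => hm.not_start ?_).symm)
  · rw [hc, ← add_smul, ← map_add, add_sub_cancel, map_one, one_smul]
  · cases he
    exact IsRightSubpath.refl _

/-- If the cyclic right subpaths followed by `α` act as zero, then there is a family of pairwise
non-isomorphic uniserial modules, nearly all of which have the same graph. -/
theorem exists_family (hI : IsAdmissible I) {U : UniserialModule I} {x : U.carrier}
    (h : IsMastTop I p x) (hx : pathIn I α.toPath • x = pathIn I p • x)
    (hzero : ∀ w : Path a a, IsRightSubpath w p → 0 < w.length → pathIn I (w.cons α) • x = 0)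
    (s : K) : ∃ (U' : UniserialModule I) (x' : U'.carrier), IsMastTop I p x' ∧
      pathIn I α.toPath • x' = algebraMap K (PathAlgebra K V ⧸ I) s • pathIn I p • x' ∧
      (∀ w : Path a a, IsRightSubpath w p → 0 < w.length → pathIn I (w.cons α) • x' = 0) ∧
      (s ≠ 0 → U'.graph x' = U.graph x) := by
  obtain ⟨U', f, hM, hK, hα', hq, hrad⟩ :=
    -- Since αx = px before the deformation, adding (s - 1)·px leaves s·px.
    exists_uniserial_deformation hI h hm.pos α hm.not_start (s - 1)
  have hpf : pathIn I p • f x = f (pathIn I p • x) := hq a b p x fun he => hm.not_start (by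
    cases he
    exact IsRightSubpath.refl _)
  have hs : pathIn I α.toPath • f x = f (algebraMap K (PathAlgebra K V ⧸ I) s • pathIn I p • x) := by
    rw [hα', hx]
    congr 1
    rw [map_sub, map_one, sub_smul, one_smul, add_sub_cancel]
  refine ⟨U', f x, hM, ?_, ?_, ?_⟩
  · exact hs.trans ((hK _ _).trans (congrArg _ hpf.symm))
  · intro w hw hpos
    refine (hq a b (w.cons α) x fun he => ?_).trans ?_
    · have := congrArg (fun q : Σ a b : V, Path a b => q.2.2.length) he
      simp only [Path.length_toPath, Path.length_cons] at this
      omega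
    · rw [hzero w hw hpos, map_zero]
  · intro hs0
    have hu : IsUnit (algebraMap K (PathAlgebra K V ⧸ I) s) :=
      (IsUnit.mk0 s hs0).map (algebraMap K (PathAlgebra K V ⧸ I))
    have key : ∀ {c : V} (u : Path a c) (i : ℕ), pathIn I u • f x ∈
        radPow (PathAlgebra K V ⧸ I) U'.carrier i ↔
          pathIn I u • x ∈ radPow (PathAlgebra K V ⧸ I) U.carrier i := by
      intro c u i
      -- Only the action of α itself has changed, from px to s·px; as s is a unit, the radical layer
      -- is the same.
      by_cases he : (⟨a, b, α.toPath⟩ : Σ a b : V, Path a b) = ⟨a, c, u⟩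
      · cases he
        rw [hs, hrad, hx]
        exact Submodule.smul_mem_iff_of_isUnit _ hu
      · rw [hq _ _ _ _ he, hrad]
    ext m
    · rw [mem_graph_vertices hI h, mem_graph_vertices hI hM]
    · rw [mem_graph_edges hI h, mem_graph_edges hI hM]
      refine exists_congr fun u => and_congr_right fun _ => ?_
      exact and_congr (not_congr (key _ _)) (and_congr (key _ _) (not_congr (key _ _)))

theorem isCircularHalyard (hI : IsAdmissible I) {U : UniserialModule I} {x : U.carrier}
    (h : IsMastTop I p x) (hx : pathIn I α.toPath • x = pathIn I p • x) {w : Path a a}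
    (hpos : 0 < w.length) (hw : w.cons α = p) : IsCircularHalyard I p Path.nil α := by
  have hU := hasMast_of_isMastTop hI h
  have hT := isTop_of_isMastTop hI h
  have hx' : pathIn I (Path.nil.cons α) • x = pathIn I p • x := hx
  refine ⟨⟨isDetour_nil hm.pos hm.not_start, U, x, hU, hT, ?_⟩, w, hpos, ?_, U, x, hU, hT, ?_⟩
  · rw [hx']
    exact h.ne_zero
  · rw [Path.nil_comp, hw]
    exact IsRightSubpath.refl p
  · rw [hx', Path.nil_comp, hw]

omit hm in
-- Since αwx = px = αx, the arrow α kills the top element x - wx. The edge labeled α leaving layer 0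
-- is present for x but not for x - wx.
theorem exists_graph_ne (hI : IsAdmissible I) {U : UniserialModule I} {x : U.carrier}
    (h : IsMastTop I p x) (hx : pathIn I α.toPath • x = pathIn I p • x) {w : Path a a}
    (hpos : 0 < w.length) (hw : w.cons α = p) :
    ∃ x' : U.carrier, U.IsTop x' ∧ U.graph x' ≠ U.graph x := by
  have h' := h.add_smul hI hpos (-1) (by
    rw [neg_smul, one_smul, smul_neg, nil_smul_pathIn_smul])
  refine ⟨_, isTop_of_isMastTop hI h', fun heq => ?_⟩
  have hmem : (0, (⟨a, b, α⟩ : Σ c d : V, c ⟶ d), p.length) ∈ (U.graph x).edges := by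
    refine (mem_graph_edges_mk hI h _ _ _).2 ⟨Path.nil, rfl, ?_, ?_, ?_⟩
    · rw [h.idem, zero_add]
      exact h.notMem_radPow_one hI
    · rw [pathIn_cons_smul, h.idem, hx]
      exact IsMastTop.smul_mem hI p x
    · rw [pathIn_cons_smul, h.idem, hx]
      exact h.smul_notMem hI (IsRightSubpath.refl p)
  rw [← heq] at hmem
  obtain ⟨u, hu, -, -, hnot⟩ := (mem_graph_edges_mk hI h' _ _ _).1 hmem
  cases u with
  | cons u β => simp at hu
  | nil =>
    apply hnot
    rw [pathIn_cons_smul, h'.idem, smul_add, hx, neg_smul, one_smul, smul_neg, ← pathIn_cons_smul,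
      hw, add_neg_cancel]
    exact Submodule.zero_mem _

end IsMinimalExceptional

theorem mastsStartWithArrows_of_finite [Infinite K] (hI : IsAdmissible I)
    (hfin : FiniteUniserialType I)
    (hhal : ∀ (a b c d : V) (p : Path a b) (u : Path a c) (α : c ⟶ d),
      IsMast I p → ¬ IsCircularHalyard I p u α) : MastsStartWithArrows I := by
  by_contra h2
  obtain ⟨a, b, α, p, hm⟩ := exists_isMinimalExceptional h2
  obtain ⟨U, x, h, hx⟩ := hm.exists_normalized hI
  have hzero : ∀ w : Path a a, IsRightSubpath w p → 0 < w.length →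
      pathIn I (w.cons α) • x = 0 := by
    intro w hw hpos
    by_contra hne
    exact hhal _ _ _ _ p Path.nil α hm.isMast
      (hm.isCircularHalyard hI h hx hpos (hm.cons_eq hI h hw hpos hne))
  choose U' x' h' hx' hzero' _ using hm.exists_family hI h hx hzero
  have : Finite (Quotient (uniserialSetoid I)) := hfin
  refine not_injective_infinite_finite (fun s : K => Quotient.mk (uniserialSetoid I) (U' s)) ?_
  intro s t hst
  obtain ⟨φ⟩ := Quotient.exact hst
  exact IsMinimalExceptional.eq_of_equiv (h' s) hI (hx' s) (h' t) (hx' t) (hzero' t) φ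

theorem mastsStartWithArrows_of_equiv [Infinite K] (hI : IsAdmissible I)
    (hΦ : ∃ Φ : UniserialType I ≃ uniserialGraphs I,
      ∀ (U : UniserialModule I) (x : U.carrier), U.IsTop x →
        (Φ (Quotient.mk (uniserialSetoid I) U) : LayeredGraph V) = U.graph x) :
    MastsStartWithArrows I := by
  obtain ⟨Φ, hΦ⟩ := hΦ
  by_contra h2
  obtain ⟨a, b, α, p, hm⟩ := exists_isMinimalExceptional h2
  obtain ⟨U, x, h, hx⟩ := hm.exists_normalized hI
  have hzero : ∀ w : Path a a, IsRightSubpath w p → 0 < w.length →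
      pathIn I (w.cons α) • x = 0 := by
    intro w hw hpos
    by_contra hne
    obtain ⟨x', hx', hg⟩ := IsMinimalExceptional.exists_graph_ne hI h hx hpos (hm.cons_eq hI h hw hpos hne)
    exact hg ((hΦ U x' hx').symm.trans (hΦ U x (isTop_of_isMastTop hI h)))
  choose U' x' h' hx' hzero' hg using hm.exists_family hI h hx hzero
  classical
  -- Avoiding 0 keeps the graph unchanged; avoiding 1 makes the module non-isomorphic to the member
  -- of the family with parameter 1.
  obtain ⟨t, ht⟩ := Infinite.exists_notMem_finset ({0, 1} : Finset K)
  simp only [Finset.mem_insert, Finset.mem_singleton, not_or] at ht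
  have heq : Quotient.mk (uniserialSetoid I) (U' t) = Quotient.mk (uniserialSetoid I) (U' 1) := by
    apply Φ.injective
    apply Subtype.ext
    rw [hΦ _ _ (isTop_of_isMastTop hI (h' t)), hΦ _ _ (isTop_of_isMastTop hI (h' 1)), hg t ht.1,
      hg 1 one_ne_zero]
  obtain ⟨φ⟩ := Quotient.exact heq
  exact ht.2 (IsMinimalExceptional.eq_of_equiv (h' t) hI (hx' t) (h' 1) (hx' 1) (hzero' 1) φ)

end PathAlgebra

/-! ### The equivalences, all routed through the condition on masts and parallel arrows. -/

open PathAlgebra in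
theorem theorem4p1 {K : Type uK} [Field K] [Infinite K]
    {V : Type uV} [Quiver.{uE} V] [Fintype V] [∀ a b : V, Finite (a ⟶ b)]
    (I : Ideal (PathAlgebra K V)) [I.IsTwoSided] (hI : IsAdmissible I) :
    List.TFAE [
      ∀ (a b : V) (p : Path a b), (uniserialVariety I p).Finite,
      ∀ (a b : V) (p : Path a b),
        uniserialVariety I p = ∅ ∨ ∃ k : DetourVar p → K, uniserialVariety I p = {k},
      ∀ (e e' : V) (α : e ⟶ e') (p : Path e e'), IsMast I p → 0 < p.length →
        ∃ c' : Path e' e', p = α.toPath.comp c',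
      FiniteUniserialType I ∧
        ∀ (a b c d : V) (p : Path a b) (u : Path a c) (α : c ⟶ d),
          IsMast I p → ¬ IsCircularHalyard I p u α,
      ∃ Φ : UniserialType I ≃ uniserialGraphs I,
        ∀ (U : UniserialModule I) (x : U.carrier), U.IsTop x →
          (Φ (Quotient.mk (uniserialSetoid I) U) : LayeredGraph V) = U.graph x,
      ∀ G ∈ uniserialGraphs I, G.IsEdgePath] := by
  tfae_have 2 → 1 := by
    intro h a b p
    rcases h a b p with h | ⟨k, h⟩
    · rw [h]; exact Set.finite_empty
    · rw [h]; exact Set.finite_singleton k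
  tfae_have 1 → 3 := by
    intro h a b α p hp hpos
    by_contra hα
    exact infinite_uniserialVariety hI hp hpos hα (h a b p)
  tfae_have 3 → 2 := fun h _ _ p => MastsStartWithArrows.eq_empty_or_singleton h hI p
  tfae_have 3 → 4 := fun h => ⟨MastsStartWithArrows.finiteUniserialType h hI,
    fun _ _ _ _ p u α _ hc => MastsStartWithArrows.not_isHalyard h hI p u α hc.1⟩
  tfae_have 4 → 3 := fun h => mastsStartWithArrows_of_finite hI h.1 h.2
  tfae_have 3 → 5 := fun h => MastsStartWithArrows.exists_equiv_graphs h hI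
  tfae_have 5 → 3 := fun h => mastsStartWithArrows_of_equiv hI h
  tfae_have 3 → 6 := fun h _ hG => MastsStartWithArrows.isEdgePath h hI hG
  tfae_have 6 → 3 := by
    intro h a b α p hp hpos
    by_contra hα
    obtain ⟨G, hG, hne⟩ := exists_not_isEdgePath hI hp hpos hα
    exact hne (h G hG)
  tfae_finish
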